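/- The base field is $\mathbb C$. Classical simple Lie algebras have type $A$ ($\mathfrak{sl}(n)$), $C$ ($\mathfrak{sp}(n)$, $n$ even) or $O$ ($\mathfrak{so}(n)$). An injective homomorphism $\mathfrak g\to\mathfrak h$ of finite-dimensional classical simple Lie algebras with natural modules $V,W$ is \emph{diagonal of signature} $(l,r,z)$ if $W|_{\mathfrak g}\cong V^{\oplus l}\oplus (V^*)^{\oplus r}\oplus \mathbb C^{\oplus z}$, where $\mathbb C$ is the trivial module. An \emph{exhaustion} of a Lie algebra is an increasing sequence of finite-dimensional subalgebras whose union is the algebra. An injective homomorphism $\theta:\mathfrak s_1\to\mathfrak s_2$ is \emph{diagonal} if there are exhaustions $(\mathfrak g_i)$ of $\mathfrak s_1$ and $(\mathfrak h_i)$ of $\mathfrak s_2$ with $\theta(\mathfrak g_i)\subseteq\mathfrak h_i$ for all $i$, such that for all sufficiently large $i$ the algebras $\mathfrak g_i,\mathfrak h_i$ are classical simple and $\theta|_{\mathfrak g_i}:\mathfrak g_i\to\mathfrak h_i$ is diagonal. Let $\mathcal T=\{(l_i,r_i,z_i)\}_{i\ge1}$ be a sequence of triples of non-negative integers with $l_i\ge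 r_i$, $l_i>0$ and $r_1=z_1=0$. Put $s_i=l_i+r_i$, $c_i=l_i-r_i$, $n_1=1$, $n_{i+1}=s_in_i+z_i$. For $X\in\{A,C,O\}$ one writes $\mathfrak s=X(\mathcal T)$ if $\mathfrak s$ has an exhaustion $\mathfrak g_2\subset\mathfrak g_3\subset\cdots$ by classical simple Lie algebras of type $X$, where the natural module of $\mathfrak g_i$ has dimension $n_i$ and the inclusion $\mathfrak g_i\subset\mathfrak g_{i+1}$ is diagonal of signature $(l_i,r_i,z_i)$; here $r_i=0$ for all $i$ if $X\ne A$. Let $$\delta(\mathcal T)=\lim_{i\to\infty}\delta_i,\quad \delta_i=\frac{s_1\cdots s_{i-1}}{n_i},\qquad \sigma(\mathcal T)=\lim_{i\to\infty}\frac{c_1\cdots c_i}{s_1\cdots s_i}.$$ $\mathcal T$ is \emph{sparse} if $\delta(\mathcal T)=0$, \emph{pure} if for some $i$ one has $\delta_j=\delta_i\neq0$ for all $j>i$, and \emph{dense} if $0<\delta(\mathcal T)<\delta_i$ for all $i$. It is \emph{one-sided} if $c_j=s_j$ for all sufficiently large $j$, and \emph{two-sided} otherwise; it is \emph{symmetric}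 if $c_j=0$ for infinitely many $j$, and \emph{non-symmetric} otherwise, in which case it is assumed that $c_i>0$ for all $i$. A two-sided non-symmetric sequence is \emph{weakly non-symmetric} if $\sigma(\mathcal T)=0$ and \emph{strongly non-symmetric} if $\sigma(\mathcal T)\ne0$. The same words are used for $\mathfrak s=X(\mathcal T)$. A \emph{Steinitz number} is a formal product $\prod_p p^{\alpha_p}$ over all primes with $\alpha_p\in\{0,1,2,\dots\}\cup\{\infty\}$; $\mathrm{GCD}$ is taken primewise, and if $\Pi$ divides $\Pi'$, the quotient $\div(\Pi',\Pi)$ is obtained by subtracting exponents, with $\infty-\infty=0$. For a sequence $(a_i)$ of positive integers $\mathrm{Stz}((a_i))$ is $\prod_i a_i$ as a Steinitz number. A finite Steinitz number is identified with a positive integer. \textbf{Lemma.} Let $\mathfrak s_1=X_1(\mathcal T_1)$ and $\mathfrak s_2=X_2(\mathcal T_2)$ be infinite-dimensional non-sparse diagonal Lie algebras (such algebras are automatically non-finitary, i.e. not isomorphic to $\mathfrak{sl}(\infty)$, $\mathfrak{so}(\infty)$ or $\mathfrak{sp}(\infty)$). Let $\mathcal S_i$ and $\mathcal C_i$ be the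 sequences of the numbers $s_j$ and $c_j$ of $\mathcal T_i$, and for $i=1,2$ put $$S_i=\mathrm{Stz}(\mathcal S_i),\ S=\mathrm{GCD}(S_1,S_2),\ R_i=\div(S_i,S),\ C_i=\mathrm{Stz}(\mathcal C_i),\ C=\mathrm{GCD}(C_1,C_2),\ B_i=\div(C_i,C),$$ $\delta_i=\delta(\mathcal T_i)$, $\sigma_i=\sigma(\mathcal T_i)$. Assume that $S$ is not divisible by $p^\infty$ for any prime $p$ and that $R_1$ and $R_2$ are finite. If $\mathfrak s_1$ admits a diagonal injective homomorphism into $\mathfrak s_2$, then the following holds. (i) $\dfrac{R_1}{\delta_1}\le\dfrac{R_2}{\delta_2}$, and the inequality is strict if $\mathfrak s_1$ is pure and $\mathfrak s_2$ is dense. (ii) $2\dfrac{R_1}{\delta_1}\le\dfrac{R_2}{\delta_2}$, again with strict inequality if $\mathfrak s_1$ is pure and $\mathfrak s_2$ is dense, whenever one of the following additional hypotheses holds: - $(X_1,X_2)$ is one of $(A,C)$, $(A,O)$, $(O,C)$, $(C,O)$; - $(X_1,X_2)=(A,A)$ and $B_1$ is infinite; - $(X_1,X_2)=(A,A)$, $B_1$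 is finite, $\mathfrak s_1$ is two-sided weakly non-symmetric, and $\mathfrak s_2$ is either one-sided or two-sided strongly non-symmetric; - $(X_1,X_2)=(A,A)$, $B_1$ and $B_2$ are finite, $C$ is not divisible by $p^\infty$ for any prime $p$, $\mathfrak s_1$ and $\mathfrak s_2$ are both two-sided strongly non-symmetric, and $\dfrac{R_1\sigma_1}{B_1}<\dfrac{R_2\sigma_2}{B_2}$. -/

import Mathlib

open Filter Topology

noncomputable section

attribute [local instance] LieRing.ofAssociativeRing

/-! ### Steinitz numbers -/

/-- A Steinitz number: an exponent in `{0, 1, 2, …} ∪ {∞}` for every prime. -/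
abbrev SteinitzNumber : Type := Nat.Primes → ℕ∞

namespace SteinitzNumber

/-- The infinite product `∏ᵢ sᵢ` of a sequence of positive integers, as a Steinitz number. -/
def stz (s : ℕ → ℕ) : SteinitzNumber :=
  fun p => ⨆ N : ℕ, ∑ i ∈ Finset.range N, (padicValNat (p : ℕ) (s i) : ℕ∞)

/-- The greatest common divisor: the primewise minimum of the exponents. -/
def gcd (P Q : SteinitzNumber) : SteinitzNumber := fun p => min (P p) (Q p)

/-- The quotient of `P` by a divisor `Q`. The exponents are subtracted; in `ℕ∞` one has
`⊤ - ⊤ = 0`, which is the convention `p ^ (∞ - ∞) = 1`. -/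
def quot (P Q : SteinitzNumber) : SteinitzNumber := fun p => P p - Q p

/-- `P` is finite, i.e. it is an ordinary positive integer. -/
def IsFinite (P : SteinitzNumber) : Prop := (∀ p, P p ≠ ⊤) ∧ {p | P p ≠ 0}.Finite

/-- The positive integer given by a finite Steinitz number. -/
def value (P : SteinitzNumber) : ℕ := ∏ᶠ p : Nat.Primes, (p : ℕ) ^ (P p).toNat

/-- `P` is not divisible by `p ^ ∞` for any prime `p`. -/
def NoInfinitePower (P : SteinitzNumber) : Prop := ∀ p, P p ≠ ⊤

end SteinitzNumber

/-! ### Classical simple Lie algebras and diagonal homomorphisms -/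

/-- The three types of classical simple Lie algebras; `O` stands for both `B` and `D`. -/
inductive ClassicalType
  | A
  | C
  | O

/-- The antidiagonal matrix with entries `1` above and `-1` below the middle. For even `n` it is
the Gram matrix of a nondegenerate alternating form on `ℂⁿ`. -/
def alternatingForm (n : ℕ) : Matrix (Fin n) (Fin n) ℂ :=
  Matrix.of fun i j => if (i : ℕ) + (j : ℕ) + 1 = n then (if i < j then 1 else -1) else 0

/-- The classical Lie algebra of type `X` whose natural module is `ℂⁿ`: `sl(n)`, `sp(n)`
(for even `n`) and `so(n)`. -/
def classicalLieAlgebra : ClassicalType → (n : ℕ) → LieSubalgebra ℂ (Matrix (Fin n) (Fin n) ℂ)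
  | .A, n => LieAlgebra.SpecialLinear.sl (Fin n) ℂ
  | .C, n => skewAdjointMatricesLieSubalgebra (alternatingForm n)
  | .O, n => LieAlgebra.Orthogonal.so (Fin n) ℂ

/-- The dimensions `n` of the natural module for which the classical Lie algebra of type `X`
is defined and simple. -/
def IsSimpleDim : ClassicalType → ℕ → Prop
  | .A, n => 2 ≤ n
  | .C, n => 2 ≤ n ∧ Even n
  | .O, n => 3 ≤ n ∧ n ≠ 4

/-- A homomorphism `φ` of classical Lie algebras with natural modules `V₁ = ℂⁿ` and `V₂ = ℂᵐ` has
signature `(l, r, z)` if, as a module over the source, `V₂` is isomorphic to the direct sum of `l`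
copies of `V₁`, of `r` copies of `V₁*` (on `ℂⁿ`, in the dual basis, `x` acts by `-xᵀ`), and of `z`
copies of the trivial one-dimensional module. -/
def HasSignature {X Y : ClassicalType} {n m : ℕ}
    (φ : classicalLieAlgebra X n →ₗ⁅ℂ⁆ classicalLieAlgebra Y m) (l r z : ℕ) : Prop :=
  ∃ Φ : (Fin m → ℂ) ≃ₗ[ℂ] (Fin l → Fin n → ℂ) × (Fin r → Fin n → ℂ) × (Fin z → ℂ),
    ∀ (x : classicalLieAlgebra X n) (v : Fin m → ℂ),
      Φ ((φ x : Matrix (Fin m) (Fin m) ℂ).mulVec v) =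
        (fun a => (x : Matrix (Fin n) (Fin n) ℂ).mulVec ((Φ v).1 a),
          fun b => (-(x : Matrix (Fin n) (Fin n) ℂ).transpose).mulVec ((Φ v).2.1 b),
          0)

/-- A homomorphism `φ : g → h`, read through identifications of `g` and `h` with classical Lie
algebras (which turn `ℂⁿ` and `ℂᵐ` into the natural modules of `g` and `h`). -/
def readThrough {g h : Type*} [LieRing g] [LieAlgebra ℂ g] [LieRing h] [LieAlgebra ℂ h]
    {X Y : ClassicalType} {n m : ℕ} (e : g ≃ₗ⁅ℂ⁆ classicalLieAlgebra X n)
    (f : h ≃ₗ⁅ℂ⁆ classicalLieAlgebra Y m) (φ : g →ₗ⁅ℂ⁆ h) :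
    classicalLieAlgebra X n →ₗ⁅ℂ⁆ classicalLieAlgebra Y m :=
  f.toLieHom.comp (φ.comp e.symm.toLieHom)

/-- `g` and `h` are finite-dimensional classical simple Lie algebras and the injective
homomorphism `φ : g → h` is diagonal. -/
def IsDiagonalFinite {g h : Type*} [LieRing g] [LieAlgebra ℂ g] [LieRing h] [LieAlgebra ℂ h]
    (φ : g →ₗ⁅ℂ⁆ h) : Prop :=
  Function.Injective φ ∧
    ∃ (X Y : ClassicalType) (n m : ℕ) (e : g ≃ₗ⁅ℂ⁆ classicalLieAlgebra X n)
      (f : h ≃ₗ⁅ℂ⁆ classicalLieAlgebra Y m) (l r z : ℕ),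
      IsSimpleDim X n ∧ IsSimpleDim Y m ∧ HasSignature (readThrough e f φ) l r z

/-- An exhaustion of a Lie algebra: an increasing sequence of finite-dimensional subalgebras
whose union is the whole algebra. -/
structure IsExhaustion {L : Type*} [LieRing L] [LieAlgebra ℂ L]
    (g : ℕ → LieSubalgebra ℂ L) : Prop where
  monotone : Monotone g
  finiteDimensional : ∀ i, FiniteDimensional ℂ (g i)
  exhausts : ∀ x : L, ∃ i, x ∈ g i

/-- The restriction `g → h` of a homomorphism of Lie algebras which maps `g` into `h`. -/
def restrictHom {L M : Type*} [LieRing L] [LieAlgebra ℂ L] [LieRing M] [LieAlgebra ℂ M]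
    (θ : L →ₗ⁅ℂ⁆ M) (g : LieSubalgebra ℂ L) (h : LieSubalgebra ℂ M)
    (hgh : ∀ x ∈ g, θ x ∈ h) : g →ₗ⁅ℂ⁆ h where
  toFun x := ⟨θ x, hgh x x.2⟩
  map_add' x y := by ext; simp
  map_smul' c x := by ext; simp
  map_lie' := by intro x y; ext; simp

/-- An injective homomorphism `θ : L → M` is diagonal if there are exhaustions `(gᵢ)` of `L` and
`(hᵢ)` of `M` such that `θ` restricts to homomorphisms `θᵢ : gᵢ → hᵢ`, and for all sufficiently
large `i` the algebras `gᵢ`, `hᵢ` are classical simple and `θᵢ` is diagonal. -/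
def IsDiagonalHom {L M : Type*} [LieRing L] [LieAlgebra ℂ L] [LieRing M] [LieAlgebra ℂ M]
    (θ : L →ₗ⁅ℂ⁆ M) : Prop :=
  Function.Injective θ ∧
    ∃ (g : ℕ → LieSubalgebra ℂ L) (h : ℕ → LieSubalgebra ℂ M)
      (hgh : ∀ i, ∀ x ∈ g i, θ x ∈ h i),
      IsExhaustion g ∧ IsExhaustion h ∧
        ∃ i₀, ∀ i, i₀ ≤ i → IsDiagonalFinite (restrictHom θ (g i) (h i) (hgh i))

/-! ### Sequences of triples -/

/-- A triple `(l, r, z)` of non-negative integers. -/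
structure SignatureTriple where
  l : ℕ
  r : ℕ
  z : ℕ

namespace SignatureTriple

/-- `sᵢ = lᵢ + rᵢ`. -/
def s (T : ℕ → SignatureTriple) (i : ℕ) : ℕ := (T i).l + (T i).r

/-- `cᵢ = lᵢ - rᵢ` (it is assumed that `rᵢ ≤ lᵢ`). -/
def c (T : ℕ → SignatureTriple) (i : ℕ) : ℕ := (T i).l - (T i).r

/-- The dimensions of the natural modules: `n₀ = 1` and `nᵢ₊₁ = sᵢ nᵢ + zᵢ`. -/
def dim (T : ℕ → SignatureTriple) : ℕ → ℕ
  | 0 => 1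
  | i + 1 => s T i * dim T i + (T i).z

/-- `δᵢ = s₀ ⋯ sᵢ₋₁ / nᵢ`. -/
def densitySeq (T : ℕ → SignatureTriple) (i : ℕ) : ℝ :=
  (∏ j ∈ Finset.range i, (s T j : ℝ)) / (dim T i : ℝ)

/-- The density index `δ = lim δᵢ`. -/
def densityIndex (T : ℕ → SignatureTriple) : ℝ := limUnder atTop (densitySeq T)

/-- `σᵢ = c₀ ⋯ cᵢ / (s₀ ⋯ sᵢ)`. -/
def symmetrySeq (T : ℕ → SignatureTriple) (i : ℕ) : ℝ :=
  (∏ j ∈ Finset.range (i + 1), (c T j : ℝ)) / ∏ j ∈ Finset.range (i + 1), (s T j : ℝ)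

/-- The symmetry index `σ = lim σᵢ`. -/
def symmetryIndex (T : ℕ → SignatureTriple) : ℝ := limUnder atTop (symmetrySeq T)

def IsSparse (T : ℕ → SignatureTriple) : Prop := densityIndex T = 0

def IsPure (T : ℕ → SignatureTriple) : Prop :=
  ∃ i, densitySeq T i ≠ 0 ∧ ∀ j, i < j → densitySeq T j = densitySeq T i

def IsDense (T : ℕ → SignatureTriple) : Prop :=
  0 < densityIndex T ∧ ∀ i, densityIndex T < densitySeq T i

def IsOneSided (T : ℕ → SignatureTriple) : Prop := ∃ i, ∀ j, i ≤ j → c T j = s T j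

def IsTwoSided (T : ℕ → SignatureTriple) : Prop := ¬ IsOneSided T

def IsSymmetric (T : ℕ → SignatureTriple) : Prop := ∀ i, ∃ j, i < j ∧ c T j = 0

def IsWeaklyNonSymmetric (T : ℕ → SignatureTriple) : Prop :=
  IsTwoSided T ∧ ¬ IsSymmetric T ∧ symmetryIndex T = 0

def IsStronglyNonSymmetric (T : ℕ → SignatureTriple) : Prop :=
  IsTwoSided T ∧ ¬ IsSymmetric T ∧ symmetryIndex T ≠ 0

/-- The conventions on the sequence of triples of a diagonal Lie algebra of type `X`. The initial
triple is `(n, 0, 0)`, where `n` is the dimension of the natural module of the first algebra of the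
exhaustion. -/
structure IsAdmissible (X : ClassicalType) (T : ℕ → SignatureTriple) : Prop where
  initial_r : (T 0).r = 0
  initial_z : (T 0).z = 0
  l_pos : ∀ i, 0 < (T i).l
  r_le_l : ∀ i, (T i).r ≤ (T i).l
  r_eq_zero : X ≠ ClassicalType.A → ∀ i, (T i).r = 0
  c_pos : ¬ IsSymmetric T → ∀ i, 0 < c T i

lemma IsAdmissible.dim_pos {X : ClassicalType} {T : ℕ → SignatureTriple}
    (hT : IsAdmissible X T) (i : ℕ) : 0 < dim T i := by
  induction i with
  | zero => simp [dim]
  | succ i ih =>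
    have h : 0 < s T i := Nat.add_pos_left (hT.l_pos i) _
    exact Nat.add_pos_left (Nat.mul_pos h ih) _

/-- The limit that defines the density index exists. -/
lemma IsAdmissible.tendsto_densitySeq {X : ClassicalType} {T : ℕ → SignatureTriple}
    (hT : IsAdmissible X T) : Tendsto (densitySeq T) atTop (𝓝 (densityIndex T)) := by
  have hnn : ∀ i, 0 ≤ densitySeq T i := fun i => by unfold densitySeq; positivity
  have hanti : Antitone (densitySeq T) := by
    refine antitone_nat_of_succ_le fun i => ?_
    have h1 : (0 : ℝ) < dim T i := by exact_mod_cast hT.dim_pos i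
    have h2 : (0 : ℝ) < dim T (i + 1) := by exact_mod_cast hT.dim_pos (i + 1)
    have h3 : (dim T (i + 1) : ℝ) = s T i * dim T i + (T i).z := by
      simp [dim]
    have h4 : (0 : ℝ) ≤ ∏ j ∈ Finset.range i, (s T j : ℝ) := by positivity
    unfold densitySeq
    rw [div_le_div_iff₀ h2 h1, Finset.prod_range_succ, h3]
    have h5 : (0 : ℝ) ≤ (T i).z := by positivity
    nlinarith [mul_nonneg h4 h5]
  have hb : BddBelow (Set.range (densitySeq T)) := ⟨0, by rintro _ ⟨i, rfl⟩; exact hnn i⟩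
  exact tendsto_nhds_limUnder ⟨_, tendsto_atTop_ciInf hanti hb⟩

/-- The limit that defines the symmetry index exists. -/
lemma IsAdmissible.tendsto_symmetrySeq {X : ClassicalType} {T : ℕ → SignatureTriple}
    (hT : IsAdmissible X T) : Tendsto (symmetrySeq T) atTop (𝓝 (symmetryIndex T)) := by
  have hnn : ∀ i, 0 ≤ symmetrySeq T i := fun i => by unfold symmetrySeq; positivity
  have hanti : Antitone (symmetrySeq T) := by
    refine antitone_nat_of_succ_le fun i => ?_
    have hs : (0 : ℝ) < s T (i + 1) := by
      exact_mod_cast Nat.add_pos_left (hT.l_pos (i + 1)) _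
    have hc : (c T (i + 1) : ℝ) ≤ s T (i + 1) := by
      exact_mod_cast (Nat.sub_le _ _).trans (Nat.le_add_right _ _)
    have h : symmetrySeq T (i + 1) = symmetrySeq T i * (c T (i + 1) / s T (i + 1)) := by
      unfold symmetrySeq
      rw [Finset.prod_range_succ _ (i + 1), Finset.prod_range_succ _ (i + 1), mul_div_mul_comm]
    rw [h]
    exact mul_le_of_le_one_right (hnn i) ((div_le_one hs).2 hc)
  have hb : BddBelow (Set.range (symmetrySeq T)) := ⟨0, by rintro _ ⟨i, rfl⟩; exact hnn i⟩
  exact tendsto_nhds_limUnder ⟨_, tendsto_atTop_ciInf hanti hb⟩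

end SignatureTriple

/-- `L` is the diagonal Lie algebra `X(T)`: it has an exhaustion `g₀ ⊆ g₁ ⊆ ⋯` by classical simple
subalgebras of type `X`, where the natural module of `gᵢ` has dimension `nᵢ₊₁` and the inclusion
of `gᵢ` into `gᵢ₊₁` is diagonal of signature `Tᵢ₊₁`. -/
def IsDiagonalLieAlgebra (X : ClassicalType) (T : ℕ → SignatureTriple)
    (L : Type*) [LieRing L] [LieAlgebra ℂ L] : Prop :=
  ∃ (g : ℕ → LieSubalgebra ℂ L) (hg : IsExhaustion g)
    (e : ∀ i, g i ≃ₗ⁅ℂ⁆ classicalLieAlgebra X (SignatureTriple.dim T (i + 1))),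
    ∀ i, IsSimpleDim X (SignatureTriple.dim T (i + 1)) ∧
      HasSignature
        (readThrough (e i) (e (i + 1)) (LieSubalgebra.inclusion (hg.monotone (Nat.le_succ i))))
        (T (i + 1)).l (T (i + 1)).r (T (i + 1)).z

end

/-! Call x, y orthogonal if xy = yx = 0 in the natural module. Diagonal homomorphisms preserve
orthogonality, and this property can be pulled back. If ψ is injective and ψφ preserves
orthogonality, then [φx,[φy,[φz,A]]] = 0 for pairwise orthogonal x, y, z: under ψ each of the eight
terms has two of the three images adjacent on one side of ψA (`triple_lie_eq_zero`). In large enough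
dimension, vanishing triple brackets force vanishing products of images of matrix units
(`frame_mul_eq_zero`). The resulting relations produce matrix units, so that φ = ρ₁ − ρ₂ for a
homomorphism ρ₁ and an antihomomorphism ρ₂ of matrix algebras with orthogonal images
(`exists_isSplit`). Interleaving the given exhaustions with those in the definition of a diagonal
homomorphism, θ splits on every pair g_a → h_b with a and then b large, with multiplicities l, r of
the natural module and its dual.

Traces see the multiplicities: tr φ(x)² = (l+r) tr x² and tr φ(x)³ = (l−r) tr x³. Along the
exhaustions these traces scale by s_k and c_k. Hence J = l+r satisfies J·∏_{k≤a} s_k(T₁)·v =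
u·∏_{k≤b} s_k(T₂), and for source type A the number D = l−r satisfies the analogous relation in the
c_k with constants v', w; none of u, v, w, v' depends on a, b (`exists_multiplicity_ratios`).
Comparing dimensions gives uδ₂ ≤ vδ₁ (`density_le`), comparing p-adic valuations gives R₁v ∣ uR₂
(`mul_value_dvd`), and together these give (i).

For (ii) it is enough that 2R₁v ≤ uR₂, which holds if J is always even or if R₁v ≠ uR₂. For mixed
types J is even: cube traces vanish on `C` and `O`, so l = r when the source has type `A`; between
`O` and `C` the multiplicity space carries a nondegenerate skew form. For (A,A), w = 0 means l = r,
so J is even again. If w ≠ 0, the relation for D makes B₁ finite, and |D| ≤ J gives |w|vσ₂ ≤ uv'σ₁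
in the limit; this excludes the second and third hypotheses. Under the fourth, B₁v' ≤ |w|B₂ and R₁v
= uR₂ would give R₂σ₂/B₂ ≤ R₁σ₁/B₁, a contradiction. -/

noncomputable section

attribute [local instance] LieRing.ofAssociativeRing

/-! ### Orthogonality from vanishing triple brackets -/

section RingIdentities

variable {R : Type*} [Ring R]

/-- Comparing an identity for `A` and for `w * A` replaces the commutator with `u` by the left
multiplication by the commutator of `w` and `u`. -/
lemma mul_bracket_eq_zero {p u w : R} {Ψ : R → R}
    (h : ∀ A, p * (u * Ψ A - Ψ A * u) = 0) (hw : ∀ A, Ψ (w * A) = w * Ψ A)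
    (hp : w * p = p * w) (A : R) :
    p * (w * u - u * w) * Ψ A = 0 := by
  have h1 := h A
  have h2 := h (w * A)
  rw [hw] at h2
  have e1 : w * (p * (u * Ψ A - Ψ A * u)) = p * (w * (u * Ψ A - Ψ A * u)) := by
    rw [← mul_assoc, hp, mul_assoc]
  -- The Leibniz rule [w,u]B = w[u,B] − [u,wB] with B = Ψ A.
  calc p * (w * u - u * w) * Ψ A
      = p * (w * (u * Ψ A - Ψ A * u)) - p * (u * (w * Ψ A) - w * Ψ A * u) := by noncomm_ring
    _ = 0 := by rw [← e1, h1, h2]; simp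

/-- The version of `mul_bracket_eq_zero` for the anticommutator with `z`. -/
lemma mul_bracket_anticomm_eq_zero {p u w z : R} {Ψ : R → R}
    (h : ∀ A, z * (p * (u * Ψ A - Ψ A * u)) + p * (u * Ψ A - Ψ A * u) * z = 0)
    (hw : ∀ A, Ψ (w * A) = w * Ψ A) (hp : w * p = p * w) (hz : w * z = z * w) (A : R) :
    z * (p * (w * u - u * w) * Ψ A) + p * (w * u - u * w) * Ψ A * z = 0 := by
  have h1 := h A
  have h2 := h (w * A)
  rw [hw] at h2
  have e1 : w * (z * (p * (u * Ψ A - Ψ A * u)) + p * (u * Ψ A - Ψ A * u) * z)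
      = z * (p * (w * (u * Ψ A - Ψ A * u))) + p * (w * (u * Ψ A - Ψ A * u)) * z := by
    rw [mul_add, ← mul_assoc w z, hz, mul_assoc z w, ← mul_assoc w p, hp, mul_assoc p w,
      ← mul_assoc w (p * _) z, ← mul_assoc w p, hp, mul_assoc p w]
  calc z * (p * (w * u - u * w) * Ψ A) + p * (w * u - u * w) * Ψ A * z
      = z * (p * (w * (u * Ψ A - Ψ A * u))) + p * (w * (u * Ψ A - Ψ A * u)) * z
        - (z * (p * (u * (w * Ψ A) - w * Ψ A * u)) + p * (u * (w * Ψ A) - w * Ψ A * u) * z) := by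
        noncomm_ring
    _ = 0 := by rw [← e1, h1, h2]; simp

lemma mul_left_commutator {u w : R} (h : w * u = u * w) (B : R) :
    u * (w * B) - w * B * u = w * (u * B - B * u) := by
  rw [mul_sub, ← mul_assoc, ← h, mul_assoc, mul_assoc w B]

end RingIdentities

/-- Matrix algebras are prime: A = E_jk links a nonzero entry (i,j) of p to a nonzero entry (k,l) of
q. -/
lemma Matrix.eq_zero_or_eq_zero_of_mul_mul {m : Type*} [Fintype m] [DecidableEq m]
    {p q : Matrix m m ℂ} (h : ∀ A : Matrix m m ℂ, p * A * q = 0) : p = 0 ∨ q = 0 := by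
  by_contra! hpq
  obtain ⟨hp, hq⟩ := hpq
  have hp' : ∃ i j, p i j ≠ 0 := by
    by_contra! hc; exact hp (by ext i j; exact hc i j)
  have hq' : ∃ i j, q i j ≠ 0 := by
    by_contra! hc; exact hq (by ext i j; exact hc i j)
  obtain ⟨i, j, hij⟩ := hp'
  obtain ⟨k, l, hkl⟩ := hq'
  have h1 := congrFun (congrFun (h (Matrix.single j k 1)) i) l
  rw [Matrix.mul_apply, Finset.sum_eq_single k] at h1
  · simp [hij, hkl] at h1
  · intro b _ hb
    rw [Matrix.mul_single_apply_of_ne _ _ _ _ _ hb, zero_mul]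
  · simp

/-- The relations between the images of the elements `E_ab` (suitably symmetrized) whose indices
lie in twelve different classes. -/
structure BracketFrame {R : Type*} [Ring R] (f : Fin 12 → Fin 12 → R) : Prop where
  bracket : ∀ i j k, i ≠ j → j ≠ k → i ≠ k → f i j * f j k - f j k * f i j = f i k
  comm : ∀ i j k l, i ≠ j → i ≠ k → i ≠ l → j ≠ k → j ≠ l → k ≠ l →
    f i j * f k l = f k l * f i j

/-! ### From vanishing triple brackets to vanishing products -/

namespace BracketFrame

section
variable {R : Type*} [Ring R] {f : Fin 12 → Fin 12 → R}

/-- Since f_pj = [f_pi, f_ij] and f_pi commutes with f_kl, the vanishing is carried from the index i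
to p. -/
lemma move_left (hf : BracketFrame f) {i j k l p : Fin 12} (hij : i ≠ j) (hkl : k ≠ l)
    (hpi : p ≠ i) (hpj : p ≠ j) (hpk : p ≠ k) (hpl : p ≠ l) (hik : i ≠ k) (hil : i ≠ l)
    (h : f i j * f k l = 0) : f p j * f k l = 0 := by
  rw [← hf.bracket p i j hpi hij hpj, sub_mul, mul_assoc, h, mul_zero, mul_assoc,
    hf.comm p i k l hpi hpk hpl hik hil hkl, ← mul_assoc, h, zero_mul, sub_zero]

lemma move_right (hf : BracketFrame f) {i j k l p : Fin 12} (hij : i ≠ j) (hkl : k ≠ l)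
    (hpi : p ≠ i) (hpj : p ≠ j) (hpk : p ≠ k) (hpl : p ≠ l) (hjk : j ≠ k) (hjl : j ≠ l)
    (h : f i j * f k l = 0) : f i p * f k l = 0 := by
  rw [← hf.bracket i j p hij hpj.symm hpi.symm, sub_mul, mul_assoc, mul_assoc, h, mul_zero,
    hf.comm j p k l hpj.symm hjk hjl hpk hpl hkl, ← mul_assoc, h, zero_mul, sub_zero]

/-- Primeness may kill the factor with indices 4, …, 7 instead of the wanted one; replacing the four
indices one at a time leads back to f₀₁f₂₃. -/
lemma move_all (hf : BracketFrame f) (h : f 4 5 * f 6 7 = 0) : f 0 1 * f 2 3 = 0 := by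
  have h1 : f 0 5 * f 6 7 = 0 := by apply hf.move_left (i := 4) _ _ _ _ _ _ _ _ h <;> decide
  have h2 : f 0 1 * f 6 7 = 0 := by apply hf.move_right (j := 5) _ _ _ _ _ _ _ _ h1 <;> decide
  rw [hf.comm 0 1 6 7 (by decide) (by decide) (by decide) (by decide) (by decide) (by decide)] at h2
  have h3 : f 2 7 * f 0 1 = 0 := by apply hf.move_left (i := 6) _ _ _ _ _ _ _ _ h2 <;> decide
  have h4 : f 2 3 * f 0 1 = 0 := by apply hf.move_right (j := 7) _ _ _ _ _ _ _ _ h3 <;> decide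
  rw [hf.comm 0 1 2 3 (by decide) (by decide) (by decide) (by decide) (by decide) (by decide), h4]

end

variable {m : ℕ} {f : Fin 12 → Fin 12 → Matrix (Fin m) (Fin m) ℂ}

/-- Distinctness is packaged as `Nodup` so that `decide` settles it for concrete indices. -/
lemma comm_of_nodup (hf : BracketFrame f) (i j k l : Fin 12) (h : [i, j, k, l].Nodup) :
    f i j * f k l = f k l * f i j := by
  simp only [List.nodup_cons, List.mem_cons, not_or, List.not_mem_nil] at h
  apply hf.comm <;> tauto

lemma comm_mul_of_nodup (hf : BracketFrame f) (i j k l p q : Fin 12) (h : [i, j, k, l].Nodup)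
    (h' : [i, j, p, q].Nodup) : f i j * (f k l * f p q) = f k l * f p q * f i j := by
  rw [← mul_assoc, hf.comm_of_nodup i j k l h, mul_assoc, hf.comm_of_nodup i j p q h', mul_assoc]

/-- The triple brackets vanish on all matrices. -/
lemma mul_eq_zero_of_forall (hf : BracketFrame f)
    (h3 : ∀ i j k l p q, [i, j, k, l, p, q].Nodup → ∀ A : Matrix (Fin m) (Fin m) ℂ,
      ⁅f i j, ⁅f k l, ⁅f p q, A⁆⁆⁆ = 0) :
    f 0 1 * f 2 3 = 0 := by
  simp only [Ring.lie_def] at h3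
  -- The auxiliary indices 8 and 9 give f₀₁ = [f₀₈,f₈₁] and f₂₃ = [f₂₉,f₉₃], so the two outer
  -- brackets become left multiplications.
  have key : ∀ q, [(0 : Fin 12), 8, 1, 2, 9, 3, q, 5].Nodup → ∀ A,
      f 0 1 * f 2 3 * (f q 5 * A - A * f q 5) = 0 := by
    intro q hq A
    have hq1 : [8, 1, 9, 3, q, 5].Nodup := by revert hq; revert q; decide
    have hq2 : [0, 8, q, 5].Nodup := by revert hq; revert q; decide
    have hq3 : [2, 9, q, 5].Nodup := by revert hq; revert q; decide
    have e1 : ∀ A, f 0 1 * (f 9 3 * (f q 5 * A - A * f q 5) - (f q 5 * A - A * f q 5) * f 9 3)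
        = 0 := by
      intro A
      have := mul_bracket_eq_zero (p := 1) (u := f 8 1) (w := f 0 8)
        (Ψ := fun A => f 9 3 * (f q 5 * A - A * f q 5) - (f q 5 * A - A * f q 5) * f 9 3)
        (by
          intro A; rw [one_mul]
          exact h3 8 1 9 3 q 5 hq1 A)
        (by
          intro A
          rw [mul_left_commutator (hf.comm_of_nodup _ _ _ _ hq2),
            mul_left_commutator (hf.comm_of_nodup _ _ _ _ (by decide))])
        (by simp) A
      rw [hf.bracket 0 8 1 (by decide) (by decide) (by decide), one_mul] at this
      exact this
    have := mul_bracket_eq_zero e1 (w := f 2 9) (fun A => mul_left_commutator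
      (hf.comm_of_nodup _ _ _ _ hq3) A)
      (hf.comm_of_nodup _ _ _ _ (by decide)) A
    rwa [hf.bracket 2 9 3 (by decide) (by decide) (by decide)] at this
  -- With q = 10 the innermost bracket is stripped too; A = 1 gives f₀₁f₂₃f₄₅ = 0.
  have k3 := mul_bracket_eq_zero (Ψ := id) (key 10 (by decide)) (w := f 4 10) (fun A => rfl)
    (hf.comm_mul_of_nodup _ _ _ _ _ _ (by decide) (by decide)) 1
  rw [hf.bracket 4 10 5 (by decide) (by decide) (by decide), id, mul_one] at k3
  -- With q = 4 only the term having f₄₅ on the right survives, and primeness applies.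
  have k4 : ∀ A, f 0 1 * f 2 3 * A * f 4 5 = 0 := by
    intro A
    have := key 4 (by decide) A
    rwa [mul_sub, ← mul_assoc, k3, zero_mul, zero_sub, neg_eq_zero, ← mul_assoc] at this
  rcases Matrix.eq_zero_or_eq_zero_of_mul_mul k4 with h | h
  · exact h
  · exact hf.move_all (by rw [h, zero_mul])

/-- The triple brackets vanish on the skew elements for an involution `star`. -/
lemma mul_eq_zero_of_skew (hf : BracketFrame f)
    (st : Matrix (Fin m) (Fin m) ℂ →ₗ[ℂ] Matrix (Fin m) (Fin m) ℂ)
    (st_mul : ∀ A B, st (A * B) = st B * st A) (st_st : ∀ A, st (st A) = A)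
    (hskew : ∀ i j, i ≠ j → st (f i j) = -f i j)
    (h3 : ∀ i j k l p q, [i, j, k, l, p, q].Nodup → ∀ A : Matrix (Fin m) (Fin m) ℂ,
      st A = -A → ⁅f i j, ⁅f k l, ⁅f p q, A⁆⁆⁆ = 0) :
    f 0 1 * f 2 3 = 0 := by
  simp only [Ring.lie_def] at h3
  have hst : ∀ i j, i ≠ j → ∀ B, st (f i j * B - B * f i j) = f i j * st B - st B * f i j := by
    intro i j hij B
    rw [map_sub, st_mul, st_mul, hskew i j hij]; noncomm_ring
  -- The triple bracket Φ kills the skew element A − st A, so Φ(st A) = Φ(A) for every A. As Φ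
  -- commutes with left multiplication by f_rs, the element f_rs Φ(A) = Φ(f_rs A) is fixed by `st`;
  -- since f_rs is skew, it anticommutes with Φ(A). This replaces vanishing on all matrices.
  have anti : ∀ i j k l p q r s, [i, j, k, l, p, q, r, s].Nodup →
      ∀ A : Matrix (Fin m) (Fin m) ℂ,
        f r s * (f i j * (f k l * (f p q * A - A * f p q) - (f p q * A - A * f p q) * f k l)
          - (f k l * (f p q * A - A * f p q) - (f p q * A - A * f p q) * f k l) * f i j)
        + (f i j * (f k l * (f p q * A - A * f p q) - (f p q * A - A * f p q) * f k l)
          - (f k l * (f p q * A - A * f p q) - (f p q * A - A * f p q) * f k l) * f i j) * f r s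
        = 0 := by
    intro i j k l p q r s hn A
    set Φ : Matrix (Fin m) (Fin m) ℂ → Matrix (Fin m) (Fin m) ℂ := fun A =>
      f i j * (f k l * (f p q * A - A * f p q) - (f p q * A - A * f p q) * f k l)
          - (f k l * (f p q * A - A * f p q) - (f p q * A - A * f p q) * f k l) * f i j with hΦ
    simp only [List.nodup_cons, List.mem_cons, not_or, List.not_mem_nil, not_false_eq_true,
      List.nodup_nil, and_true] at hn
    have hΦst : ∀ A, st (Φ A) = Φ (st A) := by
      intro A
      simp only [hΦ]
      rw [hst i j (by tauto), hst k l (by tauto), hst p q (by tauto)]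
    have hΦsub : ∀ A B, Φ (A - B) = Φ A - Φ B := by
      intro A B; simp only [hΦ]; noncomm_ring
    have hΦsym : ∀ A, Φ (st A) = Φ A := by
      intro A
      have h0 : Φ (A - st A) = 0 := h3 i j k l p q
        (by simp only [List.nodup_cons, List.mem_cons, not_or, List.not_mem_nil,
              not_false_eq_true, List.nodup_nil, and_true]; tauto) (A - st A)
        (by rw [map_sub, st_st]; abel)
      rw [hΦsub, sub_eq_zero] at h0
      exact h0.symm
    have hz : Φ (f r s * A) = f r s * Φ A := by
      simp only [hΦ]
      rw [mul_left_commutator (hf.comm r s p q (by tauto) (Ne.symm (by tauto)) (Ne.symm (by tauto))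
          (Ne.symm (by tauto)) (Ne.symm (by tauto)) (by tauto)),
        mul_left_commutator (hf.comm r s k l (by tauto) (Ne.symm (by tauto)) (Ne.symm (by tauto))
          (Ne.symm (by tauto)) (Ne.symm (by tauto)) (by tauto)),
        mul_left_commutator (hf.comm r s i j (by tauto) (Ne.symm (by tauto)) (Ne.symm (by tauto))
          (Ne.symm (by tauto)) (Ne.symm (by tauto)) (by tauto))]
    have h1 : st (f r s * Φ A) = f r s * Φ A := by
      rw [← hz, hΦst, hΦsym]
    rw [st_mul, hΦst, hΦsym, hskew r s (by tauto)] at h1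
    change f r s * Φ A + Φ A * f r s = 0
    rw [← h1]; noncomm_ring
  have key : ∀ q r, [(0 : Fin 12), 8, 1, 2, 9, 3, q, 5, r, 7].Nodup → ∀ A,
      f r 7 * (f 0 1 * f 2 3 * (f q 5 * A - A * f q 5))
        + f 0 1 * f 2 3 * (f q 5 * A - A * f q 5) * f r 7 = 0 := by
    intro q r hq A
    have hq1 : [8, 1, 9, 3, q, 5, r, 7].Nodup := by revert hq; revert q r; decide
    have hq2 : [0, 8, q, 5].Nodup := by revert hq; revert q r; decide
    have hq3 : [2, 9, q, 5].Nodup := by revert hq; revert q r; decide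
    have hq4 : [0, 8, r, 7].Nodup := by revert hq; revert q r; decide
    have hq5 : [2, 9, r, 7].Nodup := by revert hq; revert q r; decide
    have e1 : ∀ A, f r 7 * (f 0 1 *
          (f 9 3 * (f q 5 * A - A * f q 5) - (f q 5 * A - A * f q 5) * f 9 3))
        + f 0 1 * (f 9 3 * (f q 5 * A - A * f q 5) - (f q 5 * A - A * f q 5) * f 9 3) * f r 7
        = 0 := by
      intro A
      have := mul_bracket_anticomm_eq_zero (p := 1) (u := f 8 1) (w := f 0 8) (z := f r 7)
        (Ψ := fun A => f 9 3 * (f q 5 * A - A * f q 5) - (f q 5 * A - A * f q 5) * f 9 3)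
        (by intro A; rw [one_mul]; exact anti 8 1 9 3 q 5 r 7 hq1 A)
        (by
          intro A
          rw [mul_left_commutator (hf.comm_of_nodup _ _ _ _ hq2),
            mul_left_commutator (hf.comm_of_nodup _ _ _ _ (by decide))])
        (by simp) (hf.comm_of_nodup _ _ _ _ hq4) A
      rw [hf.bracket 0 8 1 (by decide) (by decide) (by decide), one_mul] at this
      exact this
    have := mul_bracket_anticomm_eq_zero e1 (w := f 2 9) (fun A => mul_left_commutator
      (hf.comm_of_nodup _ _ _ _ hq3) A)
      (hf.comm_of_nodup _ _ _ _ (by decide)) (hf.comm_of_nodup _ _ _ _ hq5) A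
    rwa [hf.bracket 2 9 3 (by decide) (by decide) (by decide)] at this
  have k4 : ∀ r, [(0 : Fin 12), 8, 1, 2, 9, 3, 4, 10, 5, r, 7].Nodup → ∀ A,
      f 0 1 * f 2 3 * (f r 7 * (A * f 4 5)) + f 0 1 * f 2 3 * (A * f 4 5 * f r 7) = 0 := by
    intro r hr A
    have hr1 : [0, 8, 1, 2, 9, 3, 10, 5, r, 7].Nodup := by revert hr; revert r; decide
    have hr2 : [0, 8, 1, 2, 9, 3, 4, 5, r, 7].Nodup := by revert hr; revert r; decide
    have hr3 : [4, 10, r, 7].Nodup := by revert hr; revert r; decide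
    have hr4 : [r, 7, 0, 1].Nodup := by revert hr; revert r; decide
    have hr5 : [r, 7, 2, 3].Nodup := by revert hr; revert r; decide
    have k3 := mul_bracket_anticomm_eq_zero (Ψ := id) (key 10 r hr1) (w := f 4 10)
      (fun A => rfl) (hf.comm_mul_of_nodup _ _ _ _ _ _ (by decide) (by decide))
      (hf.comm_of_nodup _ _ _ _ hr3) A
    rw [hf.bracket 4 10 5 (by decide) (by decide) (by decide), id] at k3
    have k2 := key 4 r hr2 A
    have k1 := hf.comm_mul_of_nodup r 7 0 1 2 3 hr4 hr5
    have : f r 7 * (f 0 1 * f 2 3 * (A * f 4 5)) + f 0 1 * f 2 3 * (A * f 4 5) * f r 7 = 0 := by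
      have e : f r 7 * (f 0 1 * f 2 3 * (A * f 4 5)) + f 0 1 * f 2 3 * (A * f 4 5) * f r 7
        = (f r 7 * (f 0 1 * f 2 3 * f 4 5 * A) + f 0 1 * f 2 3 * f 4 5 * A * f r 7)
          - (f r 7 * (f 0 1 * f 2 3 * (f 4 5 * A - A * f 4 5))
            + f 0 1 * f 2 3 * (f 4 5 * A - A * f 4 5) * f r 7) := by noncomm_ring
      rw [e, k3, k2, sub_zero]
    rwa [← mul_assoc, k1, mul_assoc _ (f r 7), mul_assoc _ (A * f 4 5)] at this
  -- The Leibniz trick once more, with f₆₇ = [f₆,₁₁, f₁₁,₇], separates the two terms of the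
  -- anticommutator.
  have k5 : ∀ A, f 0 1 * f 2 3 * (f 6 7 * (A * f 4 5)) = 0 := by
    intro A
    have h1 := k4 11 (by decide) A
    have h2 := k4 11 (by decide) (f 6 11 * A)
    have h4 := hf.comm_mul_of_nodup 6 11 0 1 2 3 (by decide) (by decide)
    rw [← hf.bracket 6 11 7 (by decide) (by decide) (by decide)]
    calc f 0 1 * f 2 3 * ((f 6 11 * f 11 7 - f 11 7 * f 6 11) * (A * f 4 5))
        = f 0 1 * f 2 3 * f 6 11 * (f 11 7 * (A * f 4 5) + A * f 4 5 * f 11 7)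
          - (f 0 1 * f 2 3 * (f 11 7 * (f 6 11 * A * f 4 5))
            + f 0 1 * f 2 3 * (f 6 11 * A * f 4 5 * f 11 7)) := by noncomm_ring
      _ = 0 := by rw [← h4, h2, mul_assoc, mul_add, h1]; simp
  have k6 : ∀ A, f 0 1 * f 2 3 * A * (f 4 5 * f 6 7) = 0 := by
    intro A
    have := k4 6 (by decide) A
    rw [k5, zero_add] at this
    rw [← this]; noncomm_ring
  rcases Matrix.eq_zero_or_eq_zero_of_mul_mul k6 with h | h
  · exact h
  · exact hf.move_all h

end BracketFrame

/-! ### Matrix units -/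

/-- A relation on indices for which any five indices have a common partner. -/
structure IsApartness {I : Type*} (Ap : I → I → Prop) : Prop where
  symm : ∀ {a b}, Ap a b → Ap b a
  exists_apart : ∀ a b c d e, ∃ x, Ap a x ∧ Ap b x ∧ Ap c x ∧ Ap d x ∧ Ap e x

/-- Partially defined matrix units extend to a full system. -/
lemma IsApartness.exists_matrixUnits {I R : Type*} [Ring R] [DecidableEq I] {Ap : I → I → Prop}
    (hAp : IsApartness Ap) (e : I → I → R)
    (hz : ∀ a b c d, Ap a b → Ap c d → b ≠ c → e a b * e c d = 0)
    (hm : ∀ a b d, Ap a b → Ap b d → Ap a d → e a b * e b d = e a d) :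
    ∃ E : I → I → R, (∀ a b c d, E a b * E c d = if b = c then E a d else 0) ∧
      (∀ a b, Ap a b → E a b = e a b) ∧
      ∀ a b x, Ap a x → Ap x b → E a b = e a x * e x b := by
  classical
  have hw : ∀ a b, ∃ x, Ap a x ∧ Ap b x := fun a b => by
    obtain ⟨x, h1, h2, -⟩ := hAp.exists_apart a b b b b
    exact ⟨x, h1, h2⟩
  choose w hwa hwb using hw
  -- The product through x does not depend on x: apart x and y are compared through e_xy, arbitrary
  -- ones through a common third index.
  have indep : ∀ a b x y, Ap a x → Ap x b → Ap a y → Ap y b →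
      e a x * e x b = e a y * e y b := by
    have aux : ∀ a b x y, Ap a x → Ap x b → Ap a y → Ap y b → Ap x y →
        e a x * e x b = e a y * e y b := by
      intro a b x y h1 h2 h3 h4 h5
      rw [← hm x y b h5 h4 h2, ← mul_assoc, hm a x y h1 h5 h3]
    intro a b x y h1 h2 h3 h4
    obtain ⟨t, ha, hb, hx, hy, -⟩ := hAp.exists_apart a b x y y
    rw [aux a b x t h1 h2 ha (hAp.symm hb) hx, aux a b y t h3 h4 ha (hAp.symm hb) hy]
  let E : I → I → R := fun a b => if Ap a b then e a b else e a (w a b) * e (w a b) b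
  have hE : ∀ a b x, Ap a x → Ap x b → E a b = e a x * e x b := by
    intro a b x h1 h2
    by_cases h : Ap a b
    · simp only [E, if_pos h]
      rw [hm a x b h1 h2 h]
    · simp only [E, if_neg h]
      exact indep _ _ _ _ (hwa a b) (hAp.symm (hwb a b)) h1 h2
  refine ⟨E, ?_, fun a b h => by simp only [E, if_pos h], hE⟩
  intro a b c d
  obtain ⟨x, hxa, hxb, hxd, -⟩ := hAp.exists_apart a b d d d
  obtain ⟨y, hya, hyc, hyd, hyx, hyb⟩ := hAp.exists_apart a c d x b
  rw [hE a b x hxa (hAp.symm hxb), hE c d y hyc (hAp.symm hyd)]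
  split_ifs with h
  · subst h
    rw [mul_assoc, ← mul_assoc (e x b), hm x b y (hAp.symm hxb) hyb hyx, ← mul_assoc,
      hm a x y hxa hyx hya, hE a d y hya (hAp.symm hyd)]
  · rw [mul_assoc, ← mul_assoc (e x b), hz x b c y (hAp.symm hxb) hyc h, zero_mul, mul_zero]

/-! ### Maps of matrix algebras built from commutation relations -/

section UnitsMap

variable {I R : Type*} [Fintype I] [DecidableEq I] [Ring R] [Algebra ℂ R]

/-- The linear map which sends the standard matrix units to the given elements. -/
def unitsMap (E : I → I → R) : Matrix I I ℂ →ₗ[ℂ] R :=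
  ∑ a, ∑ b, (Matrix.entryLinearMap ℂ ℂ a b).smulRight (E a b)

omit [DecidableEq I] in
lemma unitsMap_apply (E : I → I → R) (x : Matrix I I ℂ) :
    unitsMap E x = ∑ a, ∑ b, x a b • E a b := by
  simp [unitsMap, LinearMap.sum_apply]

lemma unitsMap_single (E : I → I → R) (a b : I) : unitsMap E (Matrix.single a b 1) = E a b := by
  rw [unitsMap_apply, Finset.sum_eq_single a, Finset.sum_eq_single b]
  · simp
  · intro c _ hc; simp [hc.symm]
  · simp
  · intro c _ hc
    exact Finset.sum_eq_zero fun d _ => by simp [hc.symm]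
  · simp

lemma linearMap_matrix_ext {M : Type*} [AddCommGroup M] [Module ℂ M]
    {f g : Matrix I I ℂ →ₗ[ℂ] M}
    (h : ∀ a b, f (Matrix.single a b 1) = g (Matrix.single a b 1)) : f = g := by
  apply Matrix.ext_linearMap
  intro a b
  ext
  simpa using h a b

lemma map_mul_of_single (ρ : Matrix I I ℂ →ₗ[ℂ] R)
    (h : ∀ a b c d, ρ (Matrix.single a b 1) * ρ (Matrix.single c d 1)
      = if b = c then ρ (Matrix.single a d 1) else 0) (x y : Matrix I I ℂ) :
    ρ (x * y) = ρ x * ρ y := by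
  have key : (LinearMap.mul ℂ (Matrix I I ℂ)).compr₂ ρ = (LinearMap.mul ℂ R).compl₁₂ ρ ρ := by
    apply linearMap_matrix_ext
    intro a b
    apply linearMap_matrix_ext
    intro c d
    simp only [LinearMap.compr₂_apply, LinearMap.mul_apply', LinearMap.compl₁₂_apply, h]
    split_ifs with hbc
    · subst hbc; simp
    · simp [hbc]
  simpa using LinearMap.congr_fun₂ key x y

lemma mul_eq_zero_of_single (ρ σ : Matrix I I ℂ →ₗ[ℂ] R)
    (h : ∀ a b c d, ρ (Matrix.single a b 1) * σ (Matrix.single c d 1) = 0)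
    (x y : Matrix I I ℂ) : ρ x * σ y = 0 := by
  have key : (LinearMap.mul ℂ R).compl₁₂ ρ σ = 0 := by
    apply linearMap_matrix_ext
    intro a b
    apply linearMap_matrix_ext
    intro c d
    simp [h]
  simpa using LinearMap.congr_fun₂ key x y

/-- A homomorphism and an antihomomorphism of matrix algebras with orthogonal images. -/
structure IsSplitting (ρ₁ ρ₂ : Matrix I I ℂ →ₗ[ℂ] R) : Prop where
  map_mul : ∀ x y, ρ₁ (x * y) = ρ₁ x * ρ₁ y
  map_mul_rev : ∀ x y, ρ₂ (x * y) = ρ₂ y * ρ₂ x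
  left_mul_right : ∀ x y, ρ₁ x * ρ₂ y = 0
  right_mul_left : ∀ x y, ρ₂ y * ρ₁ x = 0

/-- Elements with the commutation relations of `gl`, for which the products with disjoint
indices vanish, come from a splitting. -/
lemma exists_isSplitting (hI : IsApartness fun a b : I => a ≠ b) (f : I → I → R)
    (hbr : ∀ a b c, a ≠ b → b ≠ c → a ≠ c → f a b * f b c - f b c * f a b = f a c)
    (hcomm : ∀ a b x, a ≠ b → x ≠ a → x ≠ b → f x b * f a b = f a b * f x b)
    (hcomm' : ∀ a x y, a ≠ x → a ≠ y → x ≠ y → f a x * f a y = f a y * f a x)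
    (hzero : ∀ a b c d, a ≠ b → a ≠ c → a ≠ d → b ≠ c → b ≠ d → c ≠ d → f a b * f c d = 0) :
    ∃ ρ₁ ρ₂ : Matrix I I ℂ →ₗ[ℂ] R, IsSplitting ρ₁ ρ₂ ∧
      ∀ a b, a ≠ b → f a b = ρ₁ (Matrix.single a b 1) - ρ₂ (Matrix.single a b 1) := by
  have hw : ∀ a b : I, ∃ x, a ≠ x ∧ b ≠ x := fun a b => by
    obtain ⟨x, h1, h2, -⟩ := hI.exists_apart a b b b b
    exact ⟨x, h1, h2⟩
  choose w hwa hwb using hw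
  -- In the sought splitting, for a ≠ b, the product f_ax f_xb is ρ₁(E_ab) and the reversed product
  -- is ρ₂(E_ab); the mixed terms and the wrongly ordered ones vanish.
  let P : I → I → R := fun a b => f a (w a b) * f (w a b) b
  let M : I → I → R := fun a b => f (w a b) b * f a (w a b)
  -- Expanding through f_xy, the difference of the two products is a combination of terms containing
  -- a product with disjoint indices.
  have hPaux : ∀ a b x y, a ≠ b → a ≠ x → b ≠ x → a ≠ y → b ≠ y → x ≠ y →
      f a x * f x b = f a y * f y b ∧ f x b * f a x = f y b * f a y := by
    intro a b x y hab hax hbx hay hby hxy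
    have z1 := hzero a x y b hax hay hab hxy hbx.symm hby.symm
    have z2 := hzero y b a x hby.symm hay.symm hxy.symm hab.symm hbx hax
    have b1 := hbr a x y hax hxy hay
    have b2 := hbr x y b hxy hby.symm hbx.symm
    constructor
    · have : f a x * f x b - f a y * f y b = (f a x * f y b) * (-f x y) + f x y * (f a x * f y b) := by
        rw [← b1, ← b2]; noncomm_ring
      rw [z1] at this
      simpa [sub_eq_zero] using this
    · have : f x b * f a x - f y b * f a y = (f y b * f a x) * (-f x y) + f x y * (f y b * f a x) := by
        rw [← b1, ← b2]; noncomm_ring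
      rw [z2] at this
      simpa [sub_eq_zero] using this
  have hPM : ∀ a b x, a ≠ b → a ≠ x → b ≠ x →
      P a b = f a x * f x b ∧ M a b = f x b * f a x := by
    intro a b x hab hax hbx
    obtain ⟨t, h1, h2, h3, h4, -⟩ := hI.exists_apart a b x (w a b) a
    have e1 := hPaux a b (w a b) t hab (hwa a b) (hwb a b) h1 h2 h4
    have e2 := hPaux a b x t hab hax hbx h1 h2 h3
    exact ⟨e1.1.trans e2.1.symm, e1.2.trans e2.2.symm⟩
  have hf : ∀ a b, a ≠ b → f a b = P a b - M a b := fun a b hab =>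
    (hbr a (w a b) b (hwa a b) (hwb a b).symm hab).symm
  have hPP : ∀ a b c d, a ≠ b → c ≠ d → b ≠ c → P a b * P c d = 0 := by
    intro a b c d hab hcd hbc
    obtain ⟨x, hxa, hxb, hxc, hxd, -⟩ := hI.exists_apart a b c d d
    obtain ⟨y, hya, hyb, hyc, hyd, hyx⟩ := hI.exists_apart a b c d x
    rw [(hPM a b x hab hxa hxb).1, (hPM c d y hcd hyc hyd).1, mul_assoc, ← mul_assoc (f x b),
      hzero x b c y hxb.symm hxc.symm hyx.symm.symm hbc hyb hyc, zero_mul, mul_zero]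
  have hMM : ∀ a b c d, a ≠ b → c ≠ d → a ≠ d → M a b * M c d = 0 := by
    intro a b c d hab hcd had
    obtain ⟨x, hxa, hxb, hxc, hxd, -⟩ := hI.exists_apart a b c d d
    obtain ⟨y, hya, hyb, hyc, hyd, hyx⟩ := hI.exists_apart a b c d x
    rw [(hPM a b x hab hxa hxb).2, (hPM c d y hcd hyc hyd).2, mul_assoc, ← mul_assoc (f a x),
      hzero a x y d hxa hya had hyx hxd.symm hyd.symm, zero_mul, mul_zero]
  have hPM0 : ∀ a b c d, a ≠ b → c ≠ d → P a b * M c d = 0 := by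
    intro a b c d hab hcd
    obtain ⟨x, hxa, hxb, hxc, hxd, -⟩ := hI.exists_apart a b c d d
    obtain ⟨y, hya, hyb, hyc, hyd, hyx⟩ := hI.exists_apart a b c d x
    rw [(hPM a b x hab hxa hxb).1, (hPM c d y hcd hyc hyd).2]
    by_cases hbd : b = d
    · subst hbd
      rw [mul_assoc, ← mul_assoc (f x b), hcomm y b x hyb.symm hyx hxb.symm, mul_assoc,
        ← mul_assoc, hzero a x y b hxa hya hab hyx hxb.symm hyb.symm, zero_mul]
    · rw [mul_assoc, ← mul_assoc (f x b), hzero x b y d hxb.symm hyx hxd.symm hyb hbd hyd.symm,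
        zero_mul, mul_zero]
  have hMP0 : ∀ a b c d, a ≠ b → c ≠ d → M c d * P a b = 0 := by
    intro a b c d hab hcd
    obtain ⟨x, hxa, hxb, hxc, hxd, -⟩ := hI.exists_apart a b c d d
    obtain ⟨y, hya, hyb, hyc, hyd, hyx⟩ := hI.exists_apart a b c d x
    rw [(hPM a b x hab hxa hxb).1, (hPM c d y hcd hyc hyd).2]
    by_cases hca : c = a
    · subst hca
      rw [mul_assoc, ← mul_assoc (f c y), hcomm' c y x hya hxa hyx.symm, mul_assoc,
        ← mul_assoc, hzero y d c x hyd.symm hya.symm hyx.symm hcd.symm hxd hxa, zero_mul]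
    · rw [mul_assoc, ← mul_assoc (f c y), hzero c y a x hyc hca hxc hya.symm hyx.symm hxa,
        zero_mul, mul_zero]
  have hPmul : ∀ a b d, a ≠ b → b ≠ d → a ≠ d → P a b * P b d = P a d := by
    intro a b d hab hbd had
    rw [(hPM a d b had hab hbd.symm).1, hf a b hab, hf b d hbd, sub_mul, mul_sub, mul_sub,
      hPM0 a b b d hab hbd, hMP0 b d a b hbd hab, hMM a b b d hab hbd had]
    simp
  have hMmul : ∀ a b d, a ≠ b → b ≠ d → a ≠ d → M b d * M a b = M a d := by
    intro a b d hab hbd had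
    rw [(hPM a d b had hab hbd.symm).2, hf a b hab, hf b d hbd, sub_mul, mul_sub, mul_sub,
      hPM0 b d a b hbd hab, hMP0 a b b d hab hbd, hPP b d a b hbd hab had.symm]
    simp
  obtain ⟨E, hE, hE1, hE2⟩ := hI.exists_matrixUnits P hPP hPmul
  -- The elements M multiply in reversed order, so their transpose is a system of matrix units.
  obtain ⟨N, hN, hN1, hN2⟩ := hI.exists_matrixUnits (fun a b => M b a)
    (fun a b c d hab hcd hbc => hMM b a d c hab.symm hcd.symm hbc)
    (fun a b d hab hbd had => hMmul d b a hbd.symm hab.symm had.symm)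
  have hEN : ∀ a b c d, E a b * N d c = 0 ∧ N d c * E a b = 0 := by
    intro a b c d
    obtain ⟨x, hxa, hxb, hxc, hxd, -⟩ := hI.exists_apart a b c d d
    rw [hE2 a b x hxa hxb.symm, hN2 d c x hxd hxc.symm]
    constructor
    · rw [mul_assoc, ← mul_assoc (P x b), hPM0 x b x d hxb.symm hxd.symm, zero_mul,
        mul_zero]
    · rw [mul_assoc, ← mul_assoc (M c x), hMP0 a x c x hxa hxc, zero_mul, mul_zero]
  refine ⟨unitsMap E, unitsMap (fun a b => N b a), ⟨?_, ?_, ?_, ?_⟩, ?_⟩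
  · exact map_mul_of_single _ fun a b c d => by simp only [unitsMap_single, hE]
  · intro x y
    have hT : ∀ z : Matrix I I ℂ, ((unitsMap fun a b => N b a) ∘ₗ
      (Matrix.transposeLinearEquiv I I ℂ ℂ).toLinearMap) z
        = unitsMap (fun a b => N b a) z.transpose := fun _ => rfl
    have := map_mul_of_single ((unitsMap fun a b => N b a) ∘ₗ
      (Matrix.transposeLinearEquiv I I ℂ ℂ).toLinearMap) (fun a b c d => by
        simp only [hT, Matrix.transpose_single, unitsMap_single, hN]) y.transpose x.transpose
    rwa [hT, hT, hT, ← Matrix.transpose_mul, Matrix.transpose_transpose,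
      Matrix.transpose_transpose, Matrix.transpose_transpose] at this
  · exact mul_eq_zero_of_single _ _ fun a b c d => by simp only [unitsMap_single, (hEN a b c d).1]
  · intro x y
    exact mul_eq_zero_of_single _ _ (fun a b c d => by
      simp only [unitsMap_single, (hEN c d a b).2]) y x
  · intro a b hab
    simp only [unitsMap_single, hE1 a b hab, hN1 b a hab.symm, hf a b hab]

/-- Elements with the commutation relations of an orthogonal or symplectic Lie algebra, for which
the products with disjoint indices vanish, come from a homomorphism of matrix algebras. -/
lemma exists_map_mul (τ : I → I) (ε : I → ℂ) (hτ : ∀ a, τ (τ a) = a) (hε : ∀ a, ε a * ε a = 1)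
    (hI : IsApartness fun a b : I => a ≠ b ∧ a ≠ τ b) (f : I → I → R)
    (hτf : ∀ a b, f (τ b) (τ a) = -(ε a * ε b) • f a b)
    (hbr : ∀ a b c, a ≠ b ∧ a ≠ τ b → b ≠ c ∧ b ≠ τ c → a ≠ c ∧ a ≠ τ c →
      f a b * f b c - f b c * f a b = f a c)
    (hcomm : ∀ x b y, x ≠ b ∧ x ≠ τ b → x ≠ y ∧ x ≠ τ y → b ≠ y ∧ b ≠ τ y → b ≠ τ b →
      f x b * f (τ b) y = f (τ b) y * f x b)
    (hzero : ∀ a b c d, a ≠ b ∧ a ≠ τ b → a ≠ c ∧ a ≠ τ c → a ≠ d ∧ a ≠ τ d →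
      b ≠ c ∧ b ≠ τ c → b ≠ d ∧ b ≠ τ d → c ≠ d ∧ c ≠ τ d → f a b * f c d = 0) :
    ∃ ρ : Matrix I I ℂ →ₗ[ℂ] R, (∀ x y, ρ (x * y) = ρ x * ρ y) ∧
      ∀ a b, a ≠ b ∧ a ≠ τ b →
        f a b = ρ (Matrix.single a b 1 - (ε a * ε b) • Matrix.single (τ b) (τ a) 1) := by
  set Ap : I → I → Prop := fun a b : I => a ≠ b ∧ a ≠ τ b with hAp
  have apτ : ∀ {a b}, Ap a b → Ap a (τ b) := by
    intro a b h; simp only [hAp, hτ]; exact ⟨h.2, h.1⟩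
  have apτ' : ∀ {a b}, Ap a b → Ap (τ a) b := fun h => hI.symm (apτ (hI.symm h))
  have hw : ∀ a b : I, ∃ x, Ap a x ∧ Ap b x := fun a b => by
    obtain ⟨x, h1, h2, -⟩ := hI.exists_apart a b b b b
    exact ⟨x, h1, h2⟩
  choose w hwa hwb using hw
  -- The sought ρ(E_ab): in the product of two skew elements through x, all terms but E_ax E_xb =
  -- E_ab vanish when a and b are apart.
  let e : I → I → R := fun a b => f a (w a b) * f (w a b) b
  have heaux : ∀ a b x y, Ap a b → Ap a x → Ap b x → Ap a y → Ap b y → Ap x y →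
      f a x * f x b = f a y * f y b := by
    intro a b x y hab hax hbx hay hby hxy
    have z1 := hzero a x y b hax hay hab hxy (hI.symm hbx) (hI.symm hby)
    have b1 := hbr a x y hax hxy hay
    have b2 := hbr x y b hxy (hI.symm hby) (hI.symm hbx)
    have : f a x * f x b - f a y * f y b = (f a x * f y b) * (-f x y) + f x y * (f a x * f y b) := by
      rw [← b1, ← b2]; noncomm_ring
    rw [z1] at this
    simpa [sub_eq_zero] using this
  have he : ∀ a b x, Ap a b → Ap a x → Ap b x → e a b = f a x * f x b := by
    intro a b x hab hax hbx
    obtain ⟨t, h1, h2, h3, h4, -⟩ := hI.exists_apart a b x (w a b) a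
    exact (heaux a b (w a b) t hab (hwa a b) (hwb a b) h1 h2 h4).trans
      (heaux a b x t hab hax hbx h1 h2 h3).symm
  have hεε : ∀ a b, ε a * ε b * (ε b * ε a) = 1 := by
    intro a b
    calc ε a * ε b * (ε b * ε a) = (ε a * ε a) * (ε b * ε b) := by ring
      _ = 1 := by rw [hε, hε, one_mul]
  have hf : ∀ a b, Ap a b → f a b = e a b - (ε a * ε b) • e (τ b) (τ a) := by
    intro a b hab
    set x := w a b
    have hax : Ap a x := hwa a b
    have hbx : Ap b x := hwb a b
    rw [he (τ b) (τ a) (τ x) (apτ (apτ' (hI.symm hab))) (apτ (apτ' hbx)) (apτ (apτ' hax)),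
      hτf x b, hτf a x, ← hbr a x b hax (hI.symm hbx) hab, he a b x hab hax hbx]
    congr 1
    rw [smul_mul_smul_comm, smul_smul]
    have : ε a * ε b * (-(ε x * ε b) * -(ε a * ε x)) = 1 := by
      calc ε a * ε b * (-(ε x * ε b) * -(ε a * ε x))
          = (ε a * ε a) * (ε b * ε b) * (ε x * ε x) := by ring
        _ = 1 := by rw [hε, hε, hε]; ring
    rw [this, one_smul]
  have hee : ∀ a b c d, Ap a b → Ap c d → b ≠ c → e a b * e c d = 0 := by
    intro a b c d hab hcd hbc
    obtain ⟨x, hxa, hxb, hxc, hxd, -⟩ := hI.exists_apart a b c d d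
    obtain ⟨y, hya, hyb, hyc, hyd, hyx⟩ := hI.exists_apart a b c d x
    rw [he a b x hab hxa hxb, he c d y hcd hyc hyd]
    -- Here b and c lie in one τ-class, so the vanishing of disjoint products is not available until
    -- `hcomm` reorders the factors.
    by_cases hb : b = τ c
    · have hc : τ b = c := by rw [hb, hτ]
      have hbb : b ≠ τ b := by rw [hc]; exact hbc
      subst hc
      rw [mul_assoc, ← mul_assoc (f x b), hcomm x b y (hI.symm hxb) hyx hyb hbb, mul_assoc,
        ← mul_assoc, hzero a x (τ b) y hxa (apτ hab) hya (hI.symm hxc) hyx hyc, zero_mul]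
    · rw [mul_assoc, ← mul_assoc (f x b), hzero x b c y (hI.symm hxb) (hI.symm hxc) hyx
        ⟨hbc, hb⟩ hyb hyc, zero_mul, mul_zero]
  have hem : ∀ a b d, Ap a b → Ap b d → Ap a d → e a b * e b d = e a d := by
    intro a b d hab hbd had
    rw [he a d b had hab (hI.symm hbd), hf a b hab, hf b d hbd, sub_mul, mul_sub, mul_sub,
      smul_mul_smul_comm, smul_mul_assoc, mul_smul_comm,
      hee a b (τ d) (τ b) hab (apτ (apτ' (hI.symm hbd))) hbd.2,
      hee (τ b) (τ a) b d (apτ (apτ' (hI.symm hab))) hbd (apτ' hab).1,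
      hee (τ b) (τ a) (τ d) (τ b) (apτ (apτ' (hI.symm hab))) (apτ (apτ' (hI.symm hbd)))
        (apτ (apτ' had)).1]
    simp
  obtain ⟨E, hE, hE1, hE2⟩ := hI.exists_matrixUnits e hee hem
  refine ⟨unitsMap E, map_mul_of_single _ fun a b c d => by simp only [unitsMap_single, hE], ?_⟩
  intro a b hab
  rw [map_sub, map_smul, unitsMap_single, unitsMap_single, hE1 a b hab,
    hE1 (τ b) (τ a) (apτ (apτ' (hI.symm hab)))]
  exact hf a b hab

end UnitsMap

/-! ### Orthogonal and symplectic involutions -/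

/-- The adjoint with respect to the bilinear form `∑ ε i * x i * y (τ i)`. -/
def formAdjoint {n : ℕ} (τ : Fin n → Fin n) (ε : Fin n → ℂ) :
    Matrix (Fin n) (Fin n) ℂ →ₗ[ℂ] Matrix (Fin n) (Fin n) ℂ where
  toFun A := Matrix.of fun i j => ε i * ε j * A (τ j) (τ i)
  map_add' A B := by ext; simp [mul_add]
  map_smul' c A := by ext; simp; ring

/-- The data of a bilinear form `∑ ε i * x i * y (τ i)` which is symmetric (`κ = 1`) or
alternating (`κ = -1`). -/
structure IsFormData {n : ℕ} (τ : Fin n → Fin n) (ε : Fin n → ℂ) (κ : ℂ) : Prop where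
  invol : ∀ a, τ (τ a) = a
  sq : ∀ a, ε a * ε a = 1
  sign : ∀ a, ε (τ a) = κ * ε a
  sign_sq : κ * κ = 1

namespace IsFormData

variable {n : ℕ} {τ : Fin n → Fin n} {ε : Fin n → ℂ} {κ : ℂ}

lemma sign_mul_sign (h : IsFormData τ ε κ) (a b : Fin n) : ε (τ a) * ε (τ b) = ε a * ε b := by
  rw [h.sign, h.sign, mul_mul_mul_comm, h.sign_sq, one_mul]

lemma apply_eq_iff (h : IsFormData τ ε κ) {a b : Fin n} : τ a = b ↔ a = τ b :=
  ⟨fun hab => by rw [← hab, h.invol], fun hab => by rw [hab, h.invol]⟩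

lemma formAdjoint_mul (h : IsFormData τ ε κ) (A B : Matrix (Fin n) (Fin n) ℂ) :
    formAdjoint τ ε (A * B) = formAdjoint τ ε B * formAdjoint τ ε A := by
  ext i j
  simp only [formAdjoint, LinearMap.coe_mk, AddHom.coe_mk, Matrix.of_apply, Matrix.mul_apply,
    Finset.mul_sum]
  rw [← Equiv.sum_comp (show Function.Involutive τ from h.invol).toPerm]
  refine Finset.sum_congr rfl fun k _ => ?_
  rw [Function.Involutive.coe_toPerm]
  calc ε i * ε j * (A (τ j) (τ k) * B (τ k) (τ i))
      = (ε k * ε k) * (ε i * ε j * (A (τ j) (τ k) * B (τ k) (τ i))) := by rw [h.sq, one_mul]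
    _ = _ := by ring

lemma formAdjoint_formAdjoint (h : IsFormData τ ε κ) (A : Matrix (Fin n) (Fin n) ℂ) :
    formAdjoint τ ε (formAdjoint τ ε A) = A := by
  ext i j
  simp only [formAdjoint, LinearMap.coe_mk, AddHom.coe_mk, Matrix.of_apply, h.invol,
    h.sign_mul_sign]
  calc ε i * ε j * (ε j * ε i * A i j) = (ε i * ε i) * (ε j * ε j) * A i j := by ring
    _ = A i j := by rw [h.sq, h.sq]; ring

lemma formAdjoint_single (h : IsFormData τ ε κ) (a b : Fin n) :
    formAdjoint τ ε (Matrix.single a b 1) = (ε a * ε b) • Matrix.single (τ b) (τ a) 1 := by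
  ext i j
  simp only [formAdjoint, LinearMap.coe_mk, AddHom.coe_mk, Matrix.of_apply, Matrix.smul_apply,
    Matrix.single_apply, smul_eq_mul, h.apply_eq_iff]
  by_cases h1 : a = τ j <;> by_cases h2 : b = τ i
  · rw [h1, h2, h.sign_mul_sign]; simp [mul_comm]
  · simp [h1, h2]
  · simp [h1, h2]
  · simp [h1, h2]

/-- The Gram matrix of the form. -/
def gram (τ : Fin n → Fin n) (ε : Fin n → ℂ) : Matrix (Fin n) (Fin n) ℂ :=
  Matrix.of fun i j => if j = τ i then ε i else 0

lemma gram_transpose (h : IsFormData τ ε κ) : (gram τ ε).transpose = κ • gram τ ε := by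
  ext i j
  simp only [gram, Matrix.transpose_apply, Matrix.of_apply, Matrix.smul_apply, smul_eq_mul]
  by_cases hij : i = τ j
  · have hji : j = τ i := by rw [hij, h.invol]
    rw [if_pos hij, if_pos hji, hij, h.sign, ← mul_assoc, h.sign_sq, one_mul]
  · have hji : ¬ j = τ i := fun hh => hij (by rw [hh, h.invol])
    rw [if_neg hij, if_neg hji, mul_zero]

lemma gram_mul_transpose (h : IsFormData τ ε κ) : gram τ ε * (gram τ ε).transpose = 1 := by
  ext i j
  rw [Matrix.mul_apply, Finset.sum_eq_single (τ i)]
  · simp only [gram, Matrix.transpose_apply, Matrix.of_apply, Matrix.one_apply, if_true]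
    by_cases hij : i = j
    · subst hij; simp [h.sq]
    · rw [if_neg hij, if_neg, mul_zero]
      intro hh; exact hij (by rw [← h.invol i, hh, h.invol])
  · intro k _ hk; simp [gram, hk]
  · simp

/-- This identifies `formAdjoint` with A ↦ Ω⁻¹AᵀΩ, so that skewness for the Gram matrix Ω can be
stated as A* = −A. -/
lemma gram_mul_formAdjoint (h : IsFormData τ ε κ) (A : Matrix (Fin n) (Fin n) ℂ) :
    gram τ ε * formAdjoint τ ε A = A.transpose * gram τ ε := by
  ext i j
  rw [Matrix.mul_apply, Matrix.mul_apply, Finset.sum_eq_single (τ i),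
    Finset.sum_eq_single (τ j)]
  · simp only [gram, formAdjoint, LinearMap.coe_mk, AddHom.coe_mk, Matrix.of_apply, h.invol,
      if_true, Matrix.transpose_apply, h.sign]
    calc ε i * (κ * ε i * ε j * A (τ j) i) = (ε i * ε i) * (κ * ε j * A (τ j) i) := by ring
      _ = _ := by rw [h.sq]; ring
  · intro k _ hk
    have : ¬ j = τ k := fun hh => hk (by rw [hh, h.invol])
    simp [gram, this]
  · simp
  · intro k _ hk; simp [gram, hk]
  · simp

lemma skew_iff (h : IsFormData τ ε κ) (A : Matrix (Fin n) (Fin n) ℂ) :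
    A.transpose * gram τ ε = gram τ ε * (-A) ↔ formAdjoint τ ε A = -A := by
  rw [← h.gram_mul_formAdjoint]
  constructor
  · intro hh
    have h1 : (gram τ ε).transpose * gram τ ε = 1 := mul_eq_one_comm.mp h.gram_mul_transpose
    calc formAdjoint τ ε A = (gram τ ε).transpose * (gram τ ε * formAdjoint τ ε A) := by
          rw [← mul_assoc, h1, one_mul]
      _ = -A := by rw [hh, ← mul_assoc, h1, one_mul]
  · intro hh; rw [hh]

end IsFormData

/-- The sign of the form which defines the classical Lie algebras of types `C` and `O`. -/
def ClassicalType.formSign : ClassicalType → ℂ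
  | .A => 0
  | .C => -1
  | .O => 1

lemma exists_isFormData {X : ClassicalType} {n : ℕ} (hX : X ≠ .A) (hn : IsSimpleDim X n) :
    ∃ (τ : Fin n → Fin n) (ε : Fin n → ℂ), IsFormData τ ε X.formSign ∧
      ∀ A, A ∈ classicalLieAlgebra X n ↔ formAdjoint τ ε A = -A := by
  cases X with
  | A => exact absurd rfl hX
  | O =>
    refine ⟨id, fun _ => 1, ⟨by simp, by simp, by simp [ClassicalType.formSign],
      by simp [ClassicalType.formSign]⟩, fun A => ?_⟩
    rw [show classicalLieAlgebra .O n = LieAlgebra.Orthogonal.so (Fin n) ℂ from rfl,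
      LieAlgebra.Orthogonal.mem_so]
    have : formAdjoint id (fun _ => 1) A = A.transpose := by
      ext i j; simp [formAdjoint]
    rw [this]
  | C =>
    have hrev : ∀ a : Fin n, a < Fin.rev a ↔ ¬ Fin.rev a < a := by
      intro a
      obtain ⟨h2, k, hk⟩ := hn
      have := a.2
      simp only [Fin.lt_def, Fin.val_rev]
      omega
    have hform : IsFormData (Fin.rev : Fin n → Fin n)
        (fun a => if a < Fin.rev a then (1 : ℂ) else -1) (ClassicalType.C).formSign := by
      refine ⟨Fin.rev_rev, fun a => ?_, fun a => ?_, by simp [ClassicalType.formSign]⟩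
      · by_cases h : a < Fin.rev a <;> simp [h]
      · have := hrev a
        by_cases h : a < Fin.rev a
        · simp [h, this.mp h, ClassicalType.formSign]
        · have h2 : Fin.rev a < a := by
            by_contra hc; exact h (this.mpr hc)
          simp [h, h2, ClassicalType.formSign]
    refine ⟨_, _, hform, fun A => ?_⟩
    rw [← hform.skew_iff]
    have hgram : alternatingForm n = IsFormData.gram Fin.rev
        (fun a => if a < Fin.rev a then (1 : ℂ) else -1) := by
      ext i j
      simp only [alternatingForm, IsFormData.gram, Matrix.of_apply]
      have hij : ((i : ℕ) + j + 1 = n) ↔ j = Fin.rev i := by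
        rw [Fin.ext_iff, Fin.val_rev]; omega
      by_cases h : j = Fin.rev i
      · rw [if_pos (hij.mpr h), if_pos h, h]
      · rw [if_neg (fun hh => h (hij.mp hh)), if_neg h]
    rw [show classicalLieAlgebra .C n = skewAdjointMatricesLieSubalgebra (alternatingForm n)
      from rfl, mem_skewAdjointMatricesLieSubalgebra, mem_skewAdjointMatricesSubmodule, hgram]
    rfl

/-! ### Indices in general position -/

/-- The excluded x lie in s ∪ τ(s), at most 22 indices. Hence 24 is enough to choose twelve
τ-classes one by one, which is where this bound comes from. -/
lemma exists_apart_of_card {n : ℕ} {τ : Fin n → Fin n} (hτ : ∀ a, τ (τ a) = a) (hn : 24 ≤ n)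
    (s : Finset (Fin n)) (hs : s.card ≤ 11) : ∃ x, ∀ a ∈ s, a ≠ x ∧ a ≠ τ x := by
  have h1 : (s ∪ s.image τ).card < (Finset.univ : Finset (Fin n)).card := by
    have := Finset.card_union_le s (s.image τ)
    have := Finset.card_image_le (s := s) (f := τ)
    simp only [Finset.card_univ, Fintype.card_fin]
    omega
  obtain ⟨x, -, hx⟩ := Finset.exists_mem_notMem_of_card_lt_card h1
  refine ⟨x, fun a ha => ⟨?_, ?_⟩⟩
  · rintro rfl; exact hx (Finset.mem_union_left _ ha)
  · intro h
    exact hx (Finset.mem_union_right _ (Finset.mem_image.mpr ⟨a, ha, by rw [h, hτ]⟩))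

lemma isApartness_of_card {n : ℕ} {τ : Fin n → Fin n} (hτ : ∀ a, τ (τ a) = a) (hn : 24 ≤ n) :
    IsApartness fun a b : Fin n => a ≠ b ∧ a ≠ τ b where
  symm := fun {a b} h => ⟨h.1.symm, fun h' => h.2 (by rw [h', hτ])⟩
  exists_apart a b c d e := by
    obtain ⟨x, hx⟩ := exists_apart_of_card hτ hn {a, b, c, d, e}
      (Finset.card_le_five.trans (by norm_num))
    exact ⟨x, hx a (by simp), hx b (by simp), hx c (by simp), hx d (by simp), hx e (by simp)⟩

lemma exists_twelve_apart {n : ℕ} {τ : Fin n → Fin n} (hτ : ∀ a, τ (τ a) = a) (hn : 24 ≤ n)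
    (t : Fin 4 → Fin n) (ht : ∀ i j, i ≠ j → t i ≠ t j ∧ t i ≠ τ (t j)) :
    ∃ s : Fin 12 → Fin n, (∀ i j, i ≠ j → s i ≠ s j ∧ s i ≠ τ (s j)) ∧
      s 0 = t 0 ∧ s 1 = t 1 ∧ s 2 = t 2 ∧ s 3 = t 3 := by
  have step : ∀ k, k ≤ 8 → ∃ s : ℕ → Fin n,
      (∀ i j, i < 4 + k → j < 4 + k → i ≠ j → s i ≠ s j ∧ s i ≠ τ (s j)) ∧
      ∀ i : Fin 4, s i = t i := by
    intro k
    induction k with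
    | zero =>
      intro _
      refine ⟨fun i => t (Fin.ofNat 4 i), fun i j hi hj hij => ht _ _ ?_, fun i => ?_⟩
      · intro h
        rw [Fin.ext_iff] at h
        simp only [Fin.ofNat] at h
        omega
      · simp
    | succ k ih =>
      intro hk
      obtain ⟨s, hs, hst⟩ := ih (by omega)
      obtain ⟨x, hx⟩ := exists_apart_of_card hτ hn ((Finset.range (4 + k)).image s)
        (Finset.card_image_le.trans (by rw [Finset.card_range]; omega))
      have hx' : ∀ i < 4 + k, s i ≠ x ∧ s i ≠ τ x := fun i hi =>
        hx _ (Finset.mem_image_of_mem _ (Finset.mem_range.mpr hi))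
      refine ⟨Function.update s (4 + k) x, fun i j hi hj hij => ?_, fun i => ?_⟩
      · by_cases h1 : i = 4 + k
        · subst h1
          rw [Function.update_self, Function.update_of_ne hij.symm]
          have := hx' j (by omega)
          exact ⟨this.1.symm, fun h => this.2 (by rw [h, hτ])⟩
        · by_cases h2 : j = 4 + k
          · subst h2
            rw [Function.update_self, Function.update_of_ne h1]
            exact hx' i (by omega)
          · rw [Function.update_of_ne h1, Function.update_of_ne h2]
            exact hs i j (by omega) (by omega) hij
      · rw [Function.update_of_ne (by have := i.2; omega), hst]
  obtain ⟨s, hs, hst⟩ := step 8 le_rfl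
  refine ⟨fun i => s i, fun i j hij => hs i j i.2 j.2 (fun h => hij (Fin.ext h)), ?_⟩
  exact ⟨hst 0, hst 1, hst 2, hst 3⟩

/-! ### Homomorphisms which preserve orthogonality -/

/-- Elements with vanishing products are mapped to elements with vanishing products. -/
def PreservesOrthogonality {X Y : ClassicalType} {n m : ℕ}
    (φ : classicalLieAlgebra X n →ₗ⁅ℂ⁆ classicalLieAlgebra Y m) : Prop :=
  ∀ x y : classicalLieAlgebra X n,
    (x : Matrix (Fin n) (Fin n) ℂ) * (y : Matrix (Fin n) (Fin n) ℂ) = 0 →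
    (y : Matrix (Fin n) (Fin n) ℂ) * (x : Matrix (Fin n) (Fin n) ℂ) = 0 →
    (φ x : Matrix (Fin m) (Fin m) ℂ) * (φ y : Matrix (Fin m) (Fin m) ℂ) = 0

lemma PreservesOrthogonality.comp {X Y Z : ClassicalType} {n m k : ℕ}
    {ψ : classicalLieAlgebra Y m →ₗ⁅ℂ⁆ classicalLieAlgebra Z k}
    {φ : classicalLieAlgebra X n →ₗ⁅ℂ⁆ classicalLieAlgebra Y m}
    (hψ : PreservesOrthogonality ψ) (hφ : PreservesOrthogonality φ) :
    PreservesOrthogonality (ψ.comp φ) :=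
  fun x y hxy hyx => hψ _ _ (hφ x y hxy hyx) (hφ y x hyx hxy)

/-- In adapted coordinates x acts blockwise by x, −xᵀ and 0; the dual blocks contribute xᵀyᵀ =
(yx)ᵀ, which is why both products are required to vanish. -/
lemma HasSignature.preservesOrthogonality {X Y : ClassicalType} {n m : ℕ}
    {φ : classicalLieAlgebra X n →ₗ⁅ℂ⁆ classicalLieAlgebra Y m} {l r z : ℕ}
    (h : HasSignature φ l r z) : PreservesOrthogonality φ := by
  obtain ⟨Φ, hΦ⟩ := h
  intro x y hxy hyx
  have h1 : ∀ v, ((φ x : Matrix (Fin m) (Fin m) ℂ) * (φ y : Matrix (Fin m) (Fin m) ℂ)).mulVec v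
      = 0 := by
    intro v
    apply Φ.injective
    rw [← Matrix.mulVec_mulVec, hΦ, hΦ]
    simp [Matrix.mulVec_mulVec, hxy, ← Matrix.transpose_mul, hyx, Matrix.neg_mulVec,
      Matrix.mulVec_neg]
    exact ⟨rfl, rfl⟩
  ext i j
  simpa using congrFun (h1 (Pi.single j 1)) i

lemma coe_lie_classical {X : ClassicalType} {n : ℕ} (x y : classicalLieAlgebra X n) :
    ((⁅x, y⁆ : classicalLieAlgebra X n) : Matrix (Fin n) (Fin n) ℂ)
      = (x : Matrix (Fin n) (Fin n) ℂ) * y - y * (x : Matrix (Fin n) (Fin n) ℂ) := rfl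

lemma mem_classicalLieAlgebra_A {n : ℕ} {x : Matrix (Fin n) (Fin n) ℂ} :
    x ∈ classicalLieAlgebra .A n ↔ x.trace = 0 := by
  change x ∈ LieAlgebra.SpecialLinear.sl (Fin n) ℂ ↔ _
  simp [LieAlgebra.SpecialLinear.sl, ← LieSubalgebra.mem_toSubmodule]

/-! ### Pulling back orthogonality along an injective homomorphism -/

section Frames

variable {X Y Z : ClassicalType} {n m k : ℕ}
  {φ : classicalLieAlgebra X n →ₗ⁅ℂ⁆ classicalLieAlgebra Y m}
  {ψ : classicalLieAlgebra Y m →ₗ⁅ℂ⁆ classicalLieAlgebra Z k}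

/-- After applying ψ, every term of the expanded bracket has two of the three pairwise orthogonal
images next to each other. Only brackets pass through ψ, so this, and not the vanishing of products,
is what can be pulled back. -/
lemma triple_lie_eq_zero (hψ : Function.Injective ψ) (hop : PreservesOrthogonality (ψ.comp φ))
    {x y z : classicalLieAlgebra X n}
    (hxy : (x : Matrix (Fin n) (Fin n) ℂ) * y = 0) (hyx : (y : Matrix (Fin n) (Fin n) ℂ) * x = 0)
    (hxz : (x : Matrix (Fin n) (Fin n) ℂ) * z = 0) (hzx : (z : Matrix (Fin n) (Fin n) ℂ) * x = 0)
    (hyz : (y : Matrix (Fin n) (Fin n) ℂ) * z = 0) (hzy : (z : Matrix (Fin n) (Fin n) ℂ) * y = 0)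
    (A : classicalLieAlgebra Y m) : ⁅φ x, ⁅φ y, ⁅φ z, A⁆⁆⁆ = 0 := by
  apply hψ
  have p1 := hop x y hxy hyx
  have p2 := hop y x hyx hxy
  have p3 := hop x z hxz hzx
  have p4 := hop z x hzx hxz
  have p5 := hop y z hyz hzy
  have p6 := hop z y hzy hyz
  simp only [LieHom.comp_apply] at p1 p2 p3 p4 p5 p6
  rw [LieHom.map_lie, LieHom.map_lie, LieHom.map_lie, map_zero]
  apply Subtype.ext
  simp only [coe_lie_classical]
  generalize (ψ (φ x) : Matrix (Fin k) (Fin k) ℂ) = a at *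
  generalize (ψ (φ y) : Matrix (Fin k) (Fin k) ℂ) = b at *
  generalize (ψ (φ z) : Matrix (Fin k) (Fin k) ℂ) = c at *
  generalize (ψ A : Matrix (Fin k) (Fin k) ℂ) = d at *
  have : a * (b * (c * d - d * c) - (c * d - d * c) * b) -
      (b * (c * d - d * c) - (c * d - d * c) * b) * a
      = a * b * (c * d - d * c) - a * c * d * b + a * d * (c * b)
        - b * c * d * a + b * d * (c * a) + c * d * (b * a) - d * c * (b * a) := by noncomm_ring
  rw [this, p1, p2, p3, p4, p5, p6]
  simp

lemma frame_mul_eq_zero (hψ : Function.Injective ψ) (hop : PreservesOrthogonality (ψ.comp φ))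
    (hY : IsSimpleDim Y m) (F : Fin 12 → Fin 12 → classicalLieAlgebra X n)
    (hbr : ∀ i j k, i ≠ j → j ≠ k → i ≠ k → ⁅F i j, F j k⁆ = F i k)
    (hz : ∀ i j k l, i ≠ j → i ≠ k → i ≠ l → j ≠ k → j ≠ l → k ≠ l →
      (F i j : Matrix (Fin n) (Fin n) ℂ) * (F k l : Matrix (Fin n) (Fin n) ℂ) = 0) :
    (φ (F 0 1) : Matrix (Fin m) (Fin m) ℂ) * (φ (F 2 3) : Matrix (Fin m) (Fin m) ℂ) = 0 := by
  have hf : BracketFrame fun i j => (φ (F i j) : Matrix (Fin m) (Fin m) ℂ) := by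
    constructor
    · intro i j k hij hjk hik
      rw [← hbr i j k hij hjk hik, LieHom.map_lie, coe_lie_classical]
    · intro i j k l hij hik hil hjk hjl hkl
      have h0 : ⁅F i j, F k l⁆ = 0 := by
        apply Subtype.ext
        rw [coe_lie_classical, hz i j k l hij hik hil hjk hjl hkl,
          hz k l i j hkl hik.symm hjk.symm hil.symm hjl.symm hij]
        simp
      have h1 := coe_lie_classical (φ (F i j)) (φ (F k l))
      rw [← LieHom.map_lie, h0, map_zero] at h1
      exact (sub_eq_zero.mp h1.symm)
  have h3 : ∀ i j k l p q, [i, j, k, l, p, q].Nodup → ∀ A : classicalLieAlgebra Y m,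
      ⁅φ (F i j), ⁅φ (F k l), ⁅φ (F p q), A⁆⁆⁆ = 0 := by
    intro i j k l p q hn A
    simp only [List.nodup_cons, List.mem_cons, not_or, List.not_mem_nil, not_false_eq_true,
      List.nodup_nil, and_true] at hn
    obtain ⟨⟨h1, h2, h3, h4, h5⟩, ⟨h6, h7, h8, h9⟩, ⟨h10, h11, h12⟩, ⟨h13, h14⟩, h15⟩ := hn
    refine triple_lie_eq_zero hψ hop ?_ ?_ ?_ ?_ ?_ ?_ A <;> apply hz <;>
      first | assumption | (apply Ne.symm; assumption)
  by_cases hYA : Y = .A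
  · subst hYA
    refine hf.mul_eq_zero_of_forall fun i j k l p q hn A => ?_
    -- Brackets ignore scalars, so vanishing on the traceless part gives vanishing on every matrix.
    have hA : A - (A.trace / m) • (1 : Matrix (Fin m) (Fin m) ℂ) ∈ classicalLieAlgebra .A m := by
      rw [mem_classicalLieAlgebra_A, Matrix.trace_sub, Matrix.trace_smul, Matrix.trace_one,
        Fintype.card_fin, smul_eq_mul, div_mul_cancel₀, sub_self]
      have : 2 ≤ m := hY
      exact_mod_cast (by omega : m ≠ 0)
    have := congrArg (Subtype.val) (h3 i j k l p q hn ⟨_, hA⟩)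
    simp only [coe_lie_classical] at this
    simp only [Ring.lie_def]
    have e : ∀ c : Matrix (Fin m) (Fin m) ℂ, ∀ t : ℂ,
        c * (A - t • 1) - (A - t • 1) * c = c * A - A * c := by
      intro c t
      simp only [mul_sub, sub_mul, mul_smul_comm, smul_mul_assoc, mul_one, one_mul]
      abel
    rw [e] at this
    exact this
  · obtain ⟨τ, ε, hform, hmem⟩ := exists_isFormData hYA hY
    refine hf.mul_eq_zero_of_skew (formAdjoint τ ε) hform.formAdjoint_mul
      hform.formAdjoint_formAdjoint (fun i j _ => (hmem _).mp (φ (F i j)).2) ?_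
    intro i j k l p q hn A hA
    exact congrArg (Subtype.val) (h3 i j k l p q hn ⟨A, (hmem A).mpr hA⟩)

end Frames

/-! ### Splitting of homomorphisms -/

/-- A homomorphism of classical Lie algebras which comes from a homomorphism and an
antihomomorphism of matrix algebras. -/
def IsSplit {X Y : ClassicalType} {n m : ℕ}
    (φ : classicalLieAlgebra X n →ₗ⁅ℂ⁆ classicalLieAlgebra Y m)
    (ρ₁ ρ₂ : Matrix (Fin n) (Fin n) ℂ →ₗ[ℂ] Matrix (Fin m) (Fin m) ℂ) : Prop :=
  IsSplitting ρ₁ ρ₂ ∧ ∀ x : classicalLieAlgebra X n, (φ x : Matrix (Fin m) (Fin m) ℂ) = ρ₁ x - ρ₂ x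

lemma IsSplit.preservesOrthogonality {X Y : ClassicalType} {n m : ℕ}
    {φ : classicalLieAlgebra X n →ₗ⁅ℂ⁆ classicalLieAlgebra Y m}
    {ρ₁ ρ₂ : Matrix (Fin n) (Fin n) ℂ →ₗ[ℂ] Matrix (Fin m) (Fin m) ℂ}
    (h : IsSplit φ ρ₁ ρ₂) : PreservesOrthogonality φ := by
  intro x y hxy hyx
  rw [h.2, h.2, sub_mul, mul_sub, mul_sub, ← h.1.map_mul, hxy, h.1.left_mul_right,
    h.1.right_mul_left, ← h.1.map_mul_rev, hyx]
  simp

lemma IsSplitting.map_commutator {I R : Type*} [Fintype I] [DecidableEq I] [Ring R] [Algebra ℂ R]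
    {ρ₁ ρ₂ : Matrix I I ℂ →ₗ[ℂ] R} (h : IsSplitting ρ₁ ρ₂) (x y : Matrix I I ℂ) :
    (ρ₁ x - ρ₂ x) * (ρ₁ y - ρ₂ y) - (ρ₁ y - ρ₂ y) * (ρ₁ x - ρ₂ x)
      = ρ₁ (x * y - y * x) - ρ₂ (x * y - y * x) := by
  simp only [sub_mul, mul_sub, h.left_mul_right, h.right_mul_left, ← h.map_mul, ← h.map_mul_rev,
    map_sub]
  abel

lemma mem_of_trace_eq_zero {n : ℕ} (o : Fin n) {P : Submodule ℂ (Matrix (Fin n) (Fin n) ℂ)}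
    (h1 : ∀ a b, a ≠ b → Matrix.single a b 1 ∈ P)
    (h2 : ∀ a, a ≠ o → Matrix.single a a 1 - Matrix.single o o 1 ∈ P)
    {x : Matrix (Fin n) (Fin n) ℂ} (hx : x.trace = 0) : x ∈ P := by
  have hsum : x = ∑ a, ∑ b,
      x a b • (Matrix.single a b 1 - if a = b then Matrix.single o o 1 else 0) := by
    simp only [smul_sub, Finset.sum_sub_distrib, smul_ite, smul_zero, Finset.sum_ite_eq,
      Finset.mem_univ, if_true]
    rw [← Finset.sum_smul, show ∑ a, x a a = x.trace from rfl, hx, zero_smul, sub_zero]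
    conv_lhs => rw [Matrix.matrix_eq_sum_single x]
    simp
  rw [hsum]
  refine Submodule.sum_mem _ fun a _ => Submodule.sum_mem _ fun b _ => Submodule.smul_mem _ _ ?_
  by_cases hab : a = b
  · subst hab
    rw [if_pos rfl]
    by_cases hao : a = o
    · rw [hao, sub_self]; exact P.zero_mem
    · exact h2 a hao
  · rw [if_neg hab, sub_zero]; exact h1 a b hab

section Existence

variable {Y Z : ClassicalType} {n m k : ℕ} {ψ : classicalLieAlgebra Y m →ₗ⁅ℂ⁆ classicalLieAlgebra Z k}

lemma lieHom_map_commutator {X Y : ClassicalType} {n m : ℕ}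
    (φ : classicalLieAlgebra X n →ₗ⁅ℂ⁆ classicalLieAlgebra Y m) {x y z : classicalLieAlgebra X n}
    (h : (x : Matrix (Fin n) (Fin n) ℂ) * y - y * (x : Matrix (Fin n) (Fin n) ℂ) = z) :
    (φ x : Matrix (Fin m) (Fin m) ℂ) * φ y - φ y * (φ x : Matrix (Fin m) (Fin m) ℂ) = φ z := by
  rw [← coe_lie_classical, ← LieHom.map_lie]
  congr 2
  exact Subtype.ext h

lemma lieHom_map_commute {X Y : ClassicalType} {n m : ℕ}
    (φ : classicalLieAlgebra X n →ₗ⁅ℂ⁆ classicalLieAlgebra Y m) {x y : classicalLieAlgebra X n}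
    (h : (x : Matrix (Fin n) (Fin n) ℂ) * y - y * (x : Matrix (Fin n) (Fin n) ℂ) = 0) :
    (φ x : Matrix (Fin m) (Fin m) ℂ) * φ y = φ y * (φ x : Matrix (Fin m) (Fin m) ℂ) := by
  have := lieHom_map_commutator φ (z := 0) (by simpa using h)
  rw [map_zero] at this
  exact sub_eq_zero.mp this

lemma exists_isSplit_A (hn : 24 ≤ n)
    (φ : classicalLieAlgebra .A n →ₗ⁅ℂ⁆ classicalLieAlgebra Y m) (hY : IsSimpleDim Y m)
    (hψ : Function.Injective ψ) (hop : PreservesOrthogonality (ψ.comp φ)) :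
    ∃ ρ₁ ρ₂, IsSplit φ ρ₁ ρ₂ := by
  obtain ⟨F, hF⟩ : ∃ F : Fin n → Fin n → classicalLieAlgebra .A n, ∀ a b, a ≠ b →
      (F a b : Matrix (Fin n) (Fin n) ℂ) = Matrix.single a b 1 := by
    refine ⟨fun a b => if h : a ≠ b then ⟨Matrix.single a b 1, ?_⟩ else 0, fun a b h => ?_⟩
    · rw [mem_classicalLieAlgebra_A, Matrix.trace_single_eq_of_ne _ _ _ h]
    · simp only [dif_pos h]
  have hI0 := isApartness_of_card (n := n) (τ := id) (fun _ => rfl) hn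
  have hI : IsApartness fun a b : Fin n => a ≠ b := by simpa using hI0
  have hbrF : ∀ a b c, a ≠ b → b ≠ c → a ≠ c →
      (F a b : Matrix (Fin n) (Fin n) ℂ) * F b c - F b c * (F a b : Matrix (Fin n) (Fin n) ℂ)
        = F a c := by
    intro a b c h1 h2 h3
    rw [hF a b h1, hF b c h2, hF a c h3, Matrix.single_mul_single_same,
      Matrix.single_mul_single_of_ne _ _ _ _ h3.symm]
    simp
  have hzero : ∀ a b c d, a ≠ b → a ≠ c → a ≠ d → b ≠ c → b ≠ d → c ≠ d →
      (φ (F a b) : Matrix (Fin m) (Fin m) ℂ) * (φ (F c d) : Matrix (Fin m) (Fin m) ℂ) = 0 := by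
    intro a b c d hab hac had hbc hbd hcd
    obtain ⟨s, hs, h0, h1, h2, h3⟩ := exists_twelve_apart (τ := id) (fun _ => rfl) hn ![a, b, c, d]
      (by intro i j hij; fin_cases i <;> fin_cases j <;> simp_all [eq_comm])
    have := frame_mul_eq_zero hψ hop hY (fun i j => F (s i) (s j))
      (fun i j k hij hjk hik => Subtype.ext
        (hbrF _ _ _ (hs i j hij).1 (hs j k hjk).1 (hs i k hik).1))
      (fun i j k l hij hik hil hjk hjl hkl => by
        rw [hF _ _ (hs i j hij).1, hF _ _ (hs k l hkl).1,
          Matrix.single_mul_single_of_ne _ _ _ _ (hs j k hjk).1])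
    rw [h0, h1, h2, h3] at this
    exact this
  obtain ⟨ρ₁, ρ₂, hρ, hfρ⟩ := exists_isSplitting hI
    (fun a b => (φ (F a b) : Matrix (Fin m) (Fin m) ℂ))
    (fun a b c h1 h2 h3 => lieHom_map_commutator φ (hbrF a b c h1 h2 h3))
    (fun a b x hab hxa hxb => by
      apply lieHom_map_commute
      rw [hF _ _ hab, hF _ _ hxb, Matrix.single_mul_single_of_ne _ _ _ _ hab.symm,
          Matrix.single_mul_single_of_ne _ _ _ _ hxb.symm, sub_self])
    (fun a x y hax hay hxy => by
      apply lieHom_map_commute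
      rw [hF _ _ hax, hF _ _ hay, Matrix.single_mul_single_of_ne _ _ _ _ hax.symm,
          Matrix.single_mul_single_of_ne _ _ _ _ hay.symm, sub_self]) hzero
  refine ⟨ρ₁, ρ₂, hρ, ?_⟩
  -- The traceless matrices on which φ = ρ₁ − ρ₂. It suffices to find in it E_ab for a ≠ b and E_aa
  -- − E_oo = [E_ao, E_oa].
  let P : Submodule ℂ (Matrix (Fin n) (Fin n) ℂ) :=
    (LinearMap.ker ((classicalLieAlgebra Y m).toSubmodule.subtype ∘ₗ (φ : _ →ₗ[ℂ] _)
      - (ρ₁ - ρ₂) ∘ₗ (classicalLieAlgebra .A n).toSubmodule.subtype)).map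
      (classicalLieAlgebra .A n).toSubmodule.subtype
  have hP : ∀ x, x ∈ P ↔ ∃ y : classicalLieAlgebra .A n,
      (φ y : Matrix (Fin m) (Fin m) ℂ) - (ρ₁ y - ρ₂ y) = 0 ∧
        (y : Matrix (Fin n) (Fin n) ℂ) = x := fun x => Iff.rfl
  intro x
  have hx : (x : Matrix (Fin n) (Fin n) ℂ) ∈ P := by
    let o : Fin n := ⟨0, by omega⟩
    refine mem_of_trace_eq_zero o ?_ ?_ (mem_classicalLieAlgebra_A.mp x.2)
    · intro a b hab
      refine (hP _).mpr ⟨F a b, ?_, hF a b hab⟩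
      rw [hF a b hab, sub_eq_zero]
      exact hfρ a b hab
    · intro a hao
      have h1 : ((F a o : Matrix (Fin n) (Fin n) ℂ) * (F o a : Matrix (Fin n) (Fin n) ℂ)
          - (F o a : Matrix (Fin n) (Fin n) ℂ) * (F a o : Matrix (Fin n) (Fin n) ℂ) :
            Matrix (Fin n) (Fin n) ℂ) = Matrix.single a a 1 - Matrix.single o o 1 := by
        rw [hF _ _ hao, hF _ _ hao.symm, Matrix.single_mul_single_same,
          Matrix.single_mul_single_same, one_mul]
      refine (hP _).mpr ⟨⁅F a o, F o a⁆, ?_, h1⟩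
      rw [LieHom.map_lie, coe_lie_classical, coe_lie_classical, hfρ _ _ hao, hfρ _ _ hao.symm,
        hρ.map_commutator, hF _ _ hao, hF _ _ hao.symm, sub_self]
  obtain ⟨y, hy, hyx⟩ := (hP _).mp hx
  rw [show y = x from Subtype.ext hyx] at hy
  exact sub_eq_zero.mp hy

/-- The skew element attached to a matrix unit. -/
def skewUnit (τ : Fin n → Fin n) (ε : Fin n → ℂ) (a b : Fin n) : Matrix (Fin n) (Fin n) ℂ :=
  Matrix.single a b 1 - (ε a * ε b) • Matrix.single (τ b) (τ a) 1

lemma skewUnit_mul_eq_zero {τ : Fin n → Fin n} {ε : Fin n → ℂ} {κ : ℂ} (h : IsFormData τ ε κ)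
    {a b c d : Fin n} (h1 : b ≠ c) (h2 : b ≠ τ d) (h3 : a ≠ τ c) (h4 : a ≠ d) :
    skewUnit τ ε a b * skewUnit τ ε c d = 0 := by
  have h3' : τ a ≠ c := fun hh => h3 (h.apply_eq_iff.mp hh)
  have h4' : τ a ≠ τ d := fun hh => h4 (by rw [← h.invol a, hh, h.invol])
  simp only [skewUnit, sub_mul, mul_sub, smul_mul_assoc, mul_smul_comm,
    Matrix.single_mul_single_of_ne _ _ _ _ h1, Matrix.single_mul_single_of_ne _ _ _ _ h2,
    Matrix.single_mul_single_of_ne _ _ _ _ h3', Matrix.single_mul_single_of_ne _ _ _ _ h4',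
    smul_zero, sub_zero]

lemma skewUnit_mul_skewUnit {τ : Fin n → Fin n} {ε : Fin n → ℂ} {κ : ℂ} (h : IsFormData τ ε κ)
    {a b x : Fin n} (h1 : a ≠ x ∧ a ≠ τ x) (h2 : b ≠ x ∧ b ≠ τ x) :
    skewUnit τ ε a x * skewUnit τ ε x b
        = Matrix.single a b 1 + (if a = b then Matrix.single (τ x) (τ x) 1 else 0) ∧
      skewUnit τ ε x b * skewUnit τ ε a x
        = (if a = b then Matrix.single x x 1 else 0)
          + (ε a * ε b) • Matrix.single (τ b) (τ a) 1 := by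
  have e1 : x ≠ τ b := fun hh => h2.2 (by rw [hh, h.invol])
  have e2 : τ a ≠ x := fun hh => h1.2 (by rw [← hh, h.invol])
  have e3 : τ x ≠ a := h1.2.symm
  have hs : ε a * ε x * (ε x * ε b) = ε a * ε b := by
    calc ε a * ε x * (ε x * ε b) = ε x * ε x * (ε a * ε b) := by ring
      _ = _ := by rw [h.sq, one_mul]
  have hs' : ε x * ε b * (ε a * ε x) = ε a * ε b := by
    calc ε x * ε b * (ε a * ε x) = ε x * ε x * (ε a * ε b) := by ring
      _ = _ := by rw [h.sq, one_mul]
  constructor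
  · simp only [skewUnit, sub_mul, mul_sub, smul_mul_assoc, mul_smul_comm,
      Matrix.single_mul_single_of_ne _ _ _ _ e1, Matrix.single_mul_single_of_ne _ _ _ _ e2,
      Matrix.single_mul_single_same, smul_zero, sub_zero, smul_smul, mul_one, zero_sub, smul_neg,
      sub_neg_eq_add, hs']
    by_cases hab : a = b
    · subst hab
      rw [Matrix.single_mul_single_same, if_pos rfl, h.sq, one_smul, mul_one]
    · rw [if_neg hab, Matrix.single_mul_single_of_ne _ _ _ _
        (fun hh => hab (by rw [← h.invol a, hh, h.invol])), smul_zero]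
  · simp only [skewUnit, sub_mul, mul_sub, smul_mul_assoc, mul_smul_comm,
      Matrix.single_mul_single_of_ne _ _ _ _ h2.2, Matrix.single_mul_single_of_ne _ _ _ _ e3,
      Matrix.single_mul_single_same, smul_zero, sub_zero, smul_smul, mul_one, zero_sub, smul_neg,
      sub_neg_eq_add, hs]
    by_cases hab : a = b
    · subst hab
      rw [Matrix.single_mul_single_same, if_pos rfl, mul_one]
    · rw [if_neg hab, Matrix.single_mul_single_of_ne _ _ _ _ (Ne.symm hab)]

lemma skewUnit_commutator {τ : Fin n → Fin n} {ε : Fin n → ℂ} {κ : ℂ} (h : IsFormData τ ε κ)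
    {a b x : Fin n} (h1 : a ≠ x ∧ a ≠ τ x) (h2 : b ≠ x ∧ b ≠ τ x) :
    skewUnit τ ε a x * skewUnit τ ε x b - skewUnit τ ε x b * skewUnit τ ε a x
      = skewUnit τ ε a b
        + if a = b then Matrix.single (τ x) (τ x) 1 - Matrix.single x x 1 else 0 := by
  rw [(skewUnit_mul_skewUnit h h1 h2).1, (skewUnit_mul_skewUnit h h1 h2).2, skewUnit]
  split_ifs <;> abel

lemma skewUnit_apply_apply {τ : Fin n → Fin n} {ε : Fin n → ℂ} {κ : ℂ} (h : IsFormData τ ε κ)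
    (a b : Fin n) : skewUnit τ ε (τ b) (τ a) = -(ε a * ε b) • skewUnit τ ε a b := by
  have : ε a * ε b * (ε a * ε b) = 1 := by
    rw [mul_mul_mul_comm, h.sq, h.sq, one_mul]
  rw [skewUnit, skewUnit, h.sign_mul_sign, h.invol, h.invol, smul_sub, smul_smul, neg_mul, this,
    mul_comm (ε b), neg_smul, neg_smul, one_smul]
  abel

lemma eq_sum_skewUnit {τ : Fin n → Fin n} {ε : Fin n → ℂ} {κ : ℂ} (h : IsFormData τ ε κ)
    {x : Matrix (Fin n) (Fin n) ℂ} (hx : formAdjoint τ ε x = -x) :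
    x = ∑ a, ∑ b, (2⁻¹ * x a b) • skewUnit τ ε a b := by
  have h1 : ∀ a b, skewUnit τ ε a b
      = Matrix.single a b 1 - formAdjoint τ ε (Matrix.single a b 1) := fun a b => by
    rw [h.formAdjoint_single, skewUnit]
  have h2 : x = (2⁻¹ : ℂ) • (x - formAdjoint τ ε x) := by
    rw [hx, sub_neg_eq_add, ← two_smul ℂ x, smul_smul]; norm_num
  have h3 : x = ∑ a, ∑ b, x a b • Matrix.single a b (1 : ℂ) := by
    conv_lhs => rw [Matrix.matrix_eq_sum_single x]
    simp
  conv_lhs => rw [h2, h3]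
  simp only [map_sum, map_smul, ← Finset.sum_sub_distrib, ← smul_sub, ← h1, Finset.smul_sum,
    smul_smul]

lemma exists_isSplit_of_formData {X : ClassicalType} {τ : Fin n → Fin n} {ε : Fin n → ℂ} {κ : ℂ}
    (hform : IsFormData τ ε κ) (hmem : ∀ A, A ∈ classicalLieAlgebra X n ↔ formAdjoint τ ε A = -A)
    (hn : 24 ≤ n) (φ : classicalLieAlgebra X n →ₗ⁅ℂ⁆ classicalLieAlgebra Y m)
    (hY : IsSimpleDim Y m) (hψ : Function.Injective ψ) (hop : PreservesOrthogonality (ψ.comp φ)) :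
    ∃ ρ, IsSplit φ ρ 0 := by
  obtain ⟨F, hF⟩ : ∃ F : Fin n → Fin n → classicalLieAlgebra X n, ∀ a b,
      (F a b : Matrix (Fin n) (Fin n) ℂ) = skewUnit τ ε a b := by
    refine ⟨fun a b => ⟨skewUnit τ ε a b, ?_⟩, fun a b => rfl⟩
    rw [hmem, skewUnit, ← hform.formAdjoint_single, map_sub, hform.formAdjoint_formAdjoint]
    abel
  have hI := isApartness_of_card (n := n) hform.invol hn
  have hbrF : ∀ a b c, a ≠ b ∧ a ≠ τ b → b ≠ c ∧ b ≠ τ c → a ≠ c ∧ a ≠ τ c →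
      (F a b : Matrix (Fin n) (Fin n) ℂ) * F b c - F b c * (F a b : Matrix (Fin n) (Fin n) ℂ)
        = F a c := by
    intro a b c h1 h2 h3
    rw [hF, hF, hF, skewUnit_commutator hform h1 (hI.symm h2), if_neg h3.1, add_zero]
  have hzero : ∀ a b c d, a ≠ b ∧ a ≠ τ b → a ≠ c ∧ a ≠ τ c → a ≠ d ∧ a ≠ τ d →
      b ≠ c ∧ b ≠ τ c → b ≠ d ∧ b ≠ τ d → c ≠ d ∧ c ≠ τ d →
      (φ (F a b) : Matrix (Fin m) (Fin m) ℂ) * (φ (F c d) : Matrix (Fin m) (Fin m) ℂ) = 0 := by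
    intro a b c d hab hac had hbc hbd hcd
    obtain ⟨s, hs, h0, h1, h2, h3⟩ := exists_twelve_apart hform.invol hn ![a, b, c, d] (by
      intro i j hij
      fin_cases i <;> fin_cases j <;>
        first | exact absurd rfl hij | assumption | (apply hI.symm; assumption))
    have := frame_mul_eq_zero hψ hop hY (fun i j => F (s i) (s j))
      (fun i j k hij hjk hik => Subtype.ext
        (hbrF _ _ _ (hs i j hij) (hs j k hjk) (hs i k hik)))
      (fun i j k l hij hik hil hjk hjl hkl => by
        rw [hF, hF]
        exact skewUnit_mul_eq_zero hform (hs j k hjk).1 (hs j l hjl).2 (hs i k hik).2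
          (hs i l hil).1)
    rw [h0, h1, h2, h3] at this
    exact this
  obtain ⟨ρ, hρ, hfρ⟩ := exists_map_mul τ ε hform.invol hform.sq hI
    (fun a b => (φ (F a b) : Matrix (Fin m) (Fin m) ℂ))
    (fun a b => by
      have : F (τ b) (τ a) = -(ε a * ε b) • F a b := Subtype.ext (by
        rw [hF, skewUnit_apply_apply hform, ← hF]; rfl)
      rw [this, map_smul]; rfl)
    (fun a b c h1 h2 h3 => lieHom_map_commutator φ (hbrF a b c h1 h2 h3))
    (fun x b y hxb hxy hby hb => by
      apply lieHom_map_commute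
      have e1 : τ b ≠ τ x := fun hh => hxb.1 (by rw [← hform.invol x, ← hh, hform.invol])
      rw [hF, hF, skewUnit_mul_eq_zero hform hb hby.2 (by rw [hform.invol]; exact hxb.1) hxy.1,
        skewUnit_mul_eq_zero hform hxy.1.symm (hI.symm hby).2 e1 hb.symm, sub_self]) hzero
  -- So far the formula covers only apart a, b. The commutators through x and through τx have
  -- opposite diagonal defects, so their sum is 2F_ab without restriction on a, b.
  have hfρ' : ∀ a b, (φ (F a b) : Matrix (Fin m) (Fin m) ℂ) = ρ (skewUnit τ ε a b) := by
    intro a b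
    obtain ⟨x, hax, hbx, -⟩ := hI.exists_apart a b b b b
    have hax' : a ≠ τ x ∧ a ≠ τ (τ x) := ⟨hax.2, by rw [hform.invol]; exact hax.1⟩
    have hbx' : b ≠ τ x ∧ b ≠ τ (τ x) := ⟨hbx.2, by rw [hform.invol]; exact hbx.1⟩
    have e1 := skewUnit_commutator hform hax hbx
    have e2 := skewUnit_commutator hform hax' hbx'
    have e3 : skewUnit τ ε a x * skewUnit τ ε x b - skewUnit τ ε x b * skewUnit τ ε a x
        + (skewUnit τ ε a (τ x) * skewUnit τ ε (τ x) b
          - skewUnit τ ε (τ x) b * skewUnit τ ε a (τ x)) = (2 : ℂ) • skewUnit τ ε a b := by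
      rw [e1, e2, hform.invol, two_smul]
      split_ifs <;> abel
    have e4 : ⁅F a x, F x b⁆ + ⁅F a (τ x), F (τ x) b⁆ = (2 : ℂ) • F a b := by
      apply Subtype.ext
      change ((⁅F a x, F x b⁆ : classicalLieAlgebra X n) : Matrix (Fin n) (Fin n) ℂ)
        + ((⁅F a (τ x), F (τ x) b⁆ : classicalLieAlgebra X n) : Matrix (Fin n) (Fin n) ℂ)
        = (2 : ℂ) • (F a b : Matrix (Fin n) (Fin n) ℂ)
      rw [coe_lie_classical, coe_lie_classical]
      simpa only [hF] using e3
    have e5 := congrArg (fun y => (φ y : Matrix (Fin m) (Fin m) ℂ)) e4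
    simp only [map_add, map_smul, LieHom.map_lie] at e5
    change ((⁅φ (F a x), φ (F x b)⁆ : classicalLieAlgebra Y m) : Matrix (Fin m) (Fin m) ℂ)
        + ((⁅φ (F a (τ x)), φ (F (τ x) b)⁆ : classicalLieAlgebra Y m) : Matrix (Fin m) (Fin m) ℂ)
        = (2 : ℂ) • (φ (F a b) : Matrix (Fin m) (Fin m) ℂ) at e5
    have e6 := congrArg ρ e3
    simp only [map_add, map_sub, map_smul, hρ] at e6
    rw [coe_lie_classical, coe_lie_classical, hfρ _ _ hax, hfρ _ _ (hI.symm hbx),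
      hfρ _ _ hax', hfρ _ _ (hI.symm hbx')] at e5
    exact smul_right_injective _ (two_ne_zero (α := ℂ)) (e5.symm.trans e6)
  refine ⟨ρ, ⟨hρ, by simp, by simp, by simp⟩, fun x => ?_⟩
  have hx : x = ∑ a, ∑ b, (2⁻¹ * (x : Matrix (Fin n) (Fin n) ℂ) a b) • F a b := by
    apply Subtype.ext
    conv_lhs => rw [eq_sum_skewUnit hform ((hmem _).mp x.2)]
    simp only [AddSubmonoidClass.coe_finsetSum, SetLike.val_smul, hF]
  rw [LinearMap.zero_apply, sub_zero]
  obtain ⟨t, hx⟩ : ∃ t : Fin n → Fin n → ℂ, x = ∑ a, ∑ b, t a b • F a b := ⟨_, hx⟩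
  rw [hx]
  simp only [map_sum, map_smul, AddSubmonoidClass.coe_finsetSum, SetLike.val_smul, hfρ', hF]

/-- A homomorphism for which a composition with an injective homomorphism preserves orthogonality
comes from homomorphisms of matrix algebras. -/
theorem exists_isSplit {X : ClassicalType} (hX : IsSimpleDim X n) (hn : 24 ≤ n)
    (φ : classicalLieAlgebra X n →ₗ⁅ℂ⁆ classicalLieAlgebra Y m) (hY : IsSimpleDim Y m)
    (hψ : Function.Injective ψ) (hop : PreservesOrthogonality (ψ.comp φ)) :
    ∃ ρ₁ ρ₂, IsSplit φ ρ₁ ρ₂ ∧ (X ≠ .A → ρ₂ = 0) := by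
  by_cases hXA : X = .A
  · subst hXA
    obtain ⟨ρ₁, ρ₂, h⟩ := exists_isSplit_A hn φ hY hψ hop
    exact ⟨ρ₁, ρ₂, h, fun h => absurd rfl h⟩
  · obtain ⟨τ, ε, hform, hmem⟩ := exists_isFormData hXA hX
    obtain ⟨ρ, h⟩ := exists_isSplit_of_formData hform hmem hn φ hY hψ hop
    exact ⟨ρ, 0, h, fun _ => rfl⟩

end Existence

/-! ### Multiplicities of split homomorphisms -/

/-- An idempotent is the inclusion of its range after the projection onto it; l is its rank. -/
lemma exists_factorization_of_idempotent {m : ℕ} {e : Matrix (Fin m) (Fin m) ℂ} (he : e * e = e) :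
    ∃ (l : ℕ) (P : Matrix (Fin m) (Fin l) ℂ) (L : Matrix (Fin l) (Fin m) ℂ),
      e = P * L ∧ L * P = 1 := by
  let f := Matrix.toLin' e
  let p := LinearMap.range f
  let b := Module.finBasis ℂ p
  let s := Pi.basisFun ℂ (Fin m)
  refine ⟨_, LinearMap.toMatrix b s p.subtype, LinearMap.toMatrix s b f.rangeRestrict, ?_, ?_⟩
  · rw [← LinearMap.toMatrix_comp]
    have : p.subtype ∘ₗ f.rangeRestrict = f := LinearMap.ext fun _ => rfl
    rw [this]
    exact (LinearMap.toMatrix'_toLin' e).symm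
  · rw [← LinearMap.toMatrix_comp]
    have : f.rangeRestrict ∘ₗ p.subtype = LinearMap.id := by
      ext ⟨x, y, hy⟩ : 1
      apply Subtype.ext
      change f x = x
      rw [← hy]
      simp only [f, Matrix.toLin'_apply, Matrix.mulVec_mulVec, he]
    rw [this, LinearMap.toMatrix_id]

lemma le_of_mul_eq_one {m l : ℕ} {P : Matrix (Fin m) (Fin l) ℂ} {L : Matrix (Fin l) (Fin m) ℂ}
    (h : L * P = 1) : l ≤ m := by
  have h1 : (L * P).rank = l := by rw [h, Matrix.rank_one, Fintype.card_fin]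
  have h2 := Matrix.rank_mul_le_left L P
  have h3 := Matrix.rank_le_width L
  omega

lemma trace_of_factorization {m l : ℕ} {P : Matrix (Fin m) (Fin l) ℂ}
    {L : Matrix (Fin l) (Fin m) ℂ} (h : L * P = 1) : (P * L).trace = l := by
  rw [Matrix.trace_mul_comm, h, Matrix.trace_one, Fintype.card_fin]

/-- Transposing gives det G = (−1)^l det G, with det G ≠ 0. -/
lemma even_of_skew_mul_eq_one {l : ℕ} {G H : Matrix (Fin l) (Fin l) ℂ}
    (hG : G.transpose = -G) (h : G * H = 1) : Even l := by
  have h1 : G.det ≠ 0 := by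
    intro h0
    have := congrArg Matrix.det h
    rw [Matrix.det_mul, h0, zero_mul, Matrix.det_one] at this
    exact zero_ne_one this
  have h2 : G.det = (-1) ^ l * G.det := by
    conv_lhs => rw [← Matrix.det_transpose, hG, Matrix.det_neg, Fintype.card_fin]
  by_contra hodd
  rw [Nat.not_even_iff_odd] at hodd
  rw [hodd.neg_one_pow] at h2
  exact h1 (by linear_combination h2 / 2)

section Trace

variable {n m : ℕ}

/-- The functional x ↦ tr ρ(x) is invariant under cyclic permutation, so E_ab = E_ao E_ob forces it
to be a multiple of the trace. -/
lemma trace_eq_of_map_mul {ρ : Matrix (Fin n) (Fin n) ℂ →ₗ[ℂ] Matrix (Fin m) (Fin m) ℂ}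
    (hρ : ∀ x y, ρ (x * y) = ρ x * ρ y) (o : Fin n) (x : Matrix (Fin n) (Fin n) ℂ) :
    (ρ x).trace = (ρ (Matrix.single o o 1)).trace * x.trace := by
  have key : Matrix.traceLinearMap (Fin m) ℂ ℂ ∘ₗ ρ
      = (ρ (Matrix.single o o 1)).trace • Matrix.traceLinearMap (Fin n) ℂ ℂ := by
    apply linearMap_matrix_ext
    intro a b
    have h1 : Matrix.single a b (1 : ℂ) = Matrix.single a o 1 * Matrix.single o b 1 := by simp
    simp only [LinearMap.comp_apply, Matrix.traceLinearMap_apply, LinearMap.smul_apply,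
      smul_eq_mul]
    rw [h1, hρ, Matrix.trace_mul_comm, ← hρ, Matrix.trace_mul_comm]
    by_cases hab : a = b
    · subst hab; simp
    · rw [Matrix.single_mul_single_of_ne _ _ _ _ (Ne.symm hab)]; simp
  exact LinearMap.congr_fun key x

lemma exists_multiplicity {ρ : Matrix (Fin n) (Fin n) ℂ →ₗ[ℂ] Matrix (Fin m) (Fin m) ℂ}
    (hρ : ∀ x y, ρ (x * y) = ρ x * ρ y) (o : Fin n) :
    ∃ l : ℕ, (∀ x, (ρ x).trace = l * x.trace) ∧ (l = 0 → ρ = 0) := by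
  have he : ρ (Matrix.single o o 1) * ρ (Matrix.single o o 1) = ρ (Matrix.single o o 1) := by
    rw [← hρ]; simp
  obtain ⟨l, P, L, hPL, hLP⟩ := exists_factorization_of_idempotent he
  refine ⟨l, fun x => ?_, ?_⟩
  · rw [trace_eq_of_map_mul hρ o, hPL, trace_of_factorization hLP]
  · rintro rfl
    have h0 : ρ (Matrix.single o o 1) = 0 := by rw [hPL]; ext; simp [Matrix.mul_apply]
    apply linearMap_matrix_ext
    intro a b
    have : Matrix.single a b (1 : ℂ)
        = Matrix.single a o 1 * (Matrix.single o o 1 * Matrix.single o b 1) := by simp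
    rw [this, hρ, hρ, h0]; simp

lemma exists_multiplicity_rev {ρ : Matrix (Fin n) (Fin n) ℂ →ₗ[ℂ] Matrix (Fin m) (Fin m) ℂ}
    (hρ : ∀ x y, ρ (x * y) = ρ y * ρ x) (o : Fin n) :
    ∃ l : ℕ, (∀ x, (ρ x).trace = l * x.trace) ∧ (l = 0 → ρ = 0) := by
  have hT : ∀ z, (ρ ∘ₗ (Matrix.transposeLinearEquiv (Fin n) (Fin n) ℂ ℂ).toLinearMap) z
      = ρ z.transpose := fun _ => rfl
  obtain ⟨l, h1, h2⟩ := exists_multiplicity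
    (ρ := ρ ∘ₗ (Matrix.transposeLinearEquiv (Fin n) (Fin n) ℂ ℂ).toLinearMap)
    (fun x y => by rw [hT, hT, hT, Matrix.transpose_mul, hρ]) o
  refine ⟨l, fun x => ?_, fun hl => ?_⟩
  · have := h1 x.transpose
    rwa [hT, Matrix.transpose_transpose, Matrix.trace_transpose] at this
  · ext1 x
    have := LinearMap.congr_fun (h2 hl) x.transpose
    rwa [hT, Matrix.transpose_transpose] at this

/-- The multiplicities of the natural and of the dual natural module in a split homomorphism. -/
def HasMultiplicities (ρ₁ ρ₂ : Matrix (Fin n) (Fin n) ℂ →ₗ[ℂ] Matrix (Fin m) (Fin m) ℂ)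
    (l r : ℕ) : Prop :=
  (∀ x, (ρ₁ x).trace = l * x.trace) ∧ ∀ x, (ρ₂ x).trace = r * x.trace

lemma IsSplitting.exists_hasMultiplicities
    {ρ₁ ρ₂ : Matrix (Fin n) (Fin n) ℂ →ₗ[ℂ] Matrix (Fin m) (Fin m) ℂ} (h : IsSplitting ρ₁ ρ₂)
    (hn : 0 < n) : ∃ l r, HasMultiplicities ρ₁ ρ₂ l r ∧ (l = 0 → ρ₁ = 0) ∧ (r = 0 → ρ₂ = 0) := by
  obtain ⟨l, h1, h2⟩ := exists_multiplicity h.map_mul ⟨0, hn⟩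
  obtain ⟨r, h3, h4⟩ := exists_multiplicity_rev h.map_mul_rev ⟨0, hn⟩
  exact ⟨l, r, ⟨h1, h3⟩, h2, h4⟩

/-- ρ₁(1) + ρ₂(1) is idempotent, so its trace (l+r)n is its rank. -/
lemma IsSplitting.multiplicities_mul_le
    {ρ₁ ρ₂ : Matrix (Fin n) (Fin n) ℂ →ₗ[ℂ] Matrix (Fin m) (Fin m) ℂ} (h : IsSplitting ρ₁ ρ₂)
    {l r : ℕ} (hm : HasMultiplicities ρ₁ ρ₂ l r) : (l + r) * n ≤ m := by
  have he : (ρ₁ 1 + ρ₂ 1) * (ρ₁ 1 + ρ₂ 1) = ρ₁ 1 + ρ₂ 1 := by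
    rw [add_mul, mul_add, mul_add, h.left_mul_right, h.right_mul_left, ← h.map_mul,
      ← h.map_mul_rev]
    simp
  obtain ⟨k, P, L, hPL, hLP⟩ := exists_factorization_of_idempotent he
  have h1 : ((ρ₁ 1 + ρ₂ 1).trace : ℂ) = ((l + r) * n : ℕ) := by
    rw [Matrix.trace_add, hm.1, hm.2, Matrix.trace_one, Fintype.card_fin]; push_cast; ring
  rw [hPL, trace_of_factorization hLP] at h1
  rw [← (Nat.cast_injective (R := ℂ) h1)]
  exact le_of_mul_eq_one hLP

/-- Squaring removes the sign in front of ρ₂ and cubing keeps it, so squares detect l + r and cubes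
detect l − r. -/
lemma IsSplitting.trace_sq
    {ρ₁ ρ₂ : Matrix (Fin n) (Fin n) ℂ →ₗ[ℂ] Matrix (Fin m) (Fin m) ℂ} (h : IsSplitting ρ₁ ρ₂)
    {l r : ℕ} (hm : HasMultiplicities ρ₁ ρ₂ l r) (x : Matrix (Fin n) (Fin n) ℂ) :
    ((ρ₁ x - ρ₂ x) * (ρ₁ x - ρ₂ x)).trace = (l + r) * (x * x).trace := by
  rw [sub_mul, mul_sub, mul_sub, h.left_mul_right, h.right_mul_left, ← h.map_mul,
    ← h.map_mul_rev, sub_zero, zero_sub, sub_neg_eq_add, Matrix.trace_add, hm.1, hm.2]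
  ring

lemma IsSplitting.trace_cube
    {ρ₁ ρ₂ : Matrix (Fin n) (Fin n) ℂ →ₗ[ℂ] Matrix (Fin m) (Fin m) ℂ} (h : IsSplitting ρ₁ ρ₂)
    {l r : ℕ} (hm : HasMultiplicities ρ₁ ρ₂ l r) (x : Matrix (Fin n) (Fin n) ℂ) :
    ((ρ₁ x - ρ₂ x) * ((ρ₁ x - ρ₂ x) * (ρ₁ x - ρ₂ x))).trace
      = (l - r) * (x * (x * x)).trace := by
  have h0 : (ρ₁ x - ρ₂ x) * (ρ₁ x - ρ₂ x) = ρ₁ (x * x) + ρ₂ (x * x) := by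
    rw [sub_mul, mul_sub, mul_sub, h.left_mul_right, h.right_mul_left, ← h.map_mul,
      ← h.map_mul_rev, sub_zero, zero_sub, sub_neg_eq_add]
  rw [h0, sub_mul, mul_add, mul_add, h.left_mul_right, h.right_mul_left, ← h.map_mul,
    ← h.map_mul_rev, add_zero, zero_add, Matrix.trace_sub, hm.1, hm.2, mul_assoc x x x]
  ring

/-- The adjoint preserves the trace and sends x³ to −x³. -/
lemma trace_cube_eq_zero_of_formData {τ : Fin n → Fin n} {ε : Fin n → ℂ} {κ : ℂ}
    (h : IsFormData τ ε κ) {x : Matrix (Fin n) (Fin n) ℂ} (hx : formAdjoint τ ε x = -x) :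
    (x * (x * x)).trace = 0 := by
  have ht : ∀ y, (formAdjoint τ ε y).trace = y.trace := by
    intro y
    simp only [Matrix.trace, Matrix.diag_apply, formAdjoint, LinearMap.coe_mk, AddHom.coe_mk,
      Matrix.of_apply, h.sq, one_mul]
    exact Equiv.sum_comp (show Function.Involutive τ from h.invol).toPerm fun i => y i i
  have h1 := ht (x * (x * x))
  rw [h.formAdjoint_mul, h.formAdjoint_mul, hx, mul_assoc] at h1
  simp only [neg_mul, mul_neg, neg_neg, Matrix.trace_neg] at h1
  linear_combination -(1 / 2 : ℂ) * h1

/-- Multiplicities are even if the forms of the source and the target have opposite signs. -/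
lemma even_multiplicity {τ₁ : Fin n → Fin n} {ε₁ : Fin n → ℂ} {κ₁ : ℂ} {τ₂ : Fin m → Fin m}
    {ε₂ : Fin m → ℂ} {κ₂ : ℂ} (h₁ : IsFormData τ₁ ε₁ κ₁) (h₂ : IsFormData τ₂ ε₂ κ₂)
    (hκ : κ₁ * κ₂ = -1) (hn : 24 ≤ n)
    {ρ : Matrix (Fin n) (Fin n) ℂ →ₗ[ℂ] Matrix (Fin m) (Fin m) ℂ}
    (hρ : ∀ x y, ρ (x * y) = ρ x * ρ y)
    (hskew : ∀ x, formAdjoint τ₁ ε₁ x = -x → formAdjoint τ₂ ε₂ (ρ x) = -ρ x)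
    {l : ℕ} (hl : ∀ x, (ρ x).trace = l * x.trace) : Even l := by
  set st₁ := formAdjoint τ₁ ε₁
  set st₂ := formAdjoint τ₂ ε₂
  have hI := isApartness_of_card (n := n) h₁.invol hn
  have hF : ∀ a b, st₁ (skewUnit τ₁ ε₁ a b) = -skewUnit τ₁ ε₁ a b := by
    intro a b
    rw [skewUnit, ← h₁.formAdjoint_single, map_sub, h₁.formAdjoint_formAdjoint]; abel
  -- ρ respects the adjoints on skew elements, hence on E_ab with a ≠ b, a product of two skew
  -- units, and then on E_aa, a product of two such E_ab.
  have hne : ∀ a b, a ≠ b →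
      st₂ (ρ (Matrix.single a b 1)) = ρ (st₁ (Matrix.single a b 1)) := by
    intro a b hab
    obtain ⟨x, hax, hbx, -⟩ := hI.exists_apart a b b b b
    have h := (skewUnit_mul_skewUnit h₁ hax hbx).1
    rw [if_neg hab, add_zero] at h
    rw [← h, hρ, h₂.formAdjoint_mul, h₁.formAdjoint_mul, hskew _ (hF _ _), hskew _ (hF _ _), hF,
      hF, hρ, map_neg, map_neg]
  have hall : ∀ a b, st₂ (ρ (Matrix.single a b 1)) = ρ (st₁ (Matrix.single a b 1)) := by
    intro a b
    by_cases hab : a = b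
    · subst hab
      obtain ⟨x, hax, -⟩ := hI.exists_apart a a a a a
      have h : Matrix.single a a (1 : ℂ) = Matrix.single a x 1 * Matrix.single x a 1 := by simp
      rw [h, hρ, h₂.formAdjoint_mul, hne _ _ hax.1, hne _ _ hax.1.symm, ← hρ,
        ← h₁.formAdjoint_mul]
    · exact hne a b hab
  let o : Fin n := ⟨0, by omega⟩
  let e := ρ (Matrix.single o o 1)
  let k := ρ (Matrix.single (τ₁ o) o 1)
  let k' := ρ (Matrix.single o (τ₁ o) 1)
  have he : e * e = e := by simp only [e]; rw [← hρ]; simp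
  have hke : k * e = k := by simp only [e, k]; rw [← hρ]; simp
  have hkk : k * k' = st₂ e := by
    simp only [e, k, k']
    rw [hall, h₁.formAdjoint_single, h₁.sq, one_smul, ← hρ]
    simp
  have hk : st₂ k = κ₁ • k := by
    simp only [k]
    rw [hall, h₁.formAdjoint_single, h₁.invol, h₁.sign, mul_assoc, h₁.sq, mul_one, map_smul]
  set Ω := IsFormData.gram τ₂ ε₂
  obtain ⟨l', P, L, hPL, hLP⟩ := exists_factorization_of_idempotent he
  have hll : l' = l := by
    have h := hl (Matrix.single o o 1)
    rw [show ρ (Matrix.single o o 1) = P * L from hPL, trace_of_factorization hLP] at h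
    simpa using h
  rw [← hll]
  -- Here k* = κ₁k and Ωᵀ = κ₂Ω, while κ₁κ₂ = −1.
  have hskewk : (Ω * k).transpose = -(Ω * k) := by
    have h := h₂.gram_mul_formAdjoint k
    rw [Matrix.transpose_mul, h₂.gram_transpose, Matrix.mul_smul, ← h, hk, Matrix.mul_smul,
      smul_smul, mul_comm κ₂, hκ, neg_one_smul]
  -- G is the form Ωk restricted to the range of e, which has dimension l. The relation kk' = e*
  -- supplies the inverse, so G is skew and nondegenerate.
  refine even_of_skew_mul_eq_one (G := P.transpose * (Ω * k) * P)
    (H := L * k' * Ω.transpose * L.transpose) ?_ ?_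
  · rw [Matrix.transpose_mul, Matrix.transpose_mul, hskewk, Matrix.transpose_transpose,
      ← Matrix.mul_assoc, Matrix.mul_neg, Matrix.neg_mul]
  · have hadj : Ω * st₂ e = e.transpose * Ω := h₂.gram_mul_formAdjoint e
    calc P.transpose * (Ω * k) * P * (L * k' * Ω.transpose * L.transpose)
        = P.transpose * (Ω * (k * (P * L) * k')) * Ω.transpose * L.transpose := by
          simp only [Matrix.mul_assoc]
      _ = P.transpose * e.transpose * (Ω * Ω.transpose) * L.transpose := by
          rw [← hPL, hke, hkk, hadj]; simp only [Matrix.mul_assoc]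
      _ = (L * (P * L) * P).transpose := by
          rw [h₂.gram_mul_transpose, Matrix.mul_one, ← hPL]
          simp only [Matrix.transpose_mul, Matrix.mul_assoc]
      _ = 1 := by
          rw [← Matrix.mul_assoc, hLP, Matrix.one_mul, hLP, Matrix.transpose_one]

end Trace

/-! ### Traces of diagonal homomorphisms -/

lemma trace_pi_map {l n : ℕ} (N : Matrix (Fin n) (Fin n) ℂ)
    (A : (Fin l → Fin n → ℂ) →ₗ[ℂ] (Fin l → Fin n → ℂ)) (hA : ∀ w a, A w a = N.mulVec (w a)) :
    LinearMap.trace ℂ _ A = l * N.trace := by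
  rw [LinearMap.trace_eq_matrix_trace ℂ (Pi.basis fun _ : Fin l => Pi.basisFun ℂ (Fin n)),
    Matrix.trace, Fintype.sum_sigma]
  simp only [Matrix.diag_apply, LinearMap.toMatrix_apply, Pi.basis_repr, Pi.basis_apply, hA,
    Pi.single_eq_same, Pi.basisFun_apply, Pi.basisFun_repr, Matrix.mulVec_single_one]
  simp [Matrix.trace, Matrix.col]

lemma trace_eq_of_signature {m n l r z : ℕ} (M : Matrix (Fin m) (Fin m) ℂ)
    (N N' : Matrix (Fin n) (Fin n) ℂ)
    (Φ : (Fin m → ℂ) ≃ₗ[ℂ] (Fin l → Fin n → ℂ) × (Fin r → Fin n → ℂ) × (Fin z → ℂ))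
    (h : ∀ v, Φ (M.mulVec v) =
      (fun a => N.mulVec ((Φ v).1 a), fun b => N'.mulVec ((Φ v).2.1 b), 0)) :
    M.trace = l * N.trace + r * N'.trace := by
  let A : (Fin l → Fin n → ℂ) →ₗ[ℂ] (Fin l → Fin n → ℂ) := LinearMap.pi fun a =>
    Matrix.mulVecLin N ∘ₗ LinearMap.proj a
  let B : (Fin r → Fin n → ℂ) →ₗ[ℂ] (Fin r → Fin n → ℂ) := LinearMap.pi fun a =>
    Matrix.mulVecLin N' ∘ₗ LinearMap.proj a
  have h1 : Φ.conj (Matrix.toLin' M)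
      = LinearMap.prodMap A (LinearMap.prodMap B (0 : (Fin z → ℂ) →ₗ[ℂ] (Fin z → ℂ))) := by
    apply LinearMap.ext
    intro w
    rw [LinearEquiv.conj_apply_apply, Matrix.toLin'_apply, h, Φ.apply_symm_apply]
    rfl
  rw [← Matrix.trace_toLin'_eq, ← LinearMap.trace_conj' _ Φ, h1, LinearMap.trace_prodMap',
    LinearMap.trace_prodMap', trace_pi_map N A (fun _ _ => rfl), trace_pi_map N' B fun _ _ => rfl,
    map_zero, add_zero]

section

variable {X Y : ClassicalType} {n m : ℕ}
  {φ : classicalLieAlgebra X n →ₗ⁅ℂ⁆ classicalLieAlgebra Y m} {l r z : ℕ}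

lemma HasSignature.trace_sq (h : HasSignature φ l r z) (x : classicalLieAlgebra X n) :
    ((φ x : Matrix (Fin m) (Fin m) ℂ) * (φ x : Matrix (Fin m) (Fin m) ℂ)).trace
      = (l + r) * ((x : Matrix (Fin n) (Fin n) ℂ) * (x : Matrix (Fin n) (Fin n) ℂ)).trace := by
  obtain ⟨Φ, hΦ⟩ := h
  set N := (x : Matrix (Fin n) (Fin n) ℂ)
  rw [trace_eq_of_signature _ (N * N) (-N.transpose * -N.transpose) Φ (fun v => by
    rw [← Matrix.mulVec_mulVec, hΦ, hΦ]; simp [N, Matrix.mulVec_mulVec]),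
    neg_mul_neg, ← Matrix.transpose_mul, Matrix.trace_transpose]
  ring

lemma HasSignature.trace_cube (h : HasSignature φ l r z) (x : classicalLieAlgebra X n) :
    ((φ x : Matrix (Fin m) (Fin m) ℂ) *
        ((φ x : Matrix (Fin m) (Fin m) ℂ) * (φ x : Matrix (Fin m) (Fin m) ℂ))).trace
      = (l - r) * ((x : Matrix (Fin n) (Fin n) ℂ) *
        ((x : Matrix (Fin n) (Fin n) ℂ) * (x : Matrix (Fin n) (Fin n) ℂ))).trace := by
  obtain ⟨Φ, hΦ⟩ := h
  set N := (x : Matrix (Fin n) (Fin n) ℂ)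
  rw [trace_eq_of_signature _ (N * (N * N)) (-N.transpose * (-N.transpose * -N.transpose)) Φ
    (fun v => by
      rw [← Matrix.mulVec_mulVec, ← Matrix.mulVec_mulVec, hΦ, hΦ, hΦ]
      simp [N, Matrix.mulVec_mulVec]),
    neg_mul_neg, neg_mul, ← Matrix.transpose_mul, ← Matrix.transpose_mul, Matrix.trace_neg,
    Matrix.trace_transpose, mul_assoc]
  ring

end

/-! ### Exhaustions -/

section ReadThrough

variable {g h k : Type*} [LieRing g] [LieAlgebra ℂ g] [LieRing h] [LieAlgebra ℂ h]
  [LieRing k] [LieAlgebra ℂ k] {X Y Z : ClassicalType} {n m p : ℕ}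
  (e : g ≃ₗ⁅ℂ⁆ classicalLieAlgebra X n) (f : h ≃ₗ⁅ℂ⁆ classicalLieAlgebra Y m)
  (u : k ≃ₗ⁅ℂ⁆ classicalLieAlgebra Z p)

lemma readThrough_apply (φ : g →ₗ⁅ℂ⁆ h) (x : g) : readThrough e f φ (e x) = f (φ x) := by
  simp [readThrough]

lemma readThrough_comp (φ : g →ₗ⁅ℂ⁆ h) (ψ : h →ₗ⁅ℂ⁆ k) :
    (readThrough f u ψ).comp (readThrough e f φ) = readThrough e u (ψ.comp φ) := by
  ext x : 1
  simp [readThrough]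

lemma readThrough_injective {φ : g →ₗ⁅ℂ⁆ h} (hφ : Function.Injective φ) :
    Function.Injective (readThrough e f φ) := by
  intro x y hxy
  apply e.symm.injective
  apply hφ
  apply f.injective
  simpa [readThrough] using hxy

end ReadThrough

section Exhaustion

variable {L : Type*} [LieRing L] [LieAlgebra ℂ L]

lemma IsExhaustion.exists_le {g : ℕ → LieSubalgebra ℂ L} (hg : IsExhaustion g)
    (K : Submodule ℂ L) [FiniteDimensional ℂ K] : ∃ i₀, ∀ i, i₀ ≤ i → K ≤ (g i).toSubmodule := by
  obtain ⟨s, hs⟩ := (Submodule.fg_iff_finiteDimensional K).mpr inferInstance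
  choose i hi using hg.exhausts
  refine ⟨s.sup i, fun j hj => ?_⟩
  rw [← hs, Submodule.span_le]
  intro x hx
  exact hg.monotone ((Finset.le_sup hx).trans hj) (hi x)

lemma IsExhaustion.exists_finrank_gt {g : ℕ → LieSubalgebra ℂ L} (hg : IsExhaustion g)
    (hinf : ¬ FiniteDimensional ℂ L) (N : ℕ) : ∃ i, N < Module.finrank ℂ (g i) := by
  by_contra! hN
  have hbdd : BddAbove (Set.range fun i => Module.finrank ℂ (g i)) :=
    ⟨N, by rintro _ ⟨i, rfl⟩; exact hN i⟩
  obtain ⟨i, hi⟩ := Nat.sSup_mem (Set.range_nonempty _) hbdd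
  have hmax : ∀ j, Module.finrank ℂ (g j) ≤ Module.finrank ℂ (g i) := fun j => by
    simp only at hi
    rw [hi]; exact le_csSup hbdd ⟨j, rfl⟩
  apply hinf
  have := hg.finiteDimensional
  have htop : (⊤ : Submodule ℂ L) = (g i).toSubmodule := by
    apply le_antisymm _ le_top
    intro x _
    obtain ⟨j, hj⟩ := hg.exhausts x
    have hle : (g i).toSubmodule ≤ (g (max i j)).toSubmodule := hg.monotone (le_max_left _ _)
    have : FiniteDimensional ℂ (g (max i j)).toSubmodule := hg.finiteDimensional _
    rw [Submodule.eq_of_le_of_finrank_le hle (hmax _)]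
    exact hg.monotone (le_max_right i j) hj
  have h1 : FiniteDimensional ℂ (⊤ : Submodule ℂ L) := by
    rw [htop]; exact hg.finiteDimensional i
  exact Module.finite_def.mpr ((Submodule.fg_iff_finiteDimensional _).mpr h1)

/-- An exhaustion which exhibits `L` as the diagonal Lie algebra `X(T)`. -/
structure DiagonalExhaustion (X : ClassicalType) (T : ℕ → SignatureTriple) (L : Type*) [LieRing L]
    [LieAlgebra ℂ L] where
  g : ℕ → LieSubalgebra ℂ L
  isExhaustion : IsExhaustion g
  e : ∀ i, g i ≃ₗ⁅ℂ⁆ classicalLieAlgebra X (SignatureTriple.dim T (i + 1))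
  isSimpleDim : ∀ i, IsSimpleDim X (SignatureTriple.dim T (i + 1))
  hasSignature : ∀ i, HasSignature
    (readThrough (e i) (e (i + 1)) (LieSubalgebra.inclusion (isExhaustion.monotone (Nat.le_succ i))))
    (T (i + 1)).l (T (i + 1)).r (T (i + 1)).z

lemma IsDiagonalLieAlgebra.nonempty_diagonalExhaustion {X : ClassicalType}
    {T : ℕ → SignatureTriple} (h : IsDiagonalLieAlgebra X T L) :
    Nonempty (DiagonalExhaustion X T L) := by
  obtain ⟨g, hg, e, h⟩ := h
  exact ⟨⟨g, hg, e, fun i => (h i).1, fun i => (h i).2⟩⟩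

namespace DiagonalExhaustion

variable {X : ClassicalType} {T : ℕ → SignatureTriple} (E : DiagonalExhaustion X T L)

lemma mono {i j : ℕ} (h : i ≤ j) : E.g i ≤ E.g j := E.isExhaustion.monotone h

/-- The matrix of an element in the natural module of a member of the exhaustion. -/
def mat (i : ℕ) (x : E.g i) :
    Matrix (Fin (SignatureTriple.dim T (i + 1))) (Fin (SignatureTriple.dim T (i + 1))) ℂ := E.e i x

/-- A classical algebra with natural dimension n has dimension at most n², and the dimensions in an
exhaustion of an infinite-dimensional algebra are unbounded. -/
lemma exists_dim_ge (E : DiagonalExhaustion X T L) (hT : SignatureTriple.IsAdmissible X T) (hinf : ¬ FiniteDimensional ℂ L)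
    (N : ℕ) : ∃ i₀, ∀ i, i₀ ≤ i → N ≤ SignatureTriple.dim T (i + 1) := by
  have hmono : Monotone (SignatureTriple.dim T) := monotone_nat_of_le_succ fun i => by
    have h1 : 0 < SignatureTriple.s T i := Nat.add_pos_left (hT.l_pos i) _
    calc SignatureTriple.dim T i ≤ SignatureTriple.s T i * SignatureTriple.dim T i :=
          Nat.le_mul_of_pos_left _ h1
      _ ≤ _ := Nat.le_add_right _ _
  obtain ⟨i₀, hi₀⟩ := E.isExhaustion.exists_finrank_gt hinf (N * N)
  refine ⟨i₀, fun i hi => le_trans ?_ (hmono (Nat.succ_le_succ hi))⟩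
  have h1 : Module.finrank ℂ (E.g i₀) ≤ SignatureTriple.dim T (i₀ + 1)
      * SignatureTriple.dim T (i₀ + 1) := by
    rw [LinearEquiv.finrank_eq (E.e i₀).toLinearEquiv]
    have h2 := Submodule.finrank_le
      (classicalLieAlgebra X (SignatureTriple.dim T (i₀ + 1))).toSubmodule
    rw [Module.finrank_matrix] at h2
    simp only [Fintype.card_fin, Module.finrank_self, mul_one] at h2
    exact h2
  by_contra! hlt
  exact absurd (hi₀.trans_le h1) (not_lt.mpr (Nat.mul_le_mul hlt.le hlt.le))

lemma preservesOrthogonality {i j : ℕ} (hij : i ≤ j) :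
    PreservesOrthogonality (readThrough (E.e i) (E.e j) (LieSubalgebra.inclusion (E.mono hij))) := by
  induction j, hij using Nat.le_induction with
  | base =>
    intro x y hxy _
    have : ∀ z, readThrough (E.e i) (E.e i) (LieSubalgebra.inclusion (E.mono le_rfl)) z = z := by
      intro z
      change E.e i ((E.e i).symm z) = z
      exact LieEquiv.apply_symm_apply _ _
    rw [this, this, hxy]
  | succ j hij ih =>
    have := (E.hasSignature j).preservesOrthogonality.comp ih
    rw [readThrough_comp] at this
    exact this

/-- K lies between g_i and a later g_j. The composite g_i ⊆ g_j preserves orthogonality, so g_i ⊆ K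
splits although nothing is assumed about how K sits in g_j. -/
lemma preservesOrthogonality_of_le {i : ℕ} (hi : 24 ≤ SignatureTriple.dim T (i + 1))
    {K : LieSubalgebra ℂ L} [FiniteDimensional ℂ K] (hK : E.g i ≤ K) {Y : ClassicalType} {m : ℕ}
    (hY : IsSimpleDim Y m) (f : K ≃ₗ⁅ℂ⁆ classicalLieAlgebra Y m) :
    PreservesOrthogonality (readThrough (E.e i) f (LieSubalgebra.inclusion hK)) := by
  have : FiniteDimensional ℂ K.toSubmodule := ‹_›
  obtain ⟨j₀, hj₀⟩ := E.isExhaustion.exists_le K.toSubmodule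
  have hKj : K ≤ E.g (max i j₀) := hj₀ _ (le_max_right _ _)
  have hcomp := readThrough_comp (E.e i) f (E.e (max i j₀)) (LieSubalgebra.inclusion hK)
    (LieSubalgebra.inclusion hKj)
  have hop : PreservesOrthogonality ((readThrough f (E.e (max i j₀))
      (LieSubalgebra.inclusion hKj)).comp (readThrough (E.e i) f (LieSubalgebra.inclusion hK))) := by
    rw [hcomp]
    exact E.preservesOrthogonality (le_max_left i j₀)
  obtain ⟨ρ₁, ρ₂, h, -⟩ := exists_isSplit (E.isSimpleDim i) hi _ hY
    (readThrough_injective _ _ (LieSubalgebra.inclusion_injective hKj)) hop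
  exact h.preservesOrthogonality

lemma mat_trace_sq_succ {i : ℕ} (x : E.g i) (hx : (x : L) ∈ E.g (i + 1)) :
    (E.mat (i + 1) ⟨x, hx⟩ * E.mat (i + 1) ⟨x, hx⟩).trace
      = (SignatureTriple.s T (i + 1) : ℂ) * (E.mat i x * E.mat i x).trace := by
  have := (E.hasSignature i).trace_sq (E.e i x)
  rw [readThrough_apply] at this
  rw [SignatureTriple.s, Nat.cast_add]
  exact this

lemma mat_trace_cube_succ (hT : SignatureTriple.IsAdmissible X T) {i : ℕ} (x : E.g i)
    (hx : (x : L) ∈ E.g (i + 1)) :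
    (E.mat (i + 1) ⟨x, hx⟩ * (E.mat (i + 1) ⟨x, hx⟩ * E.mat (i + 1) ⟨x, hx⟩)).trace
      = (SignatureTriple.c T (i + 1) : ℂ) * (E.mat i x * (E.mat i x * E.mat i x)).trace := by
  have := (E.hasSignature i).trace_cube (E.e i x)
  rw [readThrough_apply] at this
  rw [SignatureTriple.c, Nat.cast_sub (hT.r_le_l _)]
  exact this

/-- The products stay on both sides, without division, in parallel with the cubes, where a factor
c_k may be zero. -/
lemma mat_trace_sq {i j : ℕ} (hij : i ≤ j) (x : E.g i) :
    (∏ k ∈ Finset.range (i + 1), (SignatureTriple.s T k : ℂ)) *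
        (E.mat j ⟨x, E.mono hij x.2⟩ * E.mat j ⟨x, E.mono hij x.2⟩).trace
      = (∏ k ∈ Finset.range (j + 1), (SignatureTriple.s T k : ℂ)) *
        (E.mat i x * E.mat i x).trace := by
  induction j, hij using Nat.le_induction with
  | base => rfl
  | succ j hij ih =>
    rw [E.mat_trace_sq_succ ⟨x, E.mono hij x.2⟩, mul_left_comm, ih,
      Finset.prod_range_succ _ (j + 1)]
    ring

lemma mat_trace_cube (hT : SignatureTriple.IsAdmissible X T) {i j : ℕ} (hij : i ≤ j) (x : E.g i) :
    (∏ k ∈ Finset.range (i + 1), (SignatureTriple.c T k : ℂ)) *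
        (E.mat j ⟨x, E.mono hij x.2⟩ * (E.mat j ⟨x, E.mono hij x.2⟩ *
          E.mat j ⟨x, E.mono hij x.2⟩)).trace
      = (∏ k ∈ Finset.range (j + 1), (SignatureTriple.c T k : ℂ)) *
        (E.mat i x * (E.mat i x * E.mat i x)).trace := by
  induction j, hij using Nat.le_induction with
  | base => rfl
  | succ j hij ih =>
    rw [E.mat_trace_cube_succ hT ⟨x, E.mono hij x.2⟩, mul_left_comm, ih,
      Finset.prod_range_succ _ (j + 1)]
    ring

end DiagonalExhaustion

variable {L₁ L₂ : Type*} [LieRing L₁] [LieAlgebra ℂ L₁] [LieRing L₂] [LieAlgebra ℂ L₂]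
  {X₁ X₂ : ClassicalType} {T₁ T₂ : ℕ → SignatureTriple}

/-- A diagonal homomorphism splits on the members of the given exhaustions. -/
theorem exists_isSplit_restrictHom (E₁ : DiagonalExhaustion X₁ T₁ L₁)
    (E₂ : DiagonalExhaustion X₂ T₂ L₂) {θ : L₁ →ₗ⁅ℂ⁆ L₂} (hθ : IsDiagonalHom θ) {a : ℕ}
    (ha : 24 ≤ SignatureTriple.dim T₁ (a + 1)) :
    ∃ b₀, ∀ b, b₀ ≤ b → ∃ (h : ∀ x ∈ E₁.g a, θ x ∈ E₂.g b)
      (ρ₁ ρ₂ : _), IsSplit (readThrough (E₁.e a) (E₂.e b) (restrictHom θ (E₁.g a) (E₂.g b) h)) ρ₁ ρ₂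
        ∧ (X₁ ≠ .A → ρ₂ = 0) := by
  obtain ⟨-, g', h', hgh, hg', hh', i₀, hdiag⟩ := hθ
  have fd₁ : FiniteDimensional ℂ (E₁.g a).toSubmodule := E₁.isExhaustion.finiteDimensional a
  have fdθ : FiniteDimensional ℂ ((E₁.g a).toSubmodule.map (θ : L₁ →ₗ[ℂ] L₂)) := inferInstance
  obtain ⟨b₀, hb₀⟩ := E₂.isExhaustion.exists_le ((E₁.g a).toSubmodule.map (θ : L₁ →ₗ[ℂ] L₂))
  refine ⟨b₀, fun b hb => ?_⟩
  have hab : ∀ x ∈ E₁.g a, θ x ∈ E₂.g b := fun x hx => hb₀ b hb ⟨x, hx, rfl⟩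
  have fd₂ : FiniteDimensional ℂ (E₂.g b).toSubmodule := E₂.isExhaustion.finiteDimensional b
  obtain ⟨i₁, hi₁⟩ := hg'.exists_le (E₁.g a).toSubmodule
  obtain ⟨i₂, hi₂⟩ := hh'.exists_le (E₂.g b).toSubmodule
  set i := max i₀ (max i₁ i₂)
  have hga : E₁.g a ≤ g' i := hi₁ i ((le_max_left _ _).trans (le_max_right _ _))
  have hhb : E₂.g b ≤ h' i := hi₂ i ((le_max_right _ _).trans (le_max_right _ _))
  obtain ⟨-, X, Y, n, m, e, f, l, r, z, hX, hY, hsig⟩ := hdiag i (le_max_left _ _)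
  have := hg'.finiteDimensional i
  -- The map g_a ⊆ g'_i → h'_i preserves orthogonality. It also factors as g_a → h_b ⊆ h'_i, and the
  -- last inclusion is injective, so g_a → h_b splits.
  have hop := hsig.preservesOrthogonality.comp (E₁.preservesOrthogonality_of_le ha hga hX e)
  rw [readThrough_comp] at hop
  have hcomp := readThrough_comp (E₁.e a) (E₂.e b) f (restrictHom θ (E₁.g a) (E₂.g b) hab)
    (LieSubalgebra.inclusion hhb)
  have hop' : PreservesOrthogonality ((readThrough (E₂.e b) f (LieSubalgebra.inclusion hhb)).comp
      (readThrough (E₁.e a) (E₂.e b) (restrictHom θ (E₁.g a) (E₂.g b) hab))) := by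
    rw [hcomp]; exact hop
  obtain ⟨ρ₁, ρ₂, h⟩ := exists_isSplit (E₁.isSimpleDim a) ha _ (E₂.isSimpleDim b)
    (readThrough_injective _ _ (LieSubalgebra.inclusion_injective hhb)) hop'
  exact ⟨hab, ρ₁, ρ₂, h⟩

end Exhaustion

/-! ### Multiplicities of diagonal homomorphisms -/

/-- By polarization it is enough that the trace form is not identically zero. -/
lemma exists_trace_sq_ne_zero {X : ClassicalType} {n : ℕ} (hX : IsSimpleDim X n) (hn : 24 ≤ n) :
    ∃ x : classicalLieAlgebra X n,
      ((x : Matrix (Fin n) (Fin n) ℂ) * (x : Matrix (Fin n) (Fin n) ℂ)).trace ≠ 0 := by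
  suffices h : ∃ x y : classicalLieAlgebra X n,
      ((x : Matrix (Fin n) (Fin n) ℂ) * (y : Matrix (Fin n) (Fin n) ℂ)).trace ≠ 0 by
    obtain ⟨x, y, hxy⟩ := h
    by_contra! h0
    apply hxy
    have h1 := h0 (x + y)
    have h2 := Matrix.trace_mul_comm (x : Matrix (Fin n) (Fin n) ℂ) (y : Matrix (Fin n) (Fin n) ℂ)
    rw [AddMemClass.coe_add, add_mul, mul_add, mul_add, Matrix.trace_add, Matrix.trace_add,
      Matrix.trace_add, h0, h0, ← h2] at h1
    linear_combination h1 / 2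
  by_cases hXA : X = .A
  · subst hXA
    let i : Fin n := ⟨0, by omega⟩
    let j : Fin n := ⟨1, by omega⟩
    have hij : i ≠ j := by simp [i, j]
    refine ⟨⟨Matrix.single i j 1, ?_⟩, ⟨Matrix.single j i 1, ?_⟩, ?_⟩
    · rw [mem_classicalLieAlgebra_A, Matrix.trace_single_eq_of_ne _ _ _ hij]
    · rw [mem_classicalLieAlgebra_A, Matrix.trace_single_eq_of_ne _ _ _ hij.symm]
    · simp
  · obtain ⟨τ, ε, h, hmem⟩ := exists_isFormData hXA hX
    have hF : ∀ a b, skewUnit τ ε a b ∈ classicalLieAlgebra X n := by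
      intro a b
      rw [hmem, skewUnit, ← h.formAdjoint_single, map_sub, h.formAdjoint_formAdjoint, neg_sub]
    let a : Fin n := ⟨0, by omega⟩
    obtain ⟨x, hx, -⟩ := (isApartness_of_card (n := n) h.invol hn).exists_apart a a a a a
    refine ⟨⟨_, hF a x⟩, ⟨_, hF x a⟩, ?_⟩
    rw [(skewUnit_mul_skewUnit h hx hx).1, if_pos rfl, Matrix.trace_add,
      Matrix.trace_single_eq_same, Matrix.trace_single_eq_same]
    norm_num

/-- The witness is diag(1, 1, −2, 0, …), whose cube has trace −6. -/
lemma exists_trace_cube_ne_zero {n : ℕ} (hn : 24 ≤ n) :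
    ∃ x : classicalLieAlgebra .A n, ((x : Matrix (Fin n) (Fin n) ℂ) *
      ((x : Matrix (Fin n) (Fin n) ℂ) * (x : Matrix (Fin n) (Fin n) ℂ))).trace ≠ 0 := by
  let i : Fin n := ⟨0, by omega⟩
  let j : Fin n := ⟨1, by omega⟩
  let k : Fin n := ⟨2, by omega⟩
  let d : Fin n → ℂ := Pi.single i 1 + Pi.single j 1 - Pi.single k 2
  have hij : i ≠ j := by simp [i, j]
  have hik : i ≠ k := by simp [i, k]
  have hjk : j ≠ k := by simp [j, k]
  refine ⟨⟨Matrix.diagonal d, ?_⟩, ?_⟩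
  · rw [mem_classicalLieAlgebra_A, Matrix.trace_diagonal]
    simp only [d, Pi.sub_apply, Pi.add_apply, Finset.sum_sub_distrib, Finset.sum_add_distrib,
      Finset.sum_pi_single', Finset.mem_univ, if_true]
    norm_num
  · simp only [Matrix.diagonal_mul_diagonal, Matrix.trace_diagonal]
    have : ∀ t, d t * (d t * d t)
        = (Pi.single i 1 + Pi.single j 1 - Pi.single k 8 : Fin n → ℂ) t := by
      intro t
      simp only [d, Pi.sub_apply, Pi.add_apply, Pi.single_apply]
      by_cases h1 : t = i
      · subst h1; simp [hij, hik]
      by_cases h2 : t = j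
      · subst h2; simp [h1, hjk]
      by_cases h3 : t = k
      · subst h3; simp [h1, h2]; norm_num
      simp [h1, h2, h3]
    simp only [this, Pi.sub_apply, Pi.add_apply, Finset.sum_sub_distrib, Finset.sum_add_distrib,
      Finset.sum_pi_single', Finset.mem_univ, if_true]
    norm_num

/-! ### Parity and ratios of multiplicities -/

section

variable {L₁ L₂ : Type*} [LieRing L₁] [LieAlgebra ℂ L₁] [LieRing L₂] [LieAlgebra ℂ L₂]
  {X₁ X₂ : ClassicalType} {T₁ T₂ : ℕ → SignatureTriple}

/-- The pairs of types for which all diagonal homomorphisms have even multiplicity. -/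
def ClassicalType.IsMixed (X Y : ClassicalType) : Prop :=
  (X = .A ∧ Y ≠ .A) ∨ (X = .O ∧ Y = .C) ∨ (X = .C ∧ Y = .O)

/-- From type `A` into `C` or `O`, cubes have trace zero in the target, hence l = r. Between `O` and
`C` there is no dual part, and l is even by `even_multiplicity`. -/
lemma IsSplit.even_of_isMixed {X Y : ClassicalType} (hXY : X.IsMixed Y) {n m : ℕ} (hn : 24 ≤ n)
    (hX : IsSimpleDim X n) (hY : IsSimpleDim Y m)
    {φ : classicalLieAlgebra X n →ₗ⁅ℂ⁆ classicalLieAlgebra Y m}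
    {ρ₁ ρ₂ : Matrix (Fin n) (Fin n) ℂ →ₗ[ℂ] Matrix (Fin m) (Fin m) ℂ} (h : IsSplit φ ρ₁ ρ₂)
    (hρ₂ : X ≠ .A → ρ₂ = 0) {l r : ℕ} (hm : HasMultiplicities ρ₁ ρ₂ l r) : Even (l + r) := by
  rcases hXY with ⟨rfl, hYA⟩ | hXY
  · obtain ⟨τ, ε, hform, hmem⟩ := exists_isFormData hYA hY
    obtain ⟨x, hx⟩ := exists_trace_cube_ne_zero hn
    have h1 := trace_cube_eq_zero_of_formData hform ((hmem _).mp (φ x).2)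
    rw [h.2, h.1.trace_cube hm, mul_eq_zero, or_iff_left hx, sub_eq_zero, Nat.cast_inj] at h1
    exact ⟨l, by rw [h1]⟩
  · have hXA : X ≠ .A := by rintro rfl; simp at hXY
    have hYA : Y ≠ .A := by rintro rfl; simp at hXY
    have hs : X.formSign * Y.formSign = -1 := by
      rcases hXY with ⟨rfl, rfl⟩ | ⟨rfl, rfl⟩ <;> simp [ClassicalType.formSign]
    obtain ⟨τ₁, ε₁, hf₁, hmem₁⟩ := exists_isFormData hXA hX
    obtain ⟨τ₂, ε₂, hf₂, hmem₂⟩ := exists_isFormData hYA hY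
    have h0 := hρ₂ hXA
    have hr : r = 0 := by
      have := hm.2 1
      rw [h0, LinearMap.zero_apply, Matrix.trace_zero, Matrix.trace_one, Fintype.card_fin] at this
      have h2 : r * n = 0 := by exact_mod_cast this.symm
      exact (Nat.mul_eq_zero.mp h2).resolve_right (by omega)
    rw [hr, add_zero]
    refine even_multiplicity hf₁ hf₂ hs hn h.1.map_mul (fun x hx => ?_) hm.1
    have := (hmem₂ _).mp (φ ⟨x, (hmem₁ x).mpr hx⟩).2
    rwa [h.2, h0, LinearMap.zero_apply, sub_zero] at this

/-- Multiplicities of a diagonal homomorphism on the members of the given exhaustions. -/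
theorem exists_multiplicities (E₁ : DiagonalExhaustion X₁ T₁ L₁)
    (E₂ : DiagonalExhaustion X₂ T₂ L₂) {θ : L₁ →ₗ⁅ℂ⁆ L₂} (hθ : IsDiagonalHom θ) {a : ℕ}
    (ha : 24 ≤ SignatureTriple.dim T₁ (a + 1)) :
    ∃ b₀, ∀ b, b₀ ≤ b → ∃ (h : ∀ x ∈ E₁.g a, θ x ∈ E₂.g b) (l r : ℕ), 0 < l + r ∧
      (l + r) * SignatureTriple.dim T₁ (a + 1) ≤ SignatureTriple.dim T₂ (b + 1) ∧
      (∀ x : E₁.g a, (E₂.mat b ⟨θ x, h x x.2⟩ * E₂.mat b ⟨θ x, h x x.2⟩).trace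
        = ((l : ℂ) + r) * (E₁.mat a x * E₁.mat a x).trace) ∧
      (∀ x : E₁.g a, (E₂.mat b ⟨θ x, h x x.2⟩ * (E₂.mat b ⟨θ x, h x x.2⟩ *
          E₂.mat b ⟨θ x, h x x.2⟩)).trace
        = ((l : ℂ) - r) * (E₁.mat a x * (E₁.mat a x * E₁.mat a x)).trace) ∧
      (X₁.IsMixed X₂ → Even (l + r)) := by
  obtain ⟨b₀, hb₀⟩ := exists_isSplit_restrictHom E₁ E₂ hθ ha
  refine ⟨b₀, fun b hb => ?_⟩
  obtain ⟨h, ρ₁, ρ₂, hsplit, hρ₂⟩ := hb₀ b hb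
  obtain ⟨l, r, hm, hl, hr⟩ := hsplit.1.exists_hasMultiplicities (by omega)
  have hmat : ∀ x : E₁.g a, E₂.mat b ⟨θ x, h x x.2⟩ = ρ₁ (E₁.mat a x) - ρ₂ (E₁.mat a x) := by
    intro x
    have := hsplit.2 (E₁.e a x)
    rw [readThrough_apply] at this
    exact this
  have hsq : ∀ x : E₁.g a, (E₂.mat b ⟨θ x, h x x.2⟩ * E₂.mat b ⟨θ x, h x x.2⟩).trace
        = ((l : ℂ) + r) * (E₁.mat a x * E₁.mat a x).trace := fun x => by
    rw [hmat, hsplit.1.trace_sq hm]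
  refine ⟨h, l, r, ?_, hsplit.1.multiplicities_mul_le hm, hsq, fun x => ?_,
    fun hX => hsplit.even_of_isMixed hX ha (E₁.isSimpleDim a) (E₂.isSimpleDim b) hρ₂ hm⟩
  · by_contra h0
    obtain ⟨x, hx⟩ := exists_trace_sq_ne_zero (E₁.isSimpleDim a) ha
    have hz : readThrough (E₁.e a) (E₂.e b) (restrictHom θ (E₁.g a) (E₂.g b) h) x = 0 := by
      apply Subtype.ext
      rw [hsplit.2, hl (by omega), hr (by omega)]
      simp
    have hinj : Function.Injective (restrictHom θ (E₁.g a) (E₂.g b) h) := fun y z hyz =>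
      Subtype.ext (hθ.1 (congrArg Subtype.val hyz))
    have hx0 : x = 0 := readThrough_injective (E₁.e a) (E₂.e b) hinj (hz.trans (map_zero _).symm)
    exact hx (by rw [hx0]; simp)
  · rw [hmat, hsplit.1.trace_cube hm]

open SignatureTriple in
/-- The arithmetic content of the existence of a diagonal homomorphism. -/
theorem exists_multiplicity_ratios (hT₁ : IsAdmissible X₁ T₁) (hT₂ : IsAdmissible X₂ T₂)
    (hL₁ : IsDiagonalLieAlgebra X₁ T₁ L₁) (hL₂ : IsDiagonalLieAlgebra X₂ T₂ L₂)
    (hinf : ¬ FiniteDimensional ℂ L₁) {θ : L₁ →ₗ⁅ℂ⁆ L₂} (hθ : IsDiagonalHom θ) :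
    ∃ (a₀ b₁ u : ℕ) (w : ℤ), 0 < u ∧ ∀ a, a₀ ≤ a → ∃ b₀, ∀ b, b₀ ≤ b → ∃ l r : ℕ,
      (l + r) * dim T₁ (a + 1) ≤ dim T₂ (b + 1) ∧
      (l + r) * (∏ k ∈ Finset.range (a + 1), s T₁ k) * (∏ k ∈ Finset.range (b₁ + 1), s T₂ k)
        = u * ∏ k ∈ Finset.range (b + 1), s T₂ k ∧
      (X₁ = .A → ((l : ℤ) - r) * (∏ k ∈ Finset.range (a + 1), c T₁ k : ℕ) *
        (∏ k ∈ Finset.range (b₁ + 1), c T₂ k : ℕ) = w * (∏ k ∈ Finset.range (b + 1), c T₂ k : ℕ)) ∧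
      (X₁.IsMixed X₂ → Even (l + r)) := by
  obtain ⟨E₁⟩ := hL₁.nonempty_diagonalExhaustion
  obtain ⟨E₂⟩ := hL₂.nonempty_diagonalExhaustion
  obtain ⟨a₀, ha₀⟩ := DiagonalExhaustion.exists_dim_ge E₁ hT₁ hinf 24
  obtain ⟨b₁, hb₁⟩ := exists_multiplicities E₁ E₂ hθ (ha₀ a₀ le_rfl)
  obtain ⟨h₀, l₀, r₀, hJ₀, -, hsq₀, hcube₀, -⟩ := hb₁ b₁ le_rfl
  have hs : ∀ k, 0 < s T₁ k := fun k => Nat.add_pos_left (hT₁.l_pos k) _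
  -- The constants come from the reference pair g_{a₀} → h_{b₁}.
  refine ⟨a₀, b₁, (l₀ + r₀) * ∏ k ∈ Finset.range (a₀ + 1), s T₁ k,
    ((l₀ : ℤ) - r₀) * (∏ k ∈ Finset.range (a₀ + 1), c T₁ k : ℕ),
    Nat.mul_pos hJ₀ (Finset.prod_pos fun k _ => hs k), fun a ha => ?_⟩
  obtain ⟨b₀, hb₀⟩ := exists_multiplicities E₁ E₂ hθ (ha₀ a ha)
  refine ⟨max b₀ b₁, fun b hb => ?_⟩
  have hbb : b₁ ≤ b := (le_max_right _ _).trans hb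
  obtain ⟨h, l, r, -, hle, hsq, hcube, heven⟩ := hb₀ b ((le_max_left _ _).trans hb)
  refine ⟨l, r, hle, ?_, ?_, heven⟩
  -- For one x in g_{a₀}, the trace of θ(x)² in h_b is computed through g_a and through h_{b₁}; tr
  -- x² ≠ 0 is then cancelled.
  · obtain ⟨x', hx'⟩ := exists_trace_sq_ne_zero (E₁.isSimpleDim a₀) (ha₀ a₀ le_rfl)
    obtain ⟨x, rfl⟩ : ∃ x, E₁.e a₀ x = x' := ⟨(E₁.e a₀).symm x', LieEquiv.apply_symm_apply _ _⟩
    have e1 := E₁.mat_trace_sq ha x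
    have e2 := E₂.mat_trace_sq hbb ⟨θ x, h₀ x x.2⟩
    have e3 := hsq ⟨x, E₁.mono ha x.2⟩
    rw [hsq₀] at e2
    change (E₁.mat a₀ x * E₁.mat a₀ x).trace ≠ 0 at hx'
    rw [← Nat.cast_inj (R := ℂ)]
    push_cast
    apply mul_right_cancel₀ hx'
    rw [e3] at e2
    linear_combination (∏ k ∈ Finset.range (a₀ + 1), (s T₁ k : ℂ)) * e2
      - (l + r) * (∏ k ∈ Finset.range (b₁ + 1), (s T₂ k : ℂ)) * e1
  · rintro rfl
    obtain ⟨x', hx'⟩ := exists_trace_cube_ne_zero (ha₀ a₀ le_rfl)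
    obtain ⟨x, rfl⟩ : ∃ x, E₁.e a₀ x = x' := ⟨(E₁.e a₀).symm x', LieEquiv.apply_symm_apply _ _⟩
    have e1 := E₁.mat_trace_cube hT₁ ha x
    have e2 := E₂.mat_trace_cube hT₂ hbb ⟨θ x, h₀ x x.2⟩
    have e3 := hcube ⟨x, E₁.mono ha x.2⟩
    rw [hcube₀] at e2
    change (E₁.mat a₀ x * (E₁.mat a₀ x * E₁.mat a₀ x)).trace ≠ 0 at hx'
    rw [← Int.cast_inj (α := ℂ)]
    push_cast
    apply mul_right_cancel₀ hx'
    rw [e3] at e2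
    linear_combination (∏ k ∈ Finset.range (a₀ + 1), (c T₁ k : ℂ)) * e2
      - (l - r) * (∏ k ∈ Finset.range (b₁ + 1), (c T₂ k : ℂ)) * e1

end

/-! ### Divisibility of Steinitz numbers -/

namespace SteinitzNumber

lemma padicValNat_prod_range {f : ℕ → ℕ} (hf : ∀ i, 0 < f i) (p : Nat.Primes) (N : ℕ) :
    padicValNat (p : ℕ) (∏ i ∈ Finset.range N, f i)
      = ∑ i ∈ Finset.range N, padicValNat (p : ℕ) (f i) := by
  have : Fact (p : ℕ).Prime := ⟨p.2⟩
  induction N with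
  | zero => simp
  | succ N ih =>
    rw [Finset.prod_range_succ, Finset.sum_range_succ, padicValNat.mul
      (Finset.prod_pos fun i _ => hf i).ne' (hf N).ne', ih]

lemma padicValNat_prod_le_stz {f : ℕ → ℕ} (hf : ∀ i, 0 < f i) (p : Nat.Primes) (N : ℕ) :
    (padicValNat (p : ℕ) (∏ i ∈ Finset.range N, f i) : ℕ∞) ≤ stz f p := by
  rw [padicValNat_prod_range hf, Nat.cast_sum]
  exact le_iSup (fun N : ℕ => ∑ i ∈ Finset.range N, (padicValNat (p : ℕ) (f i) : ℕ∞)) N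

lemma stz_add_le {f : ℕ → ℕ} (hf : ∀ i, 0 < f i) (p : Nat.Primes) (c : ℕ) {x : ℕ∞} (N₀ : ℕ)
    (h : ∀ N, N₀ ≤ N → (padicValNat (p : ℕ) (∏ i ∈ Finset.range (N + 1), f i) : ℕ∞) + c ≤ x) :
    stz f p + c ≤ x := by
  rw [stz, ENat.iSup_add]
  refine iSup_le fun N => le_trans ?_ (h (max N₀ N) (le_max_left _ _))
  rw [padicValNat_prod_range hf, Nat.cast_sum]
  gcongr
  exact (le_max_right _ _).trans (Nat.le_succ _)

/-- Each partial product of f times v divides u times a partial product of g; the exponents are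
compared and N tends to infinity. -/
lemma stz_add_le_add_stz {f g : ℕ → ℕ} (hf : ∀ i, 0 < f i) (hg : ∀ i, 0 < g i) {u v : ℕ}
    (hu : 0 < u) (hv : 0 < v) (N₀ : ℕ)
    (h : ∀ N, N₀ ≤ N → ∃ M J : ℕ, J * (∏ i ∈ Finset.range (N + 1), f i) * v
      = u * ∏ i ∈ Finset.range M, g i) (p : Nat.Primes) :
    stz f p + (padicValNat (p : ℕ) v : ℕ∞) ≤ (padicValNat (p : ℕ) u : ℕ∞) + stz g p := by
  have : Fact (p : ℕ).Prime := ⟨p.2⟩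
  refine stz_add_le hf p _ N₀ fun N hN => ?_
  obtain ⟨M, J, hJ⟩ := h N hN
  have hg' : 0 < ∏ i ∈ Finset.range M, g i := Finset.prod_pos fun i _ => hg i
  have hf' : 0 < ∏ i ∈ Finset.range (N + 1), f i := Finset.prod_pos fun i _ => hf i
  have hJ0 : J ≠ 0 := by
    rintro rfl
    rw [zero_mul, zero_mul] at hJ
    exact (Nat.mul_pos hu hg').ne hJ
  have h1 := congrArg (padicValNat (p : ℕ)) hJ
  rw [padicValNat.mul (Nat.mul_pos (Nat.pos_of_ne_zero hJ0) hf').ne' hv.ne',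
    padicValNat.mul hJ0 hf'.ne', padicValNat.mul hu.ne' hg'.ne'] at h1
  refine le_trans ?_ (add_le_add_right (padicValNat_prod_le_stz hg p M) _)
  rw [← Nat.cast_add, ← Nat.cast_add, Nat.cast_le]
  omega

lemma IsFinite.padicValNat_value {P : SteinitzNumber} (hP : P.IsFinite) (p : Nat.Primes) :
    padicValNat (p : ℕ) P.value = (P p).toNat := by
  classical
  have hsub : (Function.mulSupport fun q : Nat.Primes => (q : ℕ) ^ (P q).toNat)
      ⊆ (hP.2.toFinset : Set Nat.Primes) := by
    intro q hq
    rw [Set.Finite.coe_toFinset, Set.mem_ofPred_eq]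
    intro h0
    exact hq (by simp [h0])
  rw [value, finprod_eq_prod_of_mulSupport_subset _ hsub]
  have hp : Fact (p : ℕ).Prime := ⟨p.2⟩
  have key : ∀ t : Finset Nat.Primes, padicValNat (p : ℕ) (∏ q ∈ t, (q : ℕ) ^ (P q).toNat)
      = if p ∈ t then (P p).toNat else 0 := by
    intro t
    induction t using Finset.induction_on with
    | empty => simp
    | insert q t hq ih =>
      have hq' : Fact (q : ℕ).Prime := ⟨q.2⟩
      rw [Finset.prod_insert hq, padicValNat.mul (pow_ne_zero _ q.2.ne_zero)
        (Finset.prod_ne_zero_iff.mpr fun q _ => pow_ne_zero _ q.2.ne_zero), ih, padicValNat.pow]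
      by_cases hpq : p = q
      · subst hpq; simp [hq]
      · have : (p : ℕ) ≠ q := fun h => hpq (Subtype.ext h)
        simp [padicValNat_primes this, hpq]
  rw [key]
  split_ifs with h
  · rfl
  · rw [Set.Finite.mem_toFinset, Set.mem_ofPred_eq, not_not] at h
    rw [h]; rfl

lemma value_pos (P : SteinitzNumber) : 0 < P.value :=
  finprod_induction (0 < ·) one_pos (fun _ _ => Nat.mul_pos) fun q => pow_pos q.2.pos _

lemma quot_gcd_left_add (P Q : SteinitzNumber) (p : Nat.Primes) :
    quot P (gcd P Q) p + gcd P Q p = P p := tsub_add_cancel_of_le (min_le_left _ _)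

lemma quot_gcd_right_add (P Q : SteinitzNumber) (p : Nat.Primes) :
    quot Q (gcd P Q) p + gcd P Q p = Q p := tsub_add_cancel_of_le (min_le_right _ _)

/-- At each prime the exponent of the greatest common divisor occurs on both sides and is finite, so
it cancels, leaving natural numbers. -/
lemma value_mul_le {P Q : SteinitzNumber} (hG : NoInfinitePower (gcd P Q))
    (hP : IsFinite (quot P (gcd P Q))) (hQ : IsFinite (quot Q (gcd P Q))) {u v : ℕ} (hu : 0 < u)
    (hv : 0 < v) (h : ∀ p : Nat.Primes, P p + (padicValNat (p : ℕ) v : ℕ∞)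
      ≤ (padicValNat (p : ℕ) u : ℕ∞) + Q p) :
    value (quot P (gcd P Q)) * v ∣ u * value (quot Q (gcd P Q)) := by
  have h1 : value (quot P (gcd P Q)) * v ≠ 0 := (Nat.mul_pos (value_pos _) hv).ne'
  have h2 : u * value (quot Q (gcd P Q)) ≠ 0 := (Nat.mul_pos hu (value_pos _)).ne'
  rw [← Nat.factorization_le_iff_dvd h1 h2]
  intro q
  by_cases hq : q.Prime
  swap
  · simp [Nat.factorization_eq_zero_of_not_prime _ hq]
  have : Fact q.Prime := ⟨hq⟩
  let p : Nat.Primes := ⟨q, hq⟩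
  rw [Nat.factorization_def _ hq, Nat.factorization_def _ hq, padicValNat.mul (value_pos _).ne'
    hv.ne', padicValNat.mul hu.ne' (value_pos _).ne']
  have e1 := hP.padicValNat_value p
  have e2 := hQ.padicValNat_value p
  have e3 := h p
  rw [← quot_gcd_left_add P Q p, ← quot_gcd_right_add P Q p, ← ENat.natCast_toNat (hP.1 p),
    ← ENat.natCast_toNat (hQ.1 p), ← ENat.natCast_toNat (hG p)] at e3
  change padicValNat q _ = _ at e1 e2
  rw [e1, e2]
  norm_cast at e3
  change _ + padicValNat q v ≤ padicValNat q u + _ at e3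
  omega

/-- ∞ minus a finite exponent is ∞, which a finite quotient does not allow. -/
lemma ne_top_of_quot {P G : SteinitzNumber} (hG : NoInfinitePower G) (h : IsFinite (quot P G))
    (p : Nat.Primes) : P p ≠ ⊤ := by
  intro hp
  apply h.1 p
  rw [quot, hp]
  rw [← ENat.natCast_toNat (hG p)]; rfl

/-- The quotient is bounded by the exponents of u. At a prime where P is infinite, so is Q, and the
convention ∞ − ∞ = 0 applies. -/
lemma isFinite_quot_gcd {P Q : SteinitzNumber} {u : ℕ} (hu : 0 < u)
    (h : ∀ p : Nat.Primes, P p ≤ (padicValNat (p : ℕ) u : ℕ∞) + Q p) :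
    IsFinite (quot P (gcd P Q)) := by
  have hle : ∀ p, quot P (gcd P Q) p ≤ (padicValNat (p : ℕ) u : ℕ∞) := by
    intro p
    rw [quot, gcd]
    rcases le_total (P p) (Q p) with hpq | hpq
    · rw [min_eq_left hpq, tsub_self]; exact zero_le
    · rw [min_eq_right hpq]; exact tsub_le_iff_right.mpr (h p)
  refine ⟨fun p => ne_top_of_le_ne_top (ENat.natCast_ne_top _) (hle p), ?_⟩
  have hfin : (u.primeFactors : Set ℕ).Finite := u.primeFactors.finite_toSet
  refine (hfin.preimage (f := fun p : Nat.Primes => (p : ℕ))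
    Subtype.val_injective.injOn).subset fun p hp => ?_
  rw [Set.mem_preimage, Finset.mem_coe, Nat.mem_primeFactors]
  refine ⟨p.2, ?_, hu.ne'⟩
  by_contra hdvd
  apply hp
  have := hle p
  rw [padicValNat.eq_zero_of_not_dvd hdvd, Nat.cast_zero] at this
  exact le_antisymm this zero_le

lemma stz_eq_top {f : ℕ → ℕ} (hf : ∀ i, 0 < f i) (p : Nat.Primes)
    (h : ∀ i, ∃ j, i < j ∧ (p : ℕ) ∣ f j) : stz f p = ⊤ := by
  have : Fact (p : ℕ).Prime := ⟨p.2⟩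
  have key : ∀ k : ℕ, ∃ N, k ≤ ∑ i ∈ Finset.range N, padicValNat (p : ℕ) (f i) := by
    intro k
    induction k with
    | zero => exact ⟨0, Nat.zero_le _⟩
    | succ k ih =>
      obtain ⟨N, hN⟩ := ih
      obtain ⟨j, hj, hdvd⟩ := h N
      refine ⟨j + 1, ?_⟩
      rw [Finset.sum_range_succ]
      have h1 := one_le_padicValNat_of_dvd (hf j).ne' hdvd
      have h2 : ∑ i ∈ Finset.range N, padicValNat (p : ℕ) (f i)
          ≤ ∑ i ∈ Finset.range j, padicValNat (p : ℕ) (f i) :=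
        Finset.sum_le_sum_of_subset (Finset.range_mono hj.le)
      omega
  rw [ENat.eq_top_iff_forall_ge]
  intro k
  obtain ⟨N, hN⟩ := key k
  refine le_trans ?_ (le_iSup _ N)
  exact_mod_cast hN

end SteinitzNumber

/-! ### Density and symmetry indices -/

namespace SignatureTriple

variable {X : ClassicalType} {T : ℕ → SignatureTriple}

lemma IsAdmissible.s_pos (hT : IsAdmissible X T) (i : ℕ) : 0 < s T i :=
  Nat.add_pos_left (hT.l_pos i) _

lemma IsAdmissible.densityIndex_nonneg (hT : IsAdmissible X T) : 0 ≤ densityIndex T :=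
  ge_of_tendsto' hT.tendsto_densitySeq fun i => by unfold densitySeq; positivity

lemma IsAdmissible.symmetryIndex_nonneg (hT : IsAdmissible X T) : 0 ≤ symmetryIndex T :=
  ge_of_tendsto' hT.tendsto_symmetrySeq fun i => by unfold symmetrySeq; positivity

lemma IsAdmissible.densityIndex_pos (hT : IsAdmissible X T) (h : ¬ IsSparse T) :
    0 < densityIndex T := hT.densityIndex_nonneg.lt_of_ne' h

/-- The sequence σ_j is eventually constant, at a positive value because no c_k vanishes. -/
lemma IsAdmissible.symmetryIndex_pos_of_isOneSided (hT : IsAdmissible X T)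
    (hc : ∀ i, 0 < c T i) (h : IsOneSided T) : 0 < symmetryIndex T := by
  obtain ⟨i, hi⟩ := h
  have hconst : ∀ j, i ≤ j → symmetrySeq T j = symmetrySeq T i := by
    intro j hj
    induction j, hj using Nat.le_induction with
    | base => rfl
    | succ j hj ih =>
      have hs : (s T (j + 1) : ℝ) ≠ 0 := by exact_mod_cast (hT.s_pos (j + 1)).ne'
      rw [← ih, symmetrySeq, Finset.prod_range_succ _ (j + 1), Finset.prod_range_succ _ (j + 1),
        hi (j + 1) (by omega), mul_div_mul_right _ _ hs, symmetrySeq]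
  rw [tendsto_nhds_unique hT.tendsto_symmetrySeq
    (tendsto_atTop_of_eventually_const (i₀ := i) hconst)]
  exact div_pos (Finset.prod_pos fun k _ => by exact_mod_cast hc k)
    (Finset.prod_pos fun k _ => by exact_mod_cast hT.s_pos k)

lemma IsPure.exists_densitySeq_eq (hT : IsAdmissible X T) (h : IsPure T) :
    ∃ i, ∀ j, i ≤ j → densitySeq T j = densityIndex T := by
  obtain ⟨i, -, hi⟩ := h
  refine ⟨i + 1, fun j hj => ?_⟩
  rw [hi j (by omega)]
  exact (tendsto_nhds_unique hT.tendsto_densitySeq (tendsto_atTop_of_eventually_const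
    (i₀ := i + 1) fun k hk => hi k (by omega))).symm

/-- If c_j = 0 then s_j = 2l_j is even, and this occurs infinitely often. -/
lemma IsSymmetric.stz_two (hT : IsAdmissible X T) (h : IsSymmetric T) :
    SteinitzNumber.stz (s T) ⟨2, Nat.prime_two⟩ = ⊤ := by
  refine SteinitzNumber.stz_eq_top hT.s_pos _ fun i => ?_
  obtain ⟨j, hj, hc⟩ := h i
  refine ⟨j, hj, ?_⟩
  have h1 := hT.r_le_l j
  rw [c] at hc
  change 2 ∣ (T j).l + (T j).r
  omega

variable {X₁ X₂ : ClassicalType} {T₁ T₂ : ℕ → SignatureTriple}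

/-- Dimension estimates for multiplicities give estimates for the density indices. -/
lemma density_le (hT₁ : IsAdmissible X₁ T₁) (hT₂ : IsAdmissible X₂ T₂) {u v : ℕ} (hu : 0 < u)
    {a₀ : ℕ}
    (h : ∀ a, a₀ ≤ a → ∃ b₀, ∀ b, b₀ ≤ b → ∃ J : ℕ, J * dim T₁ (a + 1) ≤ dim T₂ (b + 1) ∧
      J * (∏ k ∈ Finset.range (a + 1), s T₁ k) * v = u * ∏ k ∈ Finset.range (b + 1), s T₂ k) :
    u * densityIndex T₂ ≤ v * densityIndex T₁ ∧
      (IsPure T₁ → IsDense T₂ → u * densityIndex T₂ < v * densityIndex T₁) := by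
  have key : ∀ a, a₀ ≤ a → ∃ b₀, ∀ b, b₀ ≤ b →
      u * densitySeq T₂ (b + 1) ≤ v * densitySeq T₁ (a + 1) := by
    intro a ha
    obtain ⟨b₀, hb₀⟩ := h a ha
    refine ⟨b₀, fun b hb => ?_⟩
    obtain ⟨J, hle, heq⟩ := hb₀ b hb
    have h1 : (0 : ℝ) < dim T₁ (a + 1) := by exact_mod_cast hT₁.dim_pos (a + 1)
    have h2 : (0 : ℝ) < dim T₂ (b + 1) := by exact_mod_cast hT₂.dim_pos (b + 1)
    have h3 : (J : ℝ) * dim T₁ (a + 1) ≤ dim T₂ (b + 1) := by exact_mod_cast hle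
    have h4 : (J : ℝ) * (∏ k ∈ Finset.range (a + 1), (s T₁ k : ℝ)) * v
        = u * ∏ k ∈ Finset.range (b + 1), (s T₂ k : ℝ) := by exact_mod_cast heq
    rw [densitySeq, densitySeq, mul_div_assoc', mul_div_assoc', div_le_div_iff₀ h2 h1, ← h4]
    have h5 : 0 ≤ (v : ℝ) * ∏ k ∈ Finset.range (a + 1), (s T₁ k : ℝ) := by positivity
    calc _ = (v * ∏ k ∈ Finset.range (a + 1), (s T₁ k : ℝ)) * (J * dim T₁ (a + 1)) := by ring
      _ ≤ _ := mul_le_mul_of_nonneg_left h3 h5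
  have hlim₁ := (tendsto_add_atTop_iff_nat 1).mpr hT₁.tendsto_densitySeq
  have hlim₂ := (tendsto_add_atTop_iff_nat 1).mpr hT₂.tendsto_densitySeq
  constructor
  · refine ge_of_tendsto (hlim₁.const_mul _) (eventually_atTop.mpr ⟨a₀, fun a ha => ?_⟩)
    obtain ⟨b₀, hb₀⟩ := key a ha
    exact le_of_tendsto (hlim₂.const_mul _) (eventually_atTop.mpr ⟨b₀, hb₀⟩)
  -- Limits lose strictness, so one finite stage is used: there the density of T₁ is already
  -- attained, while that of T₂ is still above its limit.
  · intro hp hd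
    obtain ⟨i, hi⟩ := hp.exists_densitySeq_eq hT₁
    obtain ⟨b₀, hb₀⟩ := key (max a₀ i) (le_max_left _ _)
    have := hb₀ b₀ le_rfl
    rw [hi (max a₀ i + 1) ((le_max_right _ _).trans (Nat.le_succ _))] at this
    exact lt_of_lt_of_le (mul_lt_mul_of_pos_left (hd.2 _) (by exact_mod_cast hu)) this

/-- Comparison of multiplicities gives estimates for the symmetry indices. -/
lemma symmetry_le (hT₁ : IsAdmissible X₁ T₁) (hT₂ : IsAdmissible X₂ T₂) {u v v' : ℕ} {w : ℤ}
    {a₀ : ℕ}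
    (h : ∀ a, a₀ ≤ a → ∃ b₀, ∀ b, b₀ ≤ b → ∃ l r : ℕ,
      (l + r) * (∏ k ∈ Finset.range (a + 1), s T₁ k) * v = u * (∏ k ∈ Finset.range (b + 1), s T₂ k) ∧
      ((l : ℤ) - r) * (∏ k ∈ Finset.range (a + 1), c T₁ k : ℕ) * v'
        = w * (∏ k ∈ Finset.range (b + 1), c T₂ k : ℕ)) :
    w.natAbs * v * symmetryIndex T₂ ≤ u * v' * symmetryIndex T₁ := by
  refine ge_of_tendsto (hT₁.tendsto_symmetrySeq.const_mul _)
    (eventually_atTop.mpr ⟨a₀, fun a ha => ?_⟩)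
  obtain ⟨b₀, hb₀⟩ := h a ha
  refine le_of_tendsto (hT₂.tendsto_symmetrySeq.const_mul _)
    (eventually_atTop.mpr ⟨b₀, fun b hb => ?_⟩)
  obtain ⟨l, r, hs, hc⟩ := hb₀ b hb
  have hP₁ : (0 : ℝ) < ∏ k ∈ Finset.range (a + 1), (s T₁ k : ℝ) :=
    Finset.prod_pos fun k _ => by exact_mod_cast hT₁.s_pos k
  have hP₂ : (0 : ℝ) < ∏ k ∈ Finset.range (b + 1), (s T₂ k : ℝ) :=
    Finset.prod_pos fun k _ => by exact_mod_cast hT₂.s_pos k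
  -- The estimate of the symmetry indices comes from |l − r| ≤ l + r alone.
  have hD : ((l : ℤ) - r).natAbs ≤ l + r := by omega
  have hc' := congrArg Int.natAbs hc
  rw [Int.natAbs_mul, Int.natAbs_mul, Int.natAbs_mul, Int.natAbs_natCast, Int.natAbs_natCast,
    Int.natAbs_natCast] at hc'
  set D := ((l : ℤ) - r).natAbs
  have h1 : (D : ℝ) * (∏ k ∈ Finset.range (a + 1), (c T₁ k : ℝ)) * v'
      = w.natAbs * ∏ k ∈ Finset.range (b + 1), (c T₂ k : ℝ) := by exact_mod_cast hc'
  have h2 : ((l + r : ℕ) : ℝ) * (∏ k ∈ Finset.range (a + 1), (s T₁ k : ℝ)) * v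
      = u * ∏ k ∈ Finset.range (b + 1), (s T₂ k : ℝ) := by exact_mod_cast hs
  have h3 : (D : ℝ) ≤ ((l + r : ℕ) : ℝ) := by exact_mod_cast hD
  rw [symmetrySeq, symmetrySeq, mul_div_assoc', mul_div_assoc', div_le_div_iff₀ hP₂ hP₁]
  set P₁ := ∏ k ∈ Finset.range (a + 1), (s T₁ k : ℝ)
  set A₁ := ∏ k ∈ Finset.range (a + 1), (c T₁ k : ℝ)
  have h4 : 0 ≤ A₁ * v' * P₁ * v := by positivity
  calc _ = (w.natAbs * ∏ k ∈ Finset.range (b + 1), (c T₂ k : ℝ)) * v * P₁ := by ring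
    _ = D * (A₁ * v' * P₁ * v) := by rw [← h1]; ring
    _ ≤ ((l + r : ℕ) : ℝ) * (A₁ * v' * P₁ * v) := mul_le_mul_of_nonneg_right h3 h4
    _ = (((l + r : ℕ) : ℝ) * P₁ * v) * (A₁ * v') := by ring
    _ = _ := by rw [h2]; ring

end SignatureTriple

/-! ### The comparison of the indices -/

namespace SignatureTriple

open SteinitzNumber

variable {X₁ X₂ : ClassicalType} {T₁ T₂ : ℕ → SignatureTriple}

/-- The inequalities mR₁v ≤ uR₂ and uδ₂ ≤ vδ₁ are chained through uR₂δ₂, and v cancels. -/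
lemma ratio_le {R₁ R₂ u v m : ℕ} {δ₁ δ₂ : ℝ} {p q : Prop} (hR₂ : 0 < R₂) (hv : 0 < v)
    (hδ₁ : 0 < δ₁) (hδ₂ : 0 < δ₂) (hδ : u * δ₂ ≤ v * δ₁ ∧ (p → q → u * δ₂ < v * δ₁))
    (h : m * (R₁ * v) ≤ u * R₂) :
    m * ((R₁ : ℝ) / δ₁) ≤ R₂ / δ₂ ∧ (p → q → m * ((R₁ : ℝ) / δ₁) < R₂ / δ₂) := by
  have hv' : (0 : ℝ) < v := by exact_mod_cast hv
  have hR₂' : (0 : ℝ) < R₂ := by exact_mod_cast hR₂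
  have h1 : (m : ℝ) * (R₁ * v) ≤ u * R₂ := by exact_mod_cast h
  have h2 : v * (m * R₁ * δ₂) ≤ R₂ * (u * δ₂) := by
    calc v * (m * R₁ * δ₂) = m * (R₁ * v) * δ₂ := by ring
      _ ≤ u * R₂ * δ₂ := mul_le_mul_of_nonneg_right h1 hδ₂.le
      _ = _ := by ring
  rw [mul_div_assoc', div_le_div_iff₀ hδ₁ hδ₂, div_lt_div_iff₀ hδ₁ hδ₂]
  refine ⟨le_of_mul_le_mul_left (h2.trans ?_) hv', fun hp hq =>
    lt_of_mul_lt_mul_left (h2.trans_lt ?_) hv'.le⟩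
  · calc _ ≤ R₂ * (v * δ₁) := mul_le_mul_of_nonneg_left hδ.1 hR₂'.le
      _ = _ := by ring
  · calc _ < R₂ * (v * δ₁) := mul_lt_mul_of_pos_left (hδ.2 hp hq) hR₂'
      _ = _ := by ring

/-- If all multiplicities are multiples of `m`, then so is the ratio of the finite quotients of the
Steinitz numbers. -/
lemma mul_value_dvd (hT₁ : IsAdmissible X₁ T₁) (hT₂ : IsAdmissible X₂ T₂) {S : SteinitzNumber}
    (hS : S = gcd (stz (s T₁)) (stz (s T₂))) (hSfin : NoInfinitePower S)
    (hR₁ : IsFinite (quot (stz (s T₁)) S)) (hR₂ : IsFinite (quot (stz (s T₂)) S)) {u v m a₀ : ℕ}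
    (hu : 0 < u) (hv : 0 < v) (hm : 0 < m)
    (h : ∀ a, a₀ ≤ a → ∃ b J : ℕ, m ∣ J ∧
      J * (∏ k ∈ Finset.range (a + 1), s T₁ k) * v = u * ∏ k ∈ Finset.range (b + 1), s T₂ k) :
    m * (value (quot (stz (s T₁)) S) * v) ∣ u * value (quot (stz (s T₂)) S) := by
  subst hS
  -- Writing J = mK moves the factor m into the constant v.
  have h1 := value_mul_le hSfin hR₁ hR₂ hu (Nat.mul_pos hm hv)
    (stz_add_le_add_stz hT₁.s_pos hT₂.s_pos hu (Nat.mul_pos hm hv) a₀ fun a ha => by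
      obtain ⟨b, J, ⟨K, rfl⟩, hJ⟩ := h a ha
      exact ⟨b + 1, K, by rw [← hJ]; ring⟩)
  rwa [mul_left_comm] at h1

end SignatureTriple
end

/-! ### The main theorem -/

open SteinitzNumber SignatureTriple in
theorem mainTheorem12
    {L₁ L₂ : Type*} [LieRing L₁] [LieAlgebra ℂ L₁] [LieRing L₂] [LieAlgebra ℂ L₂]
    (X₁ X₂ : ClassicalType) (T₁ T₂ : ℕ → SignatureTriple)
    (hT₁ : IsAdmissible X₁ T₁) (hT₂ : IsAdmissible X₂ T₂)
    (hL₁ : IsDiagonalLieAlgebra X₁ T₁ L₁) (hL₂ : IsDiagonalLieAlgebra X₂ T₂ L₂)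
    (hinf₁ : ¬ FiniteDimensional ℂ L₁) (hinf₂ : ¬ FiniteDimensional ℂ L₂)
    (hns₁ : ¬ IsSparse T₁) (hns₂ : ¬ IsSparse T₂)
    (S₁ S₂ S R₁ R₂ C₁ C₂ C B₁ B₂ : SteinitzNumber)
    (hS₁ : S₁ = stz (s T₁)) (hS₂ : S₂ = stz (s T₂)) (hS : S = gcd S₁ S₂)
    (hR₁ : R₁ = quot S₁ S) (hR₂ : R₂ = quot S₂ S)
    (hC₁ : C₁ = stz (c T₁)) (hC₂ : C₂ = stz (c T₂)) (hC : C = gcd C₁ C₂)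
    (hB₁ : B₁ = quot C₁ C) (hB₂ : B₂ = quot C₂ C)
    (δ₁ δ₂ σ₁ σ₂ : ℝ)
    (hδ₁ : δ₁ = densityIndex T₁) (hδ₂ : δ₂ = densityIndex T₂)
    (hσ₁ : σ₁ = symmetryIndex T₁) (hσ₂ : σ₂ = symmetryIndex T₂)
    (hSfin : NoInfinitePower S) (hR₁fin : IsFinite R₁) (hR₂fin : IsFinite R₂)
    (θ : L₁ →ₗ⁅ℂ⁆ L₂) (hθ : IsDiagonalHom θ) :
    ((value R₁ : ℝ) / δ₁ ≤ (value R₂ : ℝ) / δ₂ ∧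
      (IsPure T₁ → IsDense T₂ → (value R₁ : ℝ) / δ₁ < (value R₂ : ℝ) / δ₂)) ∧
    (((X₁ = .A ∧ X₂ = .C) ∨ (X₁ = .A ∧ X₂ = .O) ∨ (X₁ = .O ∧ X₂ = .C) ∨ (X₁ = .C ∧ X₂ = .O) ∨
      (X₁ = .A ∧ X₂ = .A ∧ ¬ IsFinite B₁) ∨
      (X₁ = .A ∧ X₂ = .A ∧ IsFinite B₁ ∧ IsWeaklyNonSymmetric T₁ ∧
        (IsOneSided T₂ ∨ IsStronglyNonSymmetric T₂)) ∨
      (X₁ = .A ∧ X₂ = .A ∧ IsFinite B₁ ∧ IsFinite B₂ ∧ NoInfinitePower C ∧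
        IsStronglyNonSymmetric T₁ ∧ IsStronglyNonSymmetric T₂ ∧
        (value R₁ : ℝ) * σ₁ / (value B₁ : ℝ) < (value R₂ : ℝ) * σ₂ / (value B₂ : ℝ))) →
      2 * ((value R₁ : ℝ) / δ₁) ≤ (value R₂ : ℝ) / δ₂ ∧
        (IsPure T₁ → IsDense T₂ →
          2 * ((value R₁ : ℝ) / δ₁) < (value R₂ : ℝ) / δ₂)) := by
  subst hδ₁ hδ₂ hσ₁ hσ₂ hS₁ hS₂ hR₁ hR₂ hC₁ hC₂ hB₁ hB₂
  obtain ⟨a₀, b₁, u, w, hu, hθu⟩ := exists_multiplicity_ratios hT₁ hT₂ hL₁ hL₂ hinf₁ hθ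
  set v := ∏ k ∈ Finset.range (b₁ + 1), s T₂ k
  set v' := ∏ k ∈ Finset.range (b₁ + 1), c T₂ k
  have hv : 0 < v := Finset.prod_pos fun k _ => hT₂.s_pos k
  have hδ := density_le hT₁ hT₂ hu (a₀ := a₀) (v := v) fun a ha => by
    obtain ⟨b₀, hb₀⟩ := hθu a ha
    refine ⟨b₀, fun b hb => ?_⟩
    obtain ⟨l, r, h1, h2, -⟩ := hb₀ b hb
    exact ⟨l + r, h1, h2⟩
  have hratio : ∀ m : ℕ, _ → _ := fun m => ratio_le (m := m) (value_pos (quot (stz (s T₂)) S)) hv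
    (hT₁.densityIndex_pos hns₁) (hT₂.densityIndex_pos hns₂) hδ
    (R₁ := value (quot (stz (s T₁)) S))
  have hdvd : ∀ m : ℕ, 0 < m → (∀ a, a₀ ≤ a → ∃ b₀, ∀ b, b₀ ≤ b → ∀ l r : ℕ,
      ((X₁ = .A → ((l : ℤ) - r) * (∏ k ∈ Finset.range (a + 1), c T₁ k : ℕ) * (v' : ℕ)
        = w * (∏ k ∈ Finset.range (b + 1), c T₂ k : ℕ)) ∧
      (X₁.IsMixed X₂ → Even (l + r))) → m ∣ l + r) →
      m * (value (quot (stz (s T₁)) S) * v) ∣ u * value (quot (stz (s T₂)) S) := by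
    intro m hm h
    refine mul_value_dvd hT₁ hT₂ hS hSfin hR₁fin hR₂fin hu hv hm (a₀ := a₀) fun a ha => ?_
    obtain ⟨b₀, hb₀⟩ := hθu a ha
    obtain ⟨b₀', hb₀'⟩ := h a ha
    obtain ⟨l, r, -, h2, h3⟩ := hb₀ (max b₀ b₀') (le_max_left _ _)
    exact ⟨_, l + r, hb₀' _ (le_max_right _ _) l r h3, h2⟩
  have hpos : 0 < u * value (quot (stz (s T₂)) S) := Nat.mul_pos hu (value_pos _)
  have hdvd₁ := hdvd 1 one_pos fun a _ => ⟨0, fun b _ l r _ => one_dvd _⟩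
  constructor
  · simpa only [Nat.cast_one, one_mul] using hratio 1 (Nat.le_of_dvd hpos hdvd₁)
  intro hcase
  -- All of (ii) reduces to doubling the integer inequality R₁v ≤ uR₂; the density estimate is the
  -- same as in (i).
  suffices hle : 2 * (value (quot (stz (s T₁)) S) * v) ≤ u * value (quot (stz (s T₂)) S) by
    simpa only [Nat.cast_ofNat] using hratio 2 hle
  by_cases hmix : X₁.IsMixed X₂
  · exact Nat.le_of_dvd hpos (hdvd 2 two_pos fun a _ =>
      ⟨0, fun b _ l r h => (h.2 hmix).two_dvd⟩)
  obtain ⟨rfl, rfl, hAA⟩ : X₁ = .A ∧ X₂ = .A ∧ (¬ IsFinite (quot (stz (c T₁)) C) ∨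
      (IsWeaklyNonSymmetric T₁ ∧ (IsOneSided T₂ ∨ IsStronglyNonSymmetric T₂)) ∨
      (IsFinite (quot (stz (c T₁)) C) ∧ IsFinite (quot (stz (c T₂)) C) ∧ NoInfinitePower C ∧
        (value (quot (stz (s T₁)) S) : ℝ) * symmetryIndex T₁ / value (quot (stz (c T₁)) C)
          < value (quot (stz (s T₂)) S) * symmetryIndex T₂ / value (quot (stz (c T₂)) C))) := by
    rcases hcase with ⟨rfl, rfl⟩ | ⟨rfl, rfl⟩ | ⟨rfl, rfl⟩ | ⟨rfl, rfl⟩ | ⟨h1, h2, h3⟩ |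
      ⟨h1, h2, -, h4⟩ | ⟨h1, h2, h3, h4, h5, -, -, h8⟩
    iterate 4 exact absurd (by simp [ClassicalType.IsMixed]) hmix
    · exact ⟨h1, h2, Or.inl h3⟩
    · exact ⟨h1, h2, Or.inr (Or.inl h4)⟩
    · exact ⟨h1, h2, Or.inr (Or.inr ⟨h3, h4, h5, h8⟩)⟩
  -- A symmetric sequence would make S_i divisible by 2^∞, contradicting the finiteness of R_i and
  -- of the exponents of S.
  have hc₁ := hT₁.c_pos fun h => ne_top_of_quot hSfin hR₁fin _ (h.stz_two hT₁)
  have hc₂ := hT₂.c_pos fun h => ne_top_of_quot hSfin hR₂fin _ (h.stz_two hT₂)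
  have hv' : 0 < v' := Finset.prod_pos fun k _ => hc₂ k
  -- As all c_k are positive, w = 0 forces l = r at every stage, so l + r is even.
  by_cases hw : w = 0
  · refine Nat.le_of_dvd hpos (hdvd 2 two_pos fun a _ => ⟨0, fun b _ l r h => ?_⟩)
    have h1 := h.1 rfl
    have h2 : 0 < ∏ k ∈ Finset.range (a + 1), c T₁ k := Finset.prod_pos fun k _ => hc₁ k
    rw [hw, zero_mul, mul_eq_zero, or_iff_left (by exact_mod_cast hv'.ne'), mul_eq_zero,
      or_iff_left (by exact_mod_cast h2.ne')] at h1
    omega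
  have hw' : 0 < w.natAbs := Int.natAbs_pos.mpr hw
  obtain ⟨k, hk⟩ := hdvd₁
  by_contra! hlt
  -- R₁v divides uR₂ and is more than half of it, so the two are equal.
  have hk1 : u * value (quot (stz (s T₂)) S) = value (quot (stz (s T₁)) S) * v := by
    have h1 : 0 < value (quot (stz (s T₁)) S) * v := Nat.mul_pos (value_pos _) hv
    have h2 : k < 2 := by
      by_contra! h2
      rw [hk, one_mul, mul_comm] at hlt
      exact absurd hlt (not_lt.mpr (Nat.mul_le_mul_right _ h2))
    have h3 : k ≠ 0 := by
      rintro rfl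
      rw [mul_zero] at hk
      exact hpos.ne' hk
    obtain rfl : k = 1 := by omega
    rw [hk, one_mul, mul_one]
  have hσ := symmetry_le hT₁ hT₂ (v := v) (v' := v') (w := w) (u := u) (a₀ := a₀) fun a ha => by
    obtain ⟨b₀, hb₀⟩ := hθu a ha
    refine ⟨b₀, fun b hb => ?_⟩
    obtain ⟨l, r, -, h2, h3, -⟩ := hb₀ b hb
    exact ⟨l, r, h2, h3 rfl⟩
  have hstz := stz_add_le_add_stz hc₁ hc₂ hw' hv' a₀ fun a ha => by
    obtain ⟨b₀, hb₀⟩ := hθu a ha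
    obtain ⟨l, r, -, -, h3, -⟩ := hb₀ b₀ le_rfl
    have h4 := congrArg Int.natAbs (h3 rfl)
    rw [Int.natAbs_mul, Int.natAbs_mul, Int.natAbs_mul, Int.natAbs_natCast, Int.natAbs_natCast,
      Int.natAbs_natCast] at h4
    exact ⟨b₀ + 1, _, h4⟩
  have hur : (0 : ℝ) < u := by exact_mod_cast hu
  have hvr : (0 : ℝ) < v := by exact_mod_cast hv
  have hvr' : (0 : ℝ) < v' := by exact_mod_cast hv'
  have hwr : (0 : ℝ) < w.natAbs := by exact_mod_cast hw'
  rcases hAA with hB | ⟨hweak, hT₂'⟩ | ⟨hB₁, hB₂, hCfin, hlt'⟩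
  · apply hB
    rw [hC]
    exact isFinite_quot_gcd hw' fun p => le_self_add.trans (hstz p)
  · rw [hweak.2.2, mul_zero] at hσ
    have h1 : 0 < symmetryIndex T₂ := by
      rcases hT₂' with h | h
      · exact hT₂.symmetryIndex_pos_of_isOneSided hc₂ h
      · exact hT₂.symmetryIndex_nonneg.lt_of_ne' h.2.2
    exact absurd hσ (not_le.mpr (mul_pos (mul_pos hwr hvr) h1))
  · subst hC
    have h1 := Nat.le_of_dvd (Nat.mul_pos hw' (value_pos _))
      (value_mul_le hCfin hB₁ hB₂ hw' hv' hstz)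
    set β₁ := value (quot (stz (c T₁)) (gcd (stz (c T₁)) (stz (c T₂))))
    set β₂ := value (quot (stz (c T₂)) (gcd (stz (c T₁)) (stz (c T₂))))
    set ρ₁ := value (quot (stz (s T₁)) S)
    set ρ₂ := value (quot (stz (s T₂)) S)
    have hβ₁ : (0 : ℝ) < β₁ := by exact_mod_cast value_pos _
    have hβ₂ : (0 : ℝ) < β₂ := by exact_mod_cast value_pos _
    have h1r : (β₁ : ℝ) * v' ≤ w.natAbs * β₂ := by exact_mod_cast h1
    have hk1r : (u : ℝ) * ρ₂ = ρ₁ * v := by exact_mod_cast hk1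
    rw [div_lt_div_iff₀ hβ₁ hβ₂] at hlt'
    have h2 : 0 ≤ (ρ₁ : ℝ) * v * symmetryIndex T₂ :=
      mul_nonneg (by positivity) hT₂.symmetryIndex_nonneg
    -- The chain below combines R₁v = uR₂, B₁v' ≤ |w|B₂ and |w|vσ₂ ≤ uv'σ₁; the factor uv' makes all
    -- constants cancel.
    refine absurd hlt' (not_lt.mpr (le_of_mul_le_mul_left ?_ (mul_pos hur hvr')))
    calc (u : ℝ) * v' * (ρ₂ * symmetryIndex T₂ * β₁)
        = (u * ρ₂) * symmetryIndex T₂ * (β₁ * v') := by ring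
      _ = ρ₁ * v * symmetryIndex T₂ * (β₁ * v') := by rw [hk1r]
      _ ≤ ρ₁ * v * symmetryIndex T₂ * (w.natAbs * β₂) := mul_le_mul_of_nonneg_left h1r h2
      _ = ρ₁ * β₂ * (w.natAbs * v * symmetryIndex T₂) := by ring
      _ ≤ ρ₁ * β₂ * (u * v' * symmetryIndex T₁) :=
          mul_le_mul_of_nonneg_left hσ (by positivity)
      _ = _ := by ring
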